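/- **Setting.** For $r\in(0,1)$ let $A_r=\{z\in\mathbb C: r<|z|<r^{-1}\}$. Let $0<r_3<r_2<r_1<1$ and let $\tau$ be holomorphically $(r_2,r_3)$-expansive on $A_{r_1}$, that is, $\tau$ is holomorphic on (a neighbourhood of) the closure of $A_{r_1}$, and either $$r_3<|\tau(z)|<r_2\ \text{ for } |z|=r_1,\qquad r_2^{-1}<|\tau(z)|<r_3^{-1}\ \text{ for } |z|=r_1^{-1},$$ or $$r_2^{-1}<|\tau(z)|<r_3^{-1}\ \text{ for } |z|=r_1,\qquad r_3<|\tau(z)|<r_2\ \text{ for } |z|=r_1^{-1}.$$ Assume moreover that $\tau$ has no zero in $A_{r_1}$. Let $r=\sqrt{r_1r_2}$, and let $H^2(A_r^c)$ be the Hilbert space completion of the Laurent polynomials with respect to the norm $\|f\|=\big(\sum_{n\in\mathbb Z}|c_n(f)|^2r^{2|n|}\big)^{1/2}$, where $c_n(f)=\frac1{2\pi}\int_0^{2\pi}f(e^{it})e^{-int}\,dt$; matching Fourier coefficients embeds $L^2(\mathbb T)$ in it. **Theorem.** The Koopman operator $C_\tau f=f\circ\tau$ (defined on Laurent polynomials $f$,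 with $f\circ\tau\in L^2(\mathbb T)$, and extended continuously) is a well-defined Hilbert–Schmidt operator on $H^2(A_r^c)$. Its spectrum $\operatorname{spec}(C_\tau)$ is either a finite set or a sequence of distinct non-zero numbers converging to zero together with zero itself, and each non-zero spectral point is an eigenvalue of finite algebraic multiplicity. Furthermore, let $\alpha\in\mathbb R$, and for every $n\ge1$ let $m=m(n)\in\mathbb N$ satisfy $$m\ge\frac{\log(r_2r_3)}{\log r_1}\,n .$$ Let $\psi_l(z)=z^l$ for $|l|<n$, $z^{(j)}=e^{2\pi ij/m+i\alpha}$ for $0\le j<m$, and $$G_{k,l}=\frac1m\sum_{j=0}^{m-1}\psi_k\big(\tau(z^{(j)})\big)\overline{\psi_l(z^{(j)})},\qquad H_{k,l}=\frac1m\sum_{j=0}^{m-1}\psi_k(z^{(j)})\overline{\psi_l(z^{(j)})}\qquad(|k|,|l|<n).$$ Then $H$ is invertible, and with the $(2n-1)\times(2n-1)$ EDMD matrix $M_n=GH^{-1}$ the following hold. (a) Any convergent sequence $(\lambda_n)_{n\ge1}$ with $\lambda_n\in\operatorname{spec}(M_n)$ converges to a point of $\operatorname{spec}(C_\tau)$.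 (b) Conversely, for every $\lambda\in\operatorname{spec}(C_\tau)$ there is a sequence $(\lambda_n)$ with $\lambda_n\in\operatorname{spec}(M_n)$ and $\lambda_n\to\lambda$. If $\lambda$ is an eigenvalue of ascent $p$ (the least $p$ with $\ker(\lambda I-C_\tau)^p=\ker(\lambda I-C_\tau)^{p+1}$), then every such sequence satisfies $$|\lambda-\lambda_n|=O\big((r_2/r_1)^{n/(2p)}\big)\quad\text{as } n\to\infty.$$ (c) Let $\lambda\in\operatorname{spec}(C_\tau)$ be non-zero, let $(\lambda_n)$ be any sequence with $\lambda_n\in\operatorname{spec}(M_n)$ and $\lambda_n\to\lambda$, and for each $n$ let $\xi_n=(\xi_{n,k})_{|k|<n}$ be a generalised eigenvector of $M_n^T$ for the eigenvalue $\lambda_n$, normalised so that $\sum_{|k|<n}|\xi_{n,k}|^2r^{2|k|}=1$. Then the Laurent polynomials $h_n(z)=\sum_{|k|<n}\xi_{n,k}z^k$ satisfy $$\|\mathcal P h_n-h_n\|_{H^2(A_r^c)}=O\big((r_2/r_1)^{n/2}\big)\quad\text{as } n\to\infty,$$ where $\mathcal P$ is the spectral projection of $C_\tau$ associated to $\lambda$,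 that is, $\mathcal P=\frac1{2\pi i}\oint(zI-C_\tau)^{-1}dz$ over a circle about $\lambda$ such that no other point of $\operatorname{spec}(C_\tau)$ lies on or inside it. -/

import Mathlib

open Filter Topology

noncomputable section

namespace EDMD

/-- The annulus `A_r = {z : r < |z| < r⁻¹}`. -/
def annulus (r : ℝ) : Set ℂ := {z | r < ‖z‖ ∧ ‖z‖ < r⁻¹}

/-- `τ` is holomorphically `(r₂, r₃)`-expansive on `A_{r₁}`: it is holomorphic on (a neighbourhood
of) the closure of `A_{r₁}` and maps the two boundary circles of `A_{r₁}` into the two components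
of `A_{r₃}` minus the closure of `A_{r₂}`, one circle into each component. -/
structure HolomorphicallyExpansive (r₁ r₂ r₃ : ℝ) (τ : ℂ → ℂ) : Prop where
  pos : 0 < r₃
  lt₃₂ : r₃ < r₂
  lt₂₁ : r₂ < r₁
  lt_one : r₁ < 1
  holo : AnalyticOnNhd ℂ τ (closure (annulus r₁))
  expansive :
    ((∀ z : ℂ, ‖z‖ = r₁ → r₃ < ‖τ z‖ ∧ ‖τ z‖ < r₂) ∧
      (∀ z : ℂ, ‖z‖ = r₁⁻¹ → r₂⁻¹ < ‖τ z‖ ∧ ‖τ z‖ < r₃⁻¹)) ∨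
    ((∀ z : ℂ, ‖z‖ = r₁ → r₂⁻¹ < ‖τ z‖ ∧ ‖τ z‖ < r₃⁻¹) ∧
      (∀ z : ℂ, ‖z‖ = r₁⁻¹ → r₃ < ‖τ z‖ ∧ ‖τ z‖ < r₂))

/-! ### The Hilbert space `H²(A_rᶜ)` -/

/-- The Hilbert space `H²(A_rᶜ)`, the completion of the Laurent polynomials for the norm
`(∑ |c_n|² r^(2|n|))^(1/2)`. It is realised by the coordinates with respect to its orthonormal
basis `e_n(z) = r^(-|n|) z^n`: the family `a ∈ ℓ²(ℤ)` stands for `∑ a_n e_n`, that is, for the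
(formal) Laurent series with the coefficients `HardyC.coeff r a n = r^(-|n|) a_n`. See
`HardyC.norm_sq_ofLaurent` and `HardyC.denseRange_ofLaurent` for the completion property. -/
abbrev HardyC (_r : ℝ) : Type := lp (fun _ : ℤ => ℂ) 2

/-- The `n`-th Fourier (Laurent) coefficient of an element of `H²(A_rᶜ)`. -/
def HardyC.coeff (r : ℝ) (f : HardyC r) (n : ℤ) : ℂ := ((r : ℂ) ^ n.natAbs)⁻¹ * f n

/-- The Laurent polynomial with finitely many nonzero coefficients `p n`, as a function on `ℂ`. -/
def laurentFun (p : ℤ →₀ ℂ) (z : ℂ) : ℂ := p.sum fun n a => a * z ^ n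

/-- The inclusion of the Laurent polynomials (given by their coefficients) in `H²(A_rᶜ)`. -/
def HardyC.ofLaurent (r : ℝ) : (ℤ →₀ ℂ) →ₗ[ℂ] HardyC r :=
  Finsupp.lsum ℂ fun n => ((r : ℂ) ^ n.natAbs) • lp.lsingle (𝕜 := ℂ) (E := fun _ : ℤ => ℂ) 2 n

theorem HardyC.ofLaurent_apply (r : ℝ) (p : ℤ →₀ ℂ) (n : ℤ) :
    HardyC.ofLaurent r p n = (r : ℂ) ^ n.natAbs * p n := by
  classical
  induction p using Finsupp.induction_linear with
  | zero => simp
  | add f g hf hg => simp [hf, hg, mul_add]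
  | single k a =>
    have e : HardyC.ofLaurent r (Finsupp.single k a) =
        ((r : ℂ) ^ k.natAbs) • lp.single (E := fun _ : ℤ => ℂ) 2 k a := by
      simp only [HardyC.ofLaurent, Finsupp.lsum_single, LinearMap.smul_apply]
      rfl
    rw [e, lp.coeFn_smul, Pi.smul_apply, lp.single_apply, smul_eq_mul]
    rcases eq_or_ne n k with rfl | h
    · simp
    · simp [h]

theorem HardyC.coeff_ofLaurent {r : ℝ} (hr : 0 < r) (p : ℤ →₀ ℂ) (n : ℤ) :
    HardyC.coeff r (HardyC.ofLaurent r p) n = p n := by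
  have h : ((r : ℂ) ^ n.natAbs) ≠ 0 := pow_ne_zero _ (by exact_mod_cast hr.ne')
  rw [HardyC.coeff, HardyC.ofLaurent_apply, inv_mul_cancel_left₀ h]

theorem HardyC.norm_sq_ofLaurent (r : ℝ) (p : ℤ →₀ ℂ) :
    ‖HardyC.ofLaurent r p‖ ^ 2 = ∑ n ∈ p.support, ‖p n‖ ^ 2 * r ^ (2 * n.natAbs) := by
  have h := lp.norm_rpow_eq_tsum (p := 2) (by norm_num) (HardyC.ofLaurent r p)
  simp only [ENNReal.toReal_ofNat, Real.rpow_ofNat, HardyC.ofLaurent_apply] at h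
  rw [h, tsum_eq_sum (s := p.support)]
  · refine Finset.sum_congr rfl fun n _ => ?_
    rw [norm_mul, norm_pow, Complex.norm_real, mul_pow, ← pow_mul, Real.norm_eq_abs,
      mul_comm n.natAbs 2, pow_mul, sq_abs, ← pow_mul, mul_comm]
  · intro n hn
    simp [Finsupp.notMem_support_iff.mp hn]

theorem HardyC.denseRange_ofLaurent {r : ℝ} (hr : 0 < r) :
    DenseRange (HardyC.ofLaurent r) := by
  intro f
  refine mem_closure_of_tendsto (lp.hasSum_single (by norm_num) f)
    (Filter.Eventually.of_forall fun s => ?_)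
  refine ⟨∑ n ∈ s, Finsupp.single n (((r : ℂ) ^ n.natAbs)⁻¹ * f n), ?_⟩
  rw [map_sum]
  refine Finset.sum_congr rfl fun n _ => ?_
  have h : ((r : ℂ) ^ n.natAbs) ≠ 0 := pow_ne_zero _ (by exact_mod_cast hr.ne')
  simp only [HardyC.ofLaurent, Finsupp.lsum_single, LinearMap.smul_apply]
  rw [← LinearMap.map_smul, smul_eq_mul, mul_inv_cancel_left₀ h]
  rfl

/-- The Fourier coefficient `c_n(g) = (2π)⁻¹ ∫₀^{2π} g(e^{it}) e^{-int} dt` of a function on the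
unit circle. -/
def circleCoeff (g : ℂ → ℂ) (n : ℤ) : ℂ :=
  (2 * (Real.pi : ℂ))⁻¹ * ∫ t in (0 : ℝ)..2 * Real.pi,
    g (Complex.exp (t * Complex.I)) * Complex.exp (-(n * t * Complex.I))

/-- `g` is square-integrable on the unit circle and `f` is its image under the inclusion
`L²(𝕋) ⊆ H²(A_rᶜ)`, which is given by equality of the Fourier coefficients. -/
def Represents (r : ℝ) (g : ℂ → ℂ) (f : HardyC r) : Prop :=
  MeasureTheory.MemLp (fun t : ℝ => g (Complex.exp (t * Complex.I))) 2
      (MeasureTheory.volume.restrict (Set.Ioc 0 (2 * Real.pi))) ∧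
    ∀ n : ℤ, HardyC.coeff r f n = circleCoeff g n

/-- The bounded operator `C` is the Koopman operator `f ↦ f ∘ τ` on `H²(A_rᶜ)`: it maps every
Laurent polynomial `p` to `p ∘ τ`. As the Laurent polynomials are dense, this determines `C`. -/
def IsKoopman (r : ℝ) (τ : ℂ → ℂ) (C : HardyC r →L[ℂ] HardyC r) : Prop :=
  ∀ p : ℤ →₀ ℂ, Represents r (fun z => laurentFun p (τ z)) (C (HardyC.ofLaurent r p))

/-! ### Operators on Hilbert spaces -/

section Operators

universe u

variable {H : Type u} [NormedAddCommGroup H] [InnerProductSpace ℂ H]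

/-- Hilbert–Schmidt operators: `∑ ‖T b_i‖² < ∞` for an orthonormal basis `b` (the sum does not
depend on the basis). -/
def IsHilbertSchmidt (T : H →L[ℂ] H) : Prop :=
  ∃ (ι : Type u) (b : HilbertBasis ι ℂ H), Summable fun i => ‖T (b i)‖ ^ 2

/-- `p` is the ascent of `lam` for `T`: the least `p` for which the kernels of `(lam - T)^p` and
`(lam - T)^(p+1)` coincide. -/
def IsAscent (T : H →L[ℂ] H) (lam : ℂ) (p : ℕ) : Prop :=
  IsLeast {q : ℕ | ∀ x : H, ((lam • (1 : H →L[ℂ] H) - T) ^ q) x = 0 ↔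
    ((lam • (1 : H →L[ℂ] H) - T) ^ (q + 1)) x = 0} p

/-- `P` is the spectral (Riesz) projection of `T` at the isolated spectral point `lam`:
`P = (2πi)⁻¹ ∮ (z - T)⁻¹ dz` over a circle about `lam` such that no other spectral point of `T`
lies on or inside the circle. -/
def IsSpectralProjection (T : H →L[ℂ] H) (lam : ℂ) (P : H →L[ℂ] H) : Prop :=
  ∃ ε : ℝ, 0 < ε ∧ spectrum ℂ T ∩ Metric.closedBall lam ε = {lam} ∧
    P = (2 * (Real.pi : ℂ) * Complex.I)⁻¹ • ∮ z in C(lam, ε), resolvent T z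

end Operators

/-! ### The EDMD matrices -/

section Matrices

variable {ι : Type*} {m : ℕ}

/-- `G_{k,l} = m⁻¹ ∑_j ψ_k(τ(z_j)) conj(ψ_l(z_j))`. -/
def edmdG (ψ : ι → ℂ → ℂ) (τ : ℂ → ℂ) (z : Fin m → ℂ) : Matrix ι ι ℂ :=
  Matrix.of fun k l => (m : ℂ)⁻¹ * ∑ j, ψ k (τ (z j)) * starRingEnd ℂ (ψ l (z j))

/-- `H_{k,l} = m⁻¹ ∑_j ψ_k(z_j) conj(ψ_l(z_j))`. -/
def edmdH (ψ : ι → ℂ → ℂ) (z : Fin m → ℂ) : Matrix ι ι ℂ :=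
  Matrix.of fun k l => (m : ℂ)⁻¹ * ∑ j, ψ k (z j) * starRingEnd ℂ (ψ l (z j))

/-- The EDMD matrix `M = G H⁻¹`. -/
def edmdMatrix [Fintype ι] [DecidableEq ι] (ψ : ι → ℂ → ℂ) (τ : ℂ → ℂ) (z : Fin m → ℂ) :
    Matrix ι ι ℂ :=
  edmdG ψ τ z * (edmdH ψ z)⁻¹

end Matrices

/-- The `2n - 1` indices `-(n-1), …, n-1`. -/
abbrev Idx (n : ℕ) : Type := {k : ℤ // k ∈ Finset.Ioo (-(n : ℤ)) (n : ℤ)}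

/-- The observables `ψ_l(z) = z^l`, `|l| < n`. -/
def observable (n : ℕ) (l : Idx n) (z : ℂ) : ℂ := z ^ (l : ℤ)

/-- The equidistant points `z_j = e^{2πij/m + iα}`, `0 ≤ j < m`, on the unit circle. -/
def node (m : ℕ) (α : ℝ) (j : Fin m) : ℂ :=
  Complex.exp (2 * Real.pi * Complex.I * (j : ℕ) / m + Complex.I * α)

/-- The matrix `H` for the Laurent monomials and the equidistant points. -/
def laurentH (n m : ℕ) (α : ℝ) : Matrix (Idx n) (Idx n) ℂ :=
  edmdH (observable n) (node m α)

/-- The EDMD matrix `M` for the Laurent monomials and the equidistant points. -/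
def laurentM (τ : ℂ → ℂ) (n m : ℕ) (α : ℝ) : Matrix (Idx n) (Idx n) ℂ :=
  edmdMatrix (observable n) τ (node m α)

/-- `ξ` is a generalised eigenvector of `A` for `lam`: a nonzero vector that some power of `lam - A`
annihilates. -/
def IsGenEigenvector {ι : Type*} [Fintype ι] [DecidableEq ι] (A : Matrix ι ι ℂ) (lam : ℂ)
    (ξ : ι → ℂ) : Prop :=
  ξ ≠ 0 ∧ ∃ ν : ℕ, ((lam • (1 : Matrix ι ι ℂ) - A) ^ ν).mulVec ξ = 0

/-- The Laurent polynomial `∑_{|k|<n} ξ_k z^k`, by its coefficients. -/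
def laurentOfVec {n : ℕ} (ξ : Idx n → ℂ) : ℤ →₀ ℂ := ∑ k : Idx n, Finsupp.single (k : ℤ) (ξ k)

end EDMD

end

/-! Put ρ = r/r₁ = r₂/r = (r₂/r₁)^(1/2). In the orthonormal basis the Koopman operator C has the
entries r^(|l|-|k|) c_l(τ^k). On one of the two boundary circles |τ^k| ≤ r₂^|k|, and Cauchy's
estimate on that circle bounds the entry by ρ^(|k|+|l|) (`norm_koopEntry_le`). Hence the columns of
C have summable norms, which makes C compact and Hilbert–Schmidt.

Acting by the transpose of M_n on Laurent coefficients of index below n, and by zero on the others,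
defines a finite rank operator `approxOp`. It differs from C by the truncation, of size ρ^n, and by
the aliasing of equidistant sampling. Aliasing mixes c_l with the c_p for p ≡ l mod m, and these
satisfy the second bound r₃^(-|k|) r₁^|p|. The condition on m says r₁^m ≤ (r₂r₃)^n, which is what
makes this error O(ρ^n) as well. So the operators converge in norm at the rate ρ^n
(`exists_norm_approxOp_sub_le`).

What remains at nonzero points is perturbation theory of compact operators. Limits of spectral
points are spectral (`mem_spectrum_of_tendsto`); isolated nonzero spectral points are approximated,
by the maximum principle for the resolvent (`eventually_exists_mem_spectrum`); near a point of
ascent p the resolvent grows at most like |z-μ|^(-p), which yields the exponent n/(2p)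
(`exists_resolvent_growth`, `eventually_norm_sub_pow_le`); and Riesz projections depend on the
operator in a Lipschitz way (`eventually_norm_riesz_sub_le`).

The point 0 needs two further arguments, since `approxOp` always has 0 in its spectrum and norm
convergence says nothing about M_n there. That M_n has small eigenvalues follows from its
determinant, which is at most of order (Kn)^(2n-1) ρ^(n(n-1)) (`eventually_exists_small`). That the
rate in (b) need not be considered at 0 follows from the injectivity of C (`koopOp_injective`):
integrating against τ^(-j) zτ'/τ isolates a single coefficient times the mapping degree of τ, and
this degree is nonzero because the mean of log|τ| changes between the boundary circles. -/

namespace EDMD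

/-! ### Riesz theory: ascent, generalised eigenspaces and resolvent growth of compact operators -/

section CompactOperators

variable {H : Type*} [NormedAddCommGroup H] [InnerProductSpace ℂ H]

/-- `lam - T`. -/
abbrev shift (T : H →L[ℂ] H) (lam : ℂ) : H →L[ℂ] H := lam • (1 : H →L[ℂ] H) - T

theorem shift_eq_algebraMap_sub (T : H →L[ℂ] H) (lam : ℂ) :
    shift T lam = algebraMap ℂ (H →L[ℂ] H) lam - T := by
  rw [Algebra.algebraMap_eq_smul_one]

theorem shift_apply (T : H →L[ℂ] H) (lam : ℂ) (x : H) : shift T lam x = lam • x - T x := by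
  simp [shift]

theorem pow_apply_eq_zero_of_le {S : H →L[ℂ] H} {p q : ℕ} (h : p ≤ q) {x : H}
    (hx : (S ^ p) x = 0) : (S ^ q) x = 0 := by
  obtain ⟨k, rfl⟩ := Nat.exists_eq_add_of_le' h
  rw [pow_add, mul_apply_eq_comp, hx, map_zero]

theorem pow_apply_eq_zero_of_ascent {S : H →L[ℂ] H} {p : ℕ}
    (hp : ∀ x, (S ^ p) x = 0 ↔ (S ^ (p + 1)) x = 0) (q : ℕ) {x : H} (hx : (S ^ q) x = 0) :
    (S ^ p) x = 0 := by
  rcases le_total q p with h | h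
  · exact pow_apply_eq_zero_of_le h hx
  · obtain ⟨k, rfl⟩ := Nat.exists_eq_add_of_le h
    induction k generalizing x with
    | zero => simpa using hx
    | succ k ih =>
      have h1 : (S ^ (p + k)) (S x) = 0 := by
        rw [← mul_apply_eq_comp, ← pow_succ]; exact hx
      have h2 := ih h1 (Nat.le_add_right p k)
      rw [← mul_apply_eq_comp, ← pow_succ] at h2
      exact (hp x).2 h2

theorem exists_unit_orthogonal_of_lt {K L : Submodule ℂ H} [K.HasOrthogonalProjection]
    (hKL : K < L) : ∃ y ∈ L, ‖y‖ = 1 ∧ ∀ w ∈ K, inner ℂ y w = 0 := by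
  obtain ⟨x, hxL, hxK⟩ := SetLike.exists_of_lt hKL
  have hy : x - K.starProjection x ∈ Kᗮ := K.sub_starProjection_mem_orthogonal x
  have hy0 : x - K.starProjection x ≠ 0 := by
    intro h
    rw [sub_eq_zero] at h
    exact hxK (h ▸ K.starProjection_apply_mem x)
  set y := x - K.starProjection x
  refine ⟨((‖y‖⁻¹ : ℝ) : ℂ) • y, L.smul_mem _ (L.sub_mem hxL
    (hKL.le (K.starProjection_apply_mem x))), ?_, fun w hw => ?_⟩
  · rw [norm_smul, Complex.norm_real, norm_inv, norm_norm, inv_mul_cancel₀ (norm_ne_zero_iff.2 hy0)]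
  · rw [inner_smul_left, (Submodule.mem_orthogonal' K y).1 hy w hw, mul_zero]

/-- By the binomial expansion, mu^p - (mu - T)^p is divisible by T. On the kernel of (mu - T)^p the
compact operator T * B is thus the scalar mu^p, which forces that kernel to be finite-dimensional if
mu ≠ 0. -/
theorem exists_shift_pow_eq (T : H →L[ℂ] H) (mu : ℂ) (p : ℕ) :
    ∃ B : H →L[ℂ] H, shift T mu ^ p = (mu ^ p) • (1 : H →L[ℂ] H) - T * B := by
  induction p with
  | zero => exact ⟨0, by simp⟩
  | succ p ih =>
    obtain ⟨B, hB⟩ := ih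
    refine ⟨mu ^ p • 1 + mu • B - T * B, ?_⟩
    rw [pow_succ', hB, shift]
    simp only [sub_mul, mul_sub, smul_mul_assoc, mul_smul_comm, one_mul, mul_one, mul_add,
      pow_succ', mul_smul, smul_sub]
    module

theorem mem_maxGenEigenspace_iff (T : H →L[ℂ] H) (mu : ℂ) (x : H) :
    x ∈ Module.End.maxGenEigenspace (T : H →ₗ[ℂ] H) mu ↔ ∃ k, (shift T mu ^ k) x = 0 := by
  have key : ∀ k, (((T : Module.End ℂ H) - mu • 1) ^ k) x = (-1 : ℂ) ^ k • (shift T mu ^ k) x := by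
    intro k
    have h1 : ∀ y, ((T : Module.End ℂ H) - mu • 1) y = (-1 : ℂ) • shift T mu y := by
      intro y; simp [shift]
    induction k with
    | zero => simp
    | succ k ih =>
      rw [pow_succ', Module.End.mul_apply, ih, h1, map_smul, pow_succ' (shift T mu),
        mul_apply_eq_comp, smul_smul, pow_succ']
  rw [Module.End.mem_maxGenEigenspace]
  refine exists_congr fun k => ?_
  rw [key, smul_eq_zero]
  simp

theorem exists_bound_of_isUnit {A : H →L[ℂ] H} (hA : IsUnit A) :
    ∃ K > 0, ∀ x, ‖x‖ ≤ K * ‖A x‖ := by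
  obtain ⟨u, rfl⟩ := hA
  refine ⟨‖((u⁻¹ : (H →L[ℂ] H)ˣ) : H →L[ℂ] H)‖ + 1, by positivity, fun x => ?_⟩
  have h : x = ((u⁻¹ : (H →L[ℂ] H)ˣ) : H →L[ℂ] H) ((u : H →L[ℂ] H) x) := by
    rw [← mul_apply_eq_comp, Units.inv_mul, one_apply_eq_self]
  calc ‖x‖ = ‖((u⁻¹ : (H →L[ℂ] H)ˣ) : H →L[ℂ] H) ((u : H →L[ℂ] H) x)‖ := by rw [← h]
    _ ≤ ‖((u⁻¹ : (H →L[ℂ] H)ˣ) : H →L[ℂ] H)‖ * ‖(u : H →L[ℂ] H) x‖ :=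
      ContinuousLinearMap.le_opNorm _ _
    _ ≤ _ := by gcongr; linarith

theorem exists_bound_shift_near {T : H →L[ℂ] H} {mu : ℂ} (h : mu ∈ resolventSet ℂ T) :
    ∃ δ > 0, ∃ K > 0, ∀ z, ‖z - mu‖ < δ → ∀ x, ‖x‖ ≤ K * ‖shift T z x‖ := by
  rw [spectrum.mem_resolventSet_iff, ← shift_eq_algebraMap_sub] at h
  obtain ⟨K, hK, hb⟩ := exists_bound_of_isUnit h
  -- Within this radius the perturbation costs at most half of ‖x‖, which is absorbed on the left
  -- and doubles the constant.
  refine ⟨1 / (2 * K), by positivity, 2 * K, by positivity, fun z hz x => ?_⟩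
  have h1 : shift T mu x = shift T z x - (z - mu) • x := by
    simp only [shift_apply, sub_smul]; abel
  have h2 : ‖(z - mu) • x‖ ≤ 1 / (2 * K) * ‖x‖ := by
    rw [norm_smul]; gcongr
  have h3 : K * (1 / (2 * K) * ‖x‖) = ‖x‖ / 2 := by field_simp
  have h4 : ‖x‖ ≤ K * (‖shift T z x‖ + 1 / (2 * K) * ‖x‖) := by
    refine (hb x).trans ?_
    gcongr
    rw [h1]
    exact (norm_sub_le _ _).trans (by gcongr)
  rw [mul_add, h3] at h4
  linarith

/-- On the kernel of a power of `S`, the operator `w + S` is bounded below by a multiple of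
`‖w‖ ^ p`. -/
theorem exists_bound_of_pow_ker (S : H →L[ℂ] H) (p : ℕ) :
    ∃ K, 0 ≤ K ∧ ∀ w : ℂ, ‖w‖ ≤ 1 → ∀ v, (S ^ p) v = 0 →
      ‖w‖ ^ p * ‖v‖ ≤ K * ‖w • v + S v‖ := by
  induction p with
  | zero => exact ⟨0, le_rfl, fun w _ v hv => by simp_all⟩
  | succ p ih =>
    obtain ⟨K, hK, h⟩ := ih
    refine ⟨1 + K * ‖S‖, by positivity, fun w hw v hv => ?_⟩
    have hSv : (S ^ p) (S v) = 0 := by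
      rw [← mul_apply_eq_comp, ← pow_succ]; exact hv
    have h1 := h w hw _ hSv
    set n := w • v + S v with hn
    -- The vector S v lies in the kernel of the lower power, and its image under w + S is S n; the
    -- induction hypothesis controls S v by n, and w • v = n - S v then controls v.
    have h2 : w • S v + S (S v) = S n := by rw [hn]; simp
    rw [h2] at h1
    have h3 : w • v = n - S v := by rw [hn]; abel
    have h4 : ‖w‖ ^ p ≤ 1 := pow_le_one₀ (norm_nonneg _) hw
    calc ‖w‖ ^ (p + 1) * ‖v‖ = ‖w‖ ^ p * ‖w • v‖ := by rw [norm_smul]; ring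
      _ ≤ ‖w‖ ^ p * (‖n‖ + ‖S v‖) := by rw [h3]; gcongr; exact norm_sub_le _ _
      _ = ‖w‖ ^ p * ‖n‖ + ‖w‖ ^ p * ‖S v‖ := by ring
      _ ≤ 1 * ‖n‖ + K * (‖S‖ * ‖n‖) :=
        add_le_add (mul_le_mul_of_nonneg_right h4 (norm_nonneg _))
          (h1.trans (mul_le_mul_of_nonneg_left (S.le_opNorm n) hK))
      _ = _ := by ring

variable [CompleteSpace H]

/-- If the kernels of the powers of S increased strictly, unit vectors y_k in the (k+1)-st kernel
orthogonal to the k-th would have images under T at mutual distance at least ‖mu‖: modulo the k-th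
kernel, T y_k - T y_j is mu y_k for j < k. This contradicts compactness. -/
theorem exists_ascent {T : H →L[ℂ] H} (hT : IsCompactOperator T) {mu : ℂ} (hmu : mu ≠ 0) :
    ∃ p : ℕ, ∀ x, (shift T mu ^ p) x = 0 ↔ (shift T mu ^ (p + 1)) x = 0 := by
  by_contra hcon
  push Not at hcon
  set S := shift T mu with hS
  let K : ℕ → Submodule ℂ H := fun p => ((S ^ p : H →L[ℂ] H) : H →ₗ[ℂ] H).ker
  have memK : ∀ {p x}, x ∈ K p ↔ (S ^ p) x = 0 := by
    intro p x; rfl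
  have hclosed : ∀ p, IsClosed (K p : Set H) := fun p => (S ^ p).isClosed_ker
  have hcomp : ∀ p, CompleteSpace (K p) := fun p => (hclosed p).completeSpace_coe
  have hmono : Monotone K := fun p q h x hx => pow_apply_eq_zero_of_le h hx
  have hlt : ∀ p, K p < K (p + 1) := by
    intro p
    refine lt_of_le_of_ne (hmono (Nat.le_succ p)) fun h => ?_
    obtain ⟨x, hx⟩ := hcon p
    have : x ∈ K p ↔ x ∈ K (p + 1) := by rw [h]
    rw [memK, memK] at this
    tauto
  choose y hyL hy1 hyo using fun p => exists_unit_orthogonal_of_lt (hlt p)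
  have hTy : ∀ x, T x = mu • x - S x := by
    intro x; rw [hS, shift_apply]; abel
  have hSK : ∀ {p x}, x ∈ K (p + 1) → S x ∈ K p := by
    intro p x hx
    rw [memK, ← mul_apply_eq_comp, ← pow_succ]; exact hx
  have hfar : ∀ j k, j < k → ‖mu‖ ≤ ‖T (y k) - T (y j)‖ := by
    intro j k hjk
    have hj : T (y j) ∈ K k := by
      refine hmono (Nat.succ_le_of_lt hjk) ?_
      rw [hTy]
      exact (K (j + 1)).sub_mem ((K (j + 1)).smul_mem _ (hyL j))
        (hmono (Nat.le_succ j) (hSK (hyL j)))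
    have h1 : inner ℂ (y k) (T (y k) - T (y j)) = mu := by
      rw [hTy (y k), sub_sub, inner_sub_right,
        hyo k _ ((K k).add_mem (hSK (hyL k)) hj), inner_smul_right, inner_self_eq_norm_sq_to_K,
        hy1 k]
      simp
    calc ‖mu‖ = ‖inner ℂ (y k) (T (y k) - T (y j))‖ := by rw [h1]
      _ ≤ ‖y k‖ * ‖T (y k) - T (y j)‖ := norm_inner_le_norm _ _
      _ = _ := by rw [hy1 k, one_mul]
  obtain ⟨Q, hQ, hQ'⟩ := hT.image_closedBall_subset_compact 1
  obtain ⟨a, -, φ, hφ, hφa⟩ := hQ.tendsto_subseq (x := fun n => T (y n))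
    (fun n => hQ' ⟨y n, by simp [hy1], rfl⟩)
  have hc := hφa.cauchySeq
  rw [Metric.cauchySeq_iff'] at hc
  obtain ⟨N, hN⟩ := hc ‖mu‖ (norm_pos_iff.2 hmu)
  have h2 := hN (N + 1) (Nat.le_succ N)
  rw [dist_eq_norm] at h2
  exact absurd (hfar _ _ (hφ (Nat.lt_succ_self N))) (not_le.2 h2)

theorem finiteDimensional_ker_shift_pow {T : H →L[ℂ] H} (hT : IsCompactOperator T) {mu : ℂ}
    (hmu : mu ≠ 0) (p : ℕ) :
    FiniteDimensional ℂ (((shift T mu ^ p : H →L[ℂ] H) : H →ₗ[ℂ] H).ker) := by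
  obtain ⟨B, hB⟩ := exists_shift_pow_eq T mu p
  set K := ((shift T mu ^ p : H →L[ℂ] H) : H →ₗ[ℂ] H).ker with hK
  have hcl : IsClosed (K : Set H) := (shift T mu ^ p).isClosed_ker
  have : CompleteSpace K := hcl.completeSpace_coe
  have hTB : ∀ v ∈ K, (T * B) v = mu ^ p • v := by
    intro v hv
    have hv' : (shift T mu ^ p) v = 0 := hv
    rw [hB, sub_apply, sub_eq_zero] at hv'
    rw [← hv']; simp
  have hcomp : IsCompactOperator (((T * B : H →L[ℂ] H)) : H →ₗ[ℂ] H) := hT.comp_clm B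
  have hmaps : ∀ v ∈ K, ((T * B : H →L[ℂ] H) : H →ₗ[ℂ] H) v ∈ K := by
    intro v hv
    rw [ContinuousLinearMap.coe_coe, hTB v hv]
    exact K.smul_mem _ hv
  have hr := (hcomp.restrict' hmaps).smul ((mu ^ p)⁻¹)
  apply FiniteDimensional.of_isCompactOperator_id (𝕜 := ℂ)
  refine (congrArg IsCompactOperator (funext fun v => Subtype.ext ?_)).mp hr
  simp only [id, Pi.smul_apply, Submodule.coe_smul, LinearMap.coe_restrict_apply,
    ContinuousLinearMap.coe_coe]
  rw [hTB v v.2, inv_smul_smul₀ (pow_ne_zero _ hmu)]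

theorem finiteDimensional_maxGenEigenspace {T : H →L[ℂ] H} (hT : IsCompactOperator T) {mu : ℂ}
    (hmu : mu ≠ 0) :
    FiniteDimensional ℂ (Module.End.maxGenEigenspace (T : H →ₗ[ℂ] H) mu) := by
  obtain ⟨p, hp⟩ := exists_ascent hT hmu
  have := finiteDimensional_ker_shift_pow hT hmu p
  refine Submodule.finiteDimensional_of_le
    (S₂ := (((shift T mu ^ p : H →L[ℂ] H) : H →ₗ[ℂ] H).ker)) fun x hx => ?_
  obtain ⟨k, hk⟩ := (mem_maxGenEigenspace_iff T mu x).1 hx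
  exact pow_apply_eq_zero_of_ascent hp k hk

/-- Split H into N = ker S^p and its orthogonal complement. On N, S is nilpotent and
`exists_bound_of_pow_ker` gives the loss ‖z - mu‖^p. On the complement there is no loss: the
compression T' is compact, and mu is not an eigenvalue of it. Invariance of N lets 1 - P intertwine
z - T with z - T'. -/
theorem exists_bound_shift_ascent {T : H →L[ℂ] H} (hT : IsCompactOperator T) {mu : ℂ}
    (hmu : mu ≠ 0) {p : ℕ}
    (hp : ∀ x, (shift T mu ^ p) x = 0 ↔ (shift T mu ^ (p + 1)) x = 0) :
    ∃ δ > 0, ∃ K > 0, ∀ z, ‖z - mu‖ < δ → ∀ x, ‖z - mu‖ ^ p * ‖x‖ ≤ K * ‖shift T z x‖ := by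
  set S := shift T mu with hS
  set N := ((S ^ p : H →L[ℂ] H) : H →ₗ[ℂ] H).ker with hN
  have memN : ∀ {x}, x ∈ N ↔ (S ^ p) x = 0 := by intro x; rfl
  have hcl : IsClosed (N : Set H) := (S ^ p).isClosed_ker
  have : CompleteSpace N := hcl.completeSpace_coe
  set P := N.starProjection with hP
  have hPN : ∀ x, P x ∈ N := fun x => N.starProjection_apply_mem x
  have hPid : ∀ x ∈ N, P x = x := fun x hx => Submodule.starProjection_eq_self_iff.2 hx
  have hSN : ∀ x ∈ N, S x ∈ N := by
    intro x hx
    rw [memN] at hx ⊢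
    rw [← mul_apply_eq_comp, ← pow_succ, pow_succ', mul_apply_eq_comp, hx,
      map_zero]
  have hzS : ∀ z x, shift T z x = (z - mu) • x + S x := by
    intro z x; simp only [hS, shift_apply, sub_smul]; abel
  have hzN : ∀ z, ∀ x ∈ N, shift T z x ∈ N := by
    intro z x hx
    rw [hzS]; exact N.add_mem (N.smul_mem _ hx) (hSN x hx)
  set T' : H →L[ℂ] H := (1 - P) * T * (1 - P) with hT'
  have hT'c : IsCompactOperator T' :=
    (congrArg IsCompactOperator (funext fun x => by
      simp only [hT', mul_apply_eq_comp, Function.comp_apply])).mp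
      ((hT.clm_comp (1 - P)).comp_clm (1 - P))
  have hT's : ∀ z x, (1 - P) (shift T z x) = shift T' z ((1 - P) x) := by
    intro z x
    have e1 : x = (1 - P) x + P x := by simp
    have e2 : P ((1 - P) x) = 0 := by
      rw [sub_apply, map_sub, one_apply_eq_self,
        hPid _ (hPN x), sub_self]
    have e3 : (1 - P) (shift T z (P x)) = 0 := by
      have := hPid _ (hzN z _ (hPN x))
      rw [sub_apply, this]; simp
    set u := (1 - P) x with hu
    have e4 : (1 - P) u = u := by rw [sub_apply, e2]; simp
    conv_lhs => rw [e1, map_add, map_add, e3, add_zero]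
    rw [shift_apply, shift_apply, map_sub, map_smul, e4, hT']
    simp only [mul_apply_eq_comp, e4]
  have hres : mu ∈ resolventSet ℂ T' := by
    refine (hT'c.hasEigenvalue_or_mem_resolventSet hmu).resolve_left fun hev => ?_
    obtain ⟨x, hx, hx0⟩ := hev.exists_hasEigenvector
    rw [Module.End.mem_eigenspace_iff] at hx
    have hx' : T' x = mu • x := hx
    have hPx : P x = 0 := by
      have : P (T' x) = 0 := by
        rw [hT', mul_assoc, mul_apply_eq_comp, sub_apply, map_sub,
          one_apply_eq_self, hPid _ (hPN _), sub_self]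
      rw [hx', map_smul, smul_eq_zero] at this
      exact this.resolve_left hmu
    have h1x : (1 - P) x = x := by rw [sub_apply, hPx]; simp
    have h0 : (1 - P) (S x) = 0 := by
      rw [hS, hT's, h1x, shift_apply, hx', sub_self]
    -- An eigenvector x of T' for mu has S x in N, so S^(p+1) x = 0. As p is the ascent, x itself
    -- lies in N, while P x = 0.
    have hSx : S x ∈ N := by
      rw [sub_apply, one_apply_eq_self, sub_eq_zero] at h0
      rw [h0]; exact hPN _
    have hxN : x ∈ N := by
      rw [memN] at hSx ⊢
      rw [hp, pow_succ, mul_apply_eq_comp]; exact hSx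
    exact hx0 (by rw [← hPid x hxN, hPx])
  obtain ⟨δ, hδ, K, hK, hb⟩ := exists_bound_shift_near hres
  obtain ⟨K', hK', hb'⟩ := exists_bound_of_pow_ker S p
  have hQ : ∀ x, ‖(1 - P) x‖ ≤ ‖x‖ := by
    intro x
    have : (1 - P) x = Nᗮ.starProjection x := by
      rw [Submodule.starProjection_orthogonal]; simp [hP]
    rw [this]
    exact Nᗮ.norm_starProjection_apply_le x
  set M := ‖mu‖ + 1 + ‖T‖ with hM
  refine ⟨min δ 1, by positivity, K + K' * (1 + M * K) + 1, by positivity, fun z hz x => ?_⟩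
  have hzδ : ‖z - mu‖ < δ := hz.trans_le (min_le_left _ _)
  have hz1 : ‖z - mu‖ ≤ 1 := (hz.trans_le (min_le_right _ _)).le
  set y := shift T z x with hy
  set u := (1 - P) x with hu
  have hub : ‖u‖ ≤ K * ‖y‖ := by
    refine (hb z hzδ u).trans ?_
    gcongr
    rw [hu, ← hT's]
    exact hQ _
  have hxu : x = u + P x := by simp [hu]
  -- The component in N is estimated only after the complementary component u, whose image under z -
  -- T is moved to the right-hand side.
  have hn : (z - mu) • P x + S (P x) = y - shift T z u := by
    rw [← hzS, hy]
    nth_rewrite 2 [hxu]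
    rw [map_add]; abel
  have hshift : ‖shift T z u‖ ≤ M * ‖u‖ := by
    rw [shift_apply]
    have hzn : ‖z‖ ≤ ‖mu‖ + 1 := by
      calc ‖z‖ = ‖mu + (z - mu)‖ := by congr 1; ring
        _ ≤ ‖mu‖ + ‖z - mu‖ := norm_add_le _ _
        _ ≤ _ := by gcongr
    calc ‖z • u - T u‖ ≤ ‖z • u‖ + ‖T u‖ := norm_sub_le _ _
      _ ≤ (‖mu‖ + 1) * ‖u‖ + ‖T‖ * ‖u‖ := by
        rw [norm_smul]; gcongr; exact T.le_opNorm u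
      _ = M * ‖u‖ := by rw [hM]; ring
  have hv := hb' (z - mu) hz1 (P x) (memN.1 (hPN x))
  rw [hn] at hv
  have hyb : ‖y - shift T z u‖ ≤ (1 + M * K) * ‖y‖ := by
    calc ‖y - shift T z u‖ ≤ ‖y‖ + ‖shift T z u‖ := norm_sub_le _ _
      _ ≤ ‖y‖ + M * (K * ‖y‖) := by
        gcongr
        exact hshift.trans (by gcongr)
      _ = _ := by ring
  have hpow : ‖z - mu‖ ^ p ≤ 1 := pow_le_one₀ (norm_nonneg _) hz1
  calc ‖z - mu‖ ^ p * ‖x‖ ≤ ‖z - mu‖ ^ p * (‖u‖ + ‖P x‖) := by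
        gcongr; nth_rewrite 1 [hxu]; exact norm_add_le _ _
    _ = ‖z - mu‖ ^ p * ‖u‖ + ‖z - mu‖ ^ p * ‖P x‖ := by ring
    _ ≤ 1 * (K * ‖y‖) + K' * ((1 + M * K) * ‖y‖) :=
      add_le_add (mul_le_mul hpow hub (norm_nonneg _) zero_le_one)
        (hv.trans (mul_le_mul_of_nonneg_left hyb hK'))
    _ ≤ _ := by nlinarith [norm_nonneg y]

/-- Near a nonzero point of ascent `p`, a compact operator has a resolvent, which grows at most
like `‖z - mu‖ ^ (-p)`. -/
theorem exists_resolvent_growth {T : H →L[ℂ] H} (hT : IsCompactOperator T) {mu : ℂ}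
    (hmu : mu ≠ 0) {p : ℕ}
    (hp : ∀ x, (shift T mu ^ p) x = 0 ↔ (shift T mu ^ (p + 1)) x = 0) :
    ∃ δ > 0, ∃ K > 0, ∀ z, z ≠ mu → ‖z - mu‖ < δ →
      z ∈ resolventSet ℂ T ∧ ∀ x, ‖z - mu‖ ^ p * ‖x‖ ≤ K * ‖shift T z x‖ := by
  obtain ⟨δ, hδ, K, hK, h⟩ := exists_bound_shift_ascent hT hmu hp
  -- Keeping z within ‖mu‖ of mu ensures z ≠ 0, so that the Fredholm alternative applies at z.
  refine ⟨min δ ‖mu‖, lt_min hδ (norm_pos_iff.2 hmu), K, hK, fun z hz hzd =>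
    ⟨?_, h z (hzd.trans_le (min_le_left _ _))⟩⟩
  have hz0 : z ≠ 0 := by
    rintro rfl
    have := hzd.trans_le (min_le_right _ _)
    simp at this
  refine (hT.hasEigenvalue_or_mem_resolventSet hz0).resolve_left fun hev => ?_
  obtain ⟨x, hx, hx0⟩ := hev.exists_hasEigenvector
  rw [Module.End.mem_eigenspace_iff] at hx
  have hx' : T x = z • x := hx
  have hb := h z (hzd.trans_le (min_le_left _ _)) x
  rw [shift_apply, hx', sub_self, norm_zero, mul_zero] at hb
  have hpos : 0 < ‖z - mu‖ ^ p * ‖x‖ :=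
    mul_pos (pow_pos (norm_pos_iff.2 (sub_ne_zero.2 hz)) _) (norm_pos_iff.2 hx0)
  linarith

theorem exists_punctured_ball_resolvent {T : H →L[ℂ] H} (hT : IsCompactOperator T) {mu : ℂ}
    (hmu : mu ≠ 0) : ∃ δ > 0, ∀ z, z ≠ mu → ‖z - mu‖ < δ → z ∈ resolventSet ℂ T := by
  obtain ⟨p, hp⟩ := exists_ascent hT hmu
  obtain ⟨δ, hδ, K, -, h⟩ := exists_resolvent_growth hT hmu hp
  exact ⟨δ, hδ, fun z hz hzd => (h z hz hzd).1⟩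

theorem exists_isolating_radius {T : H →L[ℂ] H} (hT : IsCompactOperator T) {mu : ℂ}
    (hmu : mu ≠ 0) (hs : mu ∈ spectrum ℂ T) {η : ℝ} (hη : 0 < η) :
    ∃ ε > 0, ε < η ∧ spectrum ℂ T ∩ Metric.closedBall mu ε = {mu} := by
  obtain ⟨δ, hδ, h⟩ := exists_punctured_ball_resolvent hT hmu
  refine ⟨min δ η / 2, by positivity, ?_, ?_⟩
  · have := min_le_right δ η; linarith
  ext z
  simp only [Set.mem_inter_iff, Metric.mem_closedBall, dist_eq_norm, Set.mem_singleton_iff]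
  constructor
  · rintro ⟨hz, hzd⟩
    by_contra hne
    refine hz (h z hne (lt_of_le_of_lt hzd ?_))
    have := min_le_left δ η; linarith
  · rintro rfl
    exact ⟨hs, by simp; positivity⟩

/-- The set is compact, and it is discrete because nonzero spectral points are isolated. -/
theorem finite_spectrum_diff_ball {T : H →L[ℂ] H} (hT : IsCompactOperator T) {η : ℝ}
    (hη : 0 < η) : {z ∈ spectrum ℂ T | η ≤ ‖z‖}.Finite := by
  have hc : IsCompact {z ∈ spectrum ℂ T | η ≤ ‖z‖} :=
    (spectrum.isCompact T).inter_right (isClosed_le continuous_const continuous_norm)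
  refine hc.finite (isDiscrete_iff_forall_mem_exists_isOpen.2 ?_) 
  rintro z ⟨hz, hzη⟩
  have hz0 : z ≠ 0 := by rintro rfl; simp at hzη; linarith
  obtain ⟨δ, hδ, h⟩ := exists_punctured_ball_resolvent hT hz0
  refine ⟨Metric.ball z δ, Metric.isOpen_ball, ?_⟩
  ext w
  simp only [Set.mem_inter_iff, Metric.mem_ball, dist_eq_norm, Set.mem_singleton_iff]
  constructor
  · rintro ⟨hwd, hw, -⟩
    by_contra hne
    exact hw (h w hne hwd)
  · rintro rfl
    exact ⟨by simpa using hδ, hz, hzη⟩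

/-- An infinite set of nonzero spectral points is a countable union of finite ones. Any bijection
with ℕ enumerates it as a null sequence, since only finitely many points lie outside each ball about
0. -/
theorem spectrum_finite_or_sequence {T : H →L[ℂ] H} (hT : IsCompactOperator T) :
    (spectrum ℂ T).Finite ∨
      ∃ s : ℕ → ℂ, Function.Injective s ∧ (∀ j, s j ≠ 0) ∧ Tendsto s atTop (𝓝 0) ∧
        spectrum ℂ T = Set.range s ∪ {0} := by
  by_cases hfin : (spectrum ℂ T).Finite
  · exact Or.inl hfin
  right
  set A := spectrum ℂ T \ {0} with hA
  have hAinf : A.Infinite := Set.Infinite.sdiff hfin (Set.finite_singleton 0)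
  have hAc : A.Countable := by
    have : A ⊆ ⋃ k : ℕ, {z ∈ spectrum ℂ T | 1 / ((k : ℝ) + 1) ≤ ‖z‖} := by
      rintro z ⟨hz, hz0⟩
      obtain ⟨k, hk⟩ := exists_nat_one_div_lt (norm_pos_iff.2 hz0)
      exact Set.mem_iUnion.2 ⟨k, hz, hk.le⟩
    exact (Set.countable_iUnion fun k =>
      (finite_spectrum_diff_ball hT (by positivity)).countable).mono this
  have : Countable A := hAc.to_subtype
  have : Infinite A := hAinf.to_subtype
  obtain ⟨e⟩ := nonempty_equiv_of_countable (α := ℕ) (β := A)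
  have hinj : Function.Injective fun j => (e j : ℂ) := Subtype.val_injective.comp e.injective
  have htend : Tendsto (fun j => (e j : ℂ)) atTop (𝓝 0) := by
    rw [Metric.tendsto_nhds]
    intro η hη
    rw [← Nat.cofinite_eq_atTop]
    have hf := (finite_spectrum_diff_ball hT hη).preimage hinj.injOn
    refine (hf.subset ?_ : _)
    intro j hj
    simp only [Set.mem_compl_iff, Set.mem_ofPred_eq, dist_zero_right, not_lt] at hj
    exact ⟨(e j).2.1, hj⟩
  refine ⟨fun j => (e j : ℂ), hinj, fun j => (e j).2.2, htend, ?_⟩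
  have hrange : Set.range (fun j => (e j : ℂ)) = A := by
    ext z
    constructor
    · rintro ⟨j, rfl⟩; exact (e j).2
    · intro hz; exact ⟨e.symm ⟨z, hz⟩, by simp⟩
  have h0 : (0 : ℂ) ∈ spectrum ℂ T :=
    (spectrum.isClosed T).mem_of_tendsto htend (Eventually.of_forall fun j => (e j).2.1)
  rw [hrange, hA, Set.sdiff_union_of_subset (Set.singleton_subset_iff.2 h0)]

end CompactOperators

end EDMD

namespace EDMD

/-! ### Stability of spectra and Riesz projections under perturbations small in norm -/

section Perturbation

variable {H : Type*} [NormedAddCommGroup H] [InnerProductSpace ℂ H]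

theorem mem_resolventSet_iff_isUnit_shift {T : H →L[ℂ] H} {z : ℂ} :
    z ∈ resolventSet ℂ T ↔ IsUnit (shift T z) := by
  rw [spectrum.mem_resolventSet_iff, ← shift_eq_algebraMap_sub]

theorem resolvent_mul_shift {T : H →L[ℂ] H} {z : ℂ} (hz : z ∈ resolventSet ℂ T) :
    resolvent T z * shift T z = 1 := by
  rw [mem_resolventSet_iff_isUnit_shift] at hz
  rw [resolvent, ← shift_eq_algebraMap_sub]
  exact Ring.inverse_mul_cancel _ hz

theorem shift_mul_resolvent {T : H →L[ℂ] H} {z : ℂ} (hz : z ∈ resolventSet ℂ T) :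
    shift T z * resolvent T z = 1 := by
  rw [mem_resolventSet_iff_isUnit_shift] at hz
  rw [resolvent, ← shift_eq_algebraMap_sub]
  exact Ring.mul_inverse_cancel _ hz

theorem norm_le_of_norm_resolvent_le {T : H →L[ℂ] H} {z : ℂ} (hz : z ∈ resolventSet ℂ T) {K : ℝ}
    (h : ‖resolvent T z‖ ≤ K) (x : H) : ‖x‖ ≤ K * ‖shift T z x‖ := by
  have e : x = resolvent T z (shift T z x) := by
    rw [← mul_apply_eq_comp, resolvent_mul_shift hz, one_apply_eq_self]
  calc ‖x‖ = ‖resolvent T z (shift T z x)‖ := by rw [← e]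
    _ ≤ ‖resolvent T z‖ * ‖shift T z x‖ := ContinuousLinearMap.le_opNorm _ _
    _ ≤ _ := by gcongr

theorem norm_resolvent_le_of_bound {T : H →L[ℂ] H} {z : ℂ} (hz : z ∈ resolventSet ℂ T) {K : ℝ}
    (hK : 0 ≤ K) (h : ∀ x, ‖x‖ ≤ K * ‖shift T z x‖) : ‖resolvent T z‖ ≤ K := by
  refine ContinuousLinearMap.opNorm_le_bound _ hK fun y => ?_
  have e : shift T z (resolvent T z y) = y := by
    rw [← mul_apply_eq_comp, shift_mul_resolvent hz, one_apply_eq_self]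
  calc _ ≤ K * ‖shift T z (resolvent T z y)‖ := h _
    _ = _ := by rw [e]

theorem shift_perturb (T A : H →L[ℂ] H) (z : ℂ) : shift A z = shift T z - (A - T) := by
  simp only [shift]; abel

theorem bound_shift_perturb {T A : H →L[ℂ] H} {z : ℂ} {K : ℝ}
    (hb : ∀ x, ‖x‖ ≤ K * ‖shift T z x‖) (hK : 0 ≤ K) (h : K * ‖A - T‖ ≤ 1 / 2) (x : H) :
    ‖x‖ ≤ 2 * K * ‖shift A z x‖ := by
  have h1 : shift T z x = shift A z x + (A - T) x := by rw [shift_perturb T A]; simp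
  have h2 : ‖x‖ ≤ K * (‖shift A z x‖ + ‖A - T‖ * ‖x‖) := by
    refine (hb x).trans ?_
    rw [h1]
    gcongr
    exact (norm_add_le _ _).trans (by gcongr; exact (A - T).le_opNorm x)
  have h3 : K * ‖A - T‖ * ‖x‖ ≤ 1 / 2 * ‖x‖ := by gcongr
  nlinarith

theorem sphere_subset_resolventSet {T : H →L[ℂ] H} {mu : ℂ} {ε : ℝ} (hε : 0 < ε)
    (h : spectrum ℂ T ∩ Metric.closedBall mu ε = {mu}) :
    Metric.sphere mu ε ⊆ resolventSet ℂ T := by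
  intro z hz
  by_contra hcon
  have : z ∈ spectrum ℂ T ∩ Metric.closedBall mu ε := ⟨hcon, Metric.sphere_subset_closedBall hz⟩
  rw [h, Set.mem_singleton_iff] at this
  subst this
  simp at hz
  linarith

variable [CompleteSpace H]

/-- Neumann series: z - A = (z - T)(1 - R(A - T)), where R is the resolvent of T. -/
theorem mem_resolventSet_of_bound {T A : H →L[ℂ] H} {z : ℂ} {K : ℝ} (hz : z ∈ resolventSet ℂ T)
    (hK : 0 ≤ K) (hb : ∀ x, ‖x‖ ≤ K * ‖shift T z x‖) (h : K * ‖A - T‖ < 1) :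
    z ∈ resolventSet ℂ A := by
  have h1 : ‖resolvent T z * (A - T)‖ < 1 :=
    ((norm_mul_le _ _).trans (by gcongr; exact norm_resolvent_le_of_bound hz hK hb)).trans_lt h
  have h2 := isUnit_one_sub_of_norm_lt_one h1
  rw [mem_resolventSet_iff_isUnit_shift] at hz ⊢
  have h3 : shift A z = shift T z * (1 - resolvent T z * (A - T)) := by
    rw [mul_sub, ← mul_assoc, shift_mul_resolvent (mem_resolventSet_iff_isUnit_shift.2 hz),
      mul_one, one_mul, shift_perturb T A]
  rw [h3]
  exact hz.mul h2

theorem continuousOn_resolvent (T : H →L[ℂ] H) {s : Set ℂ} (hs : s ⊆ resolventSet ℂ T) :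
    ContinuousOn (resolvent T) s := fun _ hz =>
  (spectrum.hasDerivAt_resolvent_const_left (hs hz)).continuousAt.continuousWithinAt

theorem exists_norm_resolvent_le_sphere (T : H →L[ℂ] H) {mu : ℂ} {ε : ℝ}
    (hs : Metric.sphere mu ε ⊆ resolventSet ℂ T) :
    ∃ K > 0, ∀ z ∈ Metric.sphere mu ε, ‖resolvent T z‖ ≤ K := by
  obtain ⟨K, hK⟩ := (isCompact_sphere mu ε).exists_bound_of_continuousOn
    (continuousOn_resolvent T hs)
  exact ⟨max K 1, by positivity, fun z hz => (hK z hz).trans (le_max_left _ _)⟩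

/-- Limits of spectral points of norm-convergent operators are spectral points of the limit. -/
theorem mem_spectrum_of_tendsto {T : H →L[ℂ] H} {A : ℕ → H →L[ℂ] H}
    (hA : Tendsto (fun n => ‖A n - T‖) atTop (𝓝 0)) {lam : ℕ → ℂ} {mu : ℂ}
    (hlam : ∀ᶠ n in atTop, lam n ∈ spectrum ℂ (A n)) (hmu : Tendsto lam atTop (𝓝 mu)) :
    mu ∈ spectrum ℂ T := by
  intro hres
  obtain ⟨δ, hδ, K, hK, hb⟩ := exists_bound_shift_near hres
  have h1 : ∀ᶠ n in atTop, lam n ∈ resolventSet ℂ T :=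
    hmu.eventually ((spectrum.isOpen_resolventSet T).mem_nhds hres)
  have h2 : ∀ᶠ n in atTop, ‖lam n - mu‖ < δ := by
    have := hmu.eventually (Metric.ball_mem_nhds mu hδ)
    simpa [dist_eq_norm] using this
  have h3 : ∀ᶠ n in atTop, ‖A n - T‖ < 1 / K := hA.eventually_lt_const (by positivity)
  obtain ⟨n, hn, hn1, hn2, hn3⟩ := (hlam.and (h1.and (h2.and h3))).exists
  refine hn (mem_resolventSet_of_bound hn1 hK.le (hb _ hn2) ?_)
  rwa [lt_div_iff₀' hK] at hn3

/-- Nonzero spectral points of a compact operator are approximated by spectral points of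
approximating operators. -/
theorem eventually_exists_mem_spectrum {T : H →L[ℂ] H} (hT : IsCompactOperator T)
    {A : ℕ → H →L[ℂ] H} (hA : Tendsto (fun n => ‖A n - T‖) atTop (𝓝 0)) {mu : ℂ} (hmu : mu ≠ 0)
    (hs : mu ∈ spectrum ℂ T) {η : ℝ} (hη : 0 < η) :
    ∀ᶠ n in atTop, ∃ z ∈ spectrum ℂ (A n), ‖z - mu‖ < η := by
  obtain ⟨ε, hε, hεη, hiso⟩ := exists_isolating_radius hT hmu hs hη
  have hsph := sphere_subset_resolventSet hε hiso
  obtain ⟨K, hK, hKb⟩ := exists_norm_resolvent_le_sphere T hsph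
  filter_upwards [hA.eventually_lt_const (show 0 < 1 / (2 * K) by positivity)] with n hn
  -- Without spectrum of `A n` in the closed disc, its resolvent would be holomorphic there, and the
  -- maximum principle would carry the bound 2 * K from the circle to the centre. The Neumann series
  -- with the roles of T and `A n` exchanged would then put mu in the resolvent set of T.
  by_contra! hcon
  have hKA : K * ‖A n - T‖ < 1 / 2 := by
    rw [lt_div_iff₀ (by positivity)] at hn
    linarith
  have hball : Metric.closedBall mu ε ⊆ resolventSet ℂ (A n) := by
    intro z hz
    by_contra hzs
    have := hcon z hzs
    rw [Metric.mem_closedBall, dist_eq_norm] at hz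
    linarith
  have hbd : ∀ z ∈ frontier (Metric.ball mu ε), ‖resolvent (A n) z‖ ≤ 2 * K := by
    rw [frontier_ball _ hε.ne']
    intro z hz
    refine norm_resolvent_le_of_bound (hball (Metric.sphere_subset_closedBall hz)) (by positivity)
      (bound_shift_perturb (norm_le_of_norm_resolvent_le (hsph hz) (hKb z hz)) hK.le hKA.le)
  have hd : DiffContOnCl ℂ (resolvent (A n)) (Metric.ball mu ε) := by
    refine ⟨fun z hz => ?_, ?_⟩
    · exact (spectrum.hasDerivAt_resolvent_const_left
        (hball (Metric.ball_subset_closedBall hz))).differentiableAt.differentiableWithinAt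
    · rw [closure_ball _ hε.ne']
      exact continuousOn_resolvent _ hball
  have hmax := Complex.norm_le_of_forall_mem_frontier_norm_le Metric.isBounded_ball hd hbd
    (subset_closure (Metric.mem_ball_self hε))
  have hmuA := hball (Metric.mem_closedBall_self hε.le)
  refine hs (mem_resolventSet_of_bound hmuA (by positivity : 0 ≤ 2 * K)
    (norm_le_of_norm_resolvent_le hmuA hmax) ?_)
  rw [norm_sub_rev]
  linarith

/-- The rate of convergence of eigenvalues, in terms of the ascent. -/
theorem eventually_norm_sub_pow_le {T : H →L[ℂ] H} (hT : IsCompactOperator T)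
    {A : ℕ → H →L[ℂ] H} {mu : ℂ} (hmu : mu ≠ 0) {p : ℕ} (hp0 : p ≠ 0)
    (hp : ∀ x, (shift T mu ^ p) x = 0 ↔ (shift T mu ^ (p + 1)) x = 0) {lam : ℕ → ℂ}
    (hlam : ∀ᶠ n in atTop, lam n ∈ spectrum ℂ (A n)) (hlim : Tendsto lam atTop (𝓝 mu)) :
    ∃ K > 0, ∀ᶠ n in atTop, ‖mu - lam n‖ ^ p ≤ K * ‖A n - T‖ := by
  obtain ⟨δ, hδ, K, hK, h⟩ := exists_resolvent_growth hT hmu hp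
  refine ⟨K, hK, ?_⟩
  have h2 : ∀ᶠ n in atTop, ‖lam n - mu‖ < δ := by
    have := hlim.eventually (Metric.ball_mem_nhds mu hδ)
    simpa [dist_eq_norm] using this
  filter_upwards [hlam, h2] with n hn hnδ
  rw [norm_sub_rev]
  rcases eq_or_ne (lam n) mu with heq | hne
  · rw [heq, sub_self, norm_zero, zero_pow hp0]; positivity
  -- Otherwise the bound K / ‖lam n - mu‖^p on the resolvent of T would be beaten by the
  -- perturbation, and `lam n` would be a regular point of `A n`.
  by_contra! hlt
  obtain ⟨hres, hb⟩ := h _ hne hnδ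
  have hpos : 0 < ‖lam n - mu‖ ^ p := pow_pos (norm_pos_iff.2 (sub_ne_zero.2 hne)) _
  refine hn (mem_resolventSet_of_bound (K := K / ‖lam n - mu‖ ^ p) hres (by positivity)
    (fun x => ?_) ?_)
  · rw [div_mul_eq_mul_div, le_div_iff₀ hpos, mul_comm]
    exact hb x
  · rwa [div_mul_eq_mul_div, div_lt_one hpos]

/-- The identity (z - lam) R x = x - R (lam - A) x splits off a scalar integral and leaves a vector
killed by one power less. Each such step lowers the exponent of z - lam by one, so all k must be
treated together in the induction; only k = 0 meets the residue of 1/(z - lam). -/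
theorem circleIntegral_zpow_smul_resolvent {A : H →L[ℂ] H} {mu lam : ℂ} {ε : ℝ} (hε : 0 < ε)
    (hs : Metric.sphere mu ε ⊆ resolventSet ℂ A) (hlam : lam ∈ Metric.ball mu ε) (ν : ℕ) :
    ∀ x, (shift A lam ^ ν) x = 0 → ∀ k : ℕ,
      (∮ z in C(mu, ε), (z - lam) ^ (-(k : ℤ)) • resolvent A z x) =
        if k = 0 then (2 * (Real.pi : ℂ) * Complex.I) • x else 0 := by
  have hne : ∀ z ∈ Metric.sphere mu ε, z - lam ≠ 0 := by
    intro z hz h0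
    rw [sub_eq_zero] at h0
    subst h0
    rw [Metric.mem_sphere] at hz
    rw [Metric.mem_ball] at hlam
    linarith
  have hcz : ∀ m : ℤ, ContinuousOn (fun z : ℂ => (z - lam) ^ m) (Metric.sphere mu ε) := fun m =>
    (continuousOn_id.sub continuousOn_const).zpow₀ m fun z hz => Or.inl (hne z hz)
  have hcr : ∀ x, ContinuousOn (fun z => resolvent A z x) (Metric.sphere mu ε) := fun x =>
    (continuousOn_resolvent A hs).clm_apply continuousOn_const
  induction ν with
  | zero =>
    intro x hx k
    have : x = 0 := by simpa using hx
    subst this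
    simp [circleIntegral]
  | succ ν ih =>
    intro x hx k
    have hSx : (shift A lam ^ ν) (shift A lam x) = 0 := by
      rw [← mul_apply_eq_comp, ← pow_succ]; exact hx
    have hcongr : Set.EqOn (fun z => (z - lam) ^ (-(k : ℤ)) • resolvent A z x)
        (fun z => (z - lam) ^ (-(k : ℤ) - 1) • x -
          (z - lam) ^ (-((k + 1 : ℕ) : ℤ)) • resolvent A z (shift A lam x))
        (Metric.sphere mu ε) := by
      intro z hz
      have e1 : (z - lam) • x = shift A z x - shift A lam x := by
        simp only [shift_apply, sub_smul]; abel
      have e2 : (z - lam) • resolvent A z x = x - resolvent A z (shift A lam x) := by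
        rw [← map_smul, e1, map_sub, ← mul_apply_eq_comp, resolvent_mul_shift (hs hz),
          one_apply_eq_self]
      have e3 : (z - lam) ^ (-(k : ℤ)) = (z - lam) ^ (-(k : ℤ) - 1) * (z - lam) := by
        rw [← zpow_add_one₀ (hne z hz)]; congr 1; ring
      have e4 : (-((k + 1 : ℕ) : ℤ)) = -(k : ℤ) - 1 := by push_cast; ring
      simp only
      rw [e3, e4, mul_smul, e2, smul_sub]
    have i1 : CircleIntegrable (fun z => (z - lam) ^ (-(k : ℤ) - 1) • x) mu ε :=
      ((hcz _).smul continuousOn_const).circleIntegrable hε.le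
    have i2 : CircleIntegrable (fun z => (z - lam) ^ (-((k + 1 : ℕ) : ℤ)) •
        resolvent A z (shift A lam x)) mu ε := ((hcz _).smul (hcr _)).circleIntegrable hε.le
    rw [circleIntegral.integral_congr hε.le hcongr, circleIntegral.integral_sub i1 i2, ih _ hSx, circleIntegral.integral_smul_const]
    rcases Nat.eq_zero_or_pos k with rfl | hk
    · simp only [CharP.cast_eq_zero, neg_zero, zero_sub, zpow_neg_one, Nat.add_eq_zero_iff,
        one_ne_zero, and_false, if_false, if_true, sub_zero]
      rw [circleIntegral.integral_sub_inv_of_mem_ball hlam]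
    · rw [circleIntegral.integral_sub_zpow_of_ne (by omega)]
      simp [hk.ne']

theorem circleIntegral_apply {A : ℂ → H →L[ℂ] H} {mu : ℂ} {ε : ℝ}
    (hA : CircleIntegrable A mu ε) (x : H) :
    (∮ z in C(mu, ε), A z) x = ∮ z in C(mu, ε), A z x := by
  have := ((ContinuousLinearMap.apply ℂ H x)).intervalIntegral_comp_comm hA.out
  simp only [circleIntegral]
  simpa using this.symm

/-- A generalised eigenvector for an eigenvalue inside the circle is fixed by the Riesz
projection. -/
theorem riesz_apply_genEigenvector {A : H →L[ℂ] H} {mu lam : ℂ} {ε : ℝ} (hε : 0 < ε)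
    (hs : Metric.sphere mu ε ⊆ resolventSet ℂ A) (hlam : lam ∈ Metric.ball mu ε) {ν : ℕ} {x : H}
    (hx : (shift A lam ^ ν) x = 0) :
    ((2 * (Real.pi : ℂ) * Complex.I)⁻¹ • ∮ z in C(mu, ε), resolvent A z) x = x := by
  have h := circleIntegral_zpow_smul_resolvent hε hs hlam ν x hx 0
  simp only [CharP.cast_eq_zero, neg_zero, zpow_zero, one_smul, if_true] at h
  rw [smul_apply, circleIntegral_apply
    ((continuousOn_resolvent A hs).circleIntegrable hε.le), h, inv_smul_smul₀]
  exact Complex.two_pi_I_ne_zero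

/-- The second resolvent identity; the perturbed resolvent is at most twice the bound K. -/
theorem norm_resolvent_sub_le {T A : H →L[ℂ] H} {z : ℂ} {K : ℝ} (hz : z ∈ resolventSet ℂ T)
    (hK : ‖resolvent T z‖ ≤ K) (h : K * ‖A - T‖ < 1 / 2) :
    z ∈ resolventSet ℂ A ∧ ‖resolvent T z - resolvent A z‖ ≤ 2 * K ^ 2 * ‖A - T‖ := by
  have hK0 : 0 ≤ K := (norm_nonneg _).trans hK
  have hb := norm_le_of_norm_resolvent_le hz hK
  have hzA : z ∈ resolventSet ℂ A := mem_resolventSet_of_bound hz hK0 hb (by linarith)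
  refine ⟨hzA, ?_⟩
  have hA2 : ‖resolvent A z‖ ≤ 2 * K :=
    norm_resolvent_le_of_bound hzA (by positivity) (bound_shift_perturb hb hK0 h.le)
  have e : resolvent T z - resolvent A z = -(resolvent T z * (A - T) * resolvent A z) := by
    have e1 : A - T = shift T z - shift A z := by rw [shift_perturb T A]; abel
    rw [e1, mul_sub, sub_mul, resolvent_mul_shift hz, mul_assoc, shift_mul_resolvent hzA]
    simp
  rw [e, norm_neg]
  calc _ ≤ ‖resolvent T z‖ * ‖A - T‖ * ‖resolvent A z‖ :=
        (norm_mul_le _ _).trans (by gcongr; exact norm_mul_le _ _)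
    _ ≤ K * ‖A - T‖ * (2 * K) := by gcongr
    _ = _ := by ring

/-- The rate of convergence of normalised generalised eigenvectors. -/
theorem eventually_norm_riesz_sub_le {T P : H →L[ℂ] H} {A : ℕ → H →L[ℂ] H} {mu : ℂ}
    (hP : IsSpectralProjection T mu P) (hA : Tendsto (fun n => ‖A n - T‖) atTop (𝓝 0))
    {lam : ℕ → ℂ} (hlim : Tendsto lam atTop (𝓝 mu)) {x : ℕ → H}
    (hx : ∀ᶠ n in atTop, ‖x n‖ = 1 ∧ ∃ ν : ℕ, (shift (A n) (lam n) ^ ν) (x n) = 0) :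
    ∃ K > 0, ∀ᶠ n in atTop, ‖P (x n) - x n‖ ≤ K * ‖A n - T‖ := by
  obtain ⟨ε, hε, hiso, rfl⟩ := hP
  have hsph := sphere_subset_resolventSet hε hiso
  obtain ⟨K, hK, hKb⟩ := exists_norm_resolvent_le_sphere T hsph
  refine ⟨ε * (2 * K ^ 2), by positivity, ?_⟩
  have h2 : ∀ᶠ n in atTop, lam n ∈ Metric.ball mu ε :=
    hlim.eventually (Metric.ball_mem_nhds mu hε)
  filter_upwards [hx, h2, hA.eventually_lt_const (show 0 < 1 / (2 * K) by positivity)]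
    with n ⟨hn1, ν, hν⟩ hnε hn
  have hKA : K * ‖A n - T‖ < 1 / 2 := by
    rw [lt_div_iff₀ (by positivity)] at hn
    linarith
  have hd : ∀ z ∈ Metric.sphere mu ε, z ∈ resolventSet ℂ (A n) ∧
      ‖resolvent T z - resolvent (A n) z‖ ≤ 2 * K ^ 2 * ‖A n - T‖ := fun z hz =>
    norm_resolvent_sub_le (hsph hz) (hKb z hz) hKA
  have hsphA : Metric.sphere mu ε ⊆ resolventSet ℂ (A n) := fun z hz => (hd z hz).1
  -- As x_n is fixed by the projection of `A n`, its defect under that of T is the difference of the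
  -- two projections applied to x_n. No bound on the exponent ν is needed.
  have hfix := riesz_apply_genEigenvector hε hsphA hnε hν
  set PT := (2 * (Real.pi : ℂ) * Complex.I)⁻¹ • ∮ z in C(mu, ε), resolvent T z with hPT
  set PA := (2 * (Real.pi : ℂ) * Complex.I)⁻¹ • ∮ z in C(mu, ε), resolvent (A n) z with hPA
  have hdiff : ‖PT - PA‖ ≤ ε * (2 * K ^ 2 * ‖A n - T‖) := by
    rw [hPT, hPA, ← smul_sub, ← circleIntegral.integral_sub
      ((continuousOn_resolvent T hsph).circleIntegrable hε.le)
      ((continuousOn_resolvent (A n) hsphA).circleIntegrable hε.le)]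
    exact circleIntegral.norm_two_pi_i_inv_smul_integral_le_of_norm_le_const hε.le
      fun z hz => (hd z hz).2
  calc ‖PT (x n) - x n‖ = ‖(PT - PA) (x n)‖ := by rw [sub_apply, hfix]
    _ ≤ ‖PT - PA‖ * ‖x n‖ := ContinuousLinearMap.le_opNorm _ _
    _ ≤ _ := by rw [hn1, mul_one]; exact hdiff.trans (le_of_eq (by ring))

end Perturbation

end EDMD

noncomputable section

namespace EDMD

/-! ### Geometric series indexed by |k|, with their tails and truncations -/

section Sequences

theorem hasSum_int_natAbs {g : ℕ → ℝ} (hg : Summable g) :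
    HasSum (fun k : ℤ => g k.natAbs) (∑' n, g n + ∑' n, g (n + 1)) := by
  refine HasSum.of_nat_of_neg_add_one (f := fun k : ℤ => g k.natAbs) ?_ ?_
  · simpa using hg.hasSum
  · have h : ∀ n : ℕ, (-((n : ℤ) + 1)).natAbs = n + 1 := by intro n; omega
    simp only [h]
    exact ((summable_nat_add_iff 1).2 hg).hasSum

theorem summable_int_natAbs {g : ℕ → ℝ} (hg : Summable g) : Summable fun k : ℤ => g k.natAbs :=
  (hasSum_int_natAbs hg).summable

theorem tsum_int_natAbs_le {g : ℕ → ℝ} (hg : Summable g) (h0 : ∀ n, 0 ≤ g n) :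
    ∑' k : ℤ, g k.natAbs ≤ 2 * ∑' n, g n := by
  rw [(hasSum_int_natAbs hg).tsum_eq, two_mul, hg.tsum_eq_zero_add]
  have := h0 0
  linarith

theorem summable_pow_natAbs {q : ℝ} (h0 : 0 ≤ q) (h1 : q < 1) :
    Summable fun k : ℤ => q ^ k.natAbs :=
  summable_int_natAbs (summable_geometric_of_lt_one h0 h1)

theorem tsum_pow_natAbs_le {q : ℝ} (h0 : 0 ≤ q) (h1 : q < 1) :
    ∑' k : ℤ, q ^ k.natAbs ≤ 2 / (1 - q) := by
  refine (tsum_int_natAbs_le (summable_geometric_of_lt_one h0 h1) fun n => by positivity).trans ?_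
  rw [tsum_geometric_of_lt_one h0 h1, div_eq_mul_inv]

/-- The tail of the geometric sequence. -/
def geomTail (q : ℝ) (n : ℕ) (j : ℕ) : ℝ := if n ≤ j then q ^ j else 0

theorem geomTail_nonneg {q : ℝ} (h0 : 0 ≤ q) (n j : ℕ) : 0 ≤ geomTail q n j := by
  unfold geomTail; split_ifs <;> positivity

theorem hasSum_geomTail {q : ℝ} (h0 : 0 ≤ q) (h1 : q < 1) (n : ℕ) :
    HasSum (geomTail q n) (q ^ n / (1 - q)) := by
  have h : HasSum (fun j => geomTail q n (j + n)) (q ^ n / (1 - q)) := by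
    have e : (fun j => geomTail q n (j + n)) = fun j => q ^ n * q ^ j := by
      funext j; simp [geomTail, pow_add, mul_comm]
    rw [e, div_eq_mul_inv]
    exact (hasSum_geometric_of_lt_one h0 h1).mul_left _
  rw [← hasSum_nat_add_iff' n]
  have e : ∑ i ∈ Finset.range n, geomTail q n i = 0 :=
    Finset.sum_eq_zero fun i hi => by
      simp [geomTail, not_le.2 (Finset.mem_range.1 hi)]
  rwa [e, sub_zero]

theorem summable_geomTail_natAbs {q : ℝ} (h0 : 0 ≤ q) (h1 : q < 1) (n : ℕ) :
    Summable fun k : ℤ => geomTail q n k.natAbs :=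
  summable_int_natAbs (hasSum_geomTail h0 h1 n).summable

theorem tsum_geomTail_natAbs_le {q : ℝ} (h0 : 0 ≤ q) (h1 : q < 1) (n : ℕ) :
    ∑' k : ℤ, geomTail q n k.natAbs ≤ 2 / (1 - q) * q ^ n := by
  refine (tsum_int_natAbs_le (hasSum_geomTail h0 h1 n).summable
    (geomTail_nonneg h0 n)).trans (le_of_eq ?_)
  rw [(hasSum_geomTail h0 h1 n).tsum_eq]
  ring

/-- The powers `q ^ (n - j)` for `j < n`. -/
def geomHead (q : ℝ) (n : ℕ) (j : ℕ) : ℝ := if j < n then q ^ (n - j) else 0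

theorem geomHead_nonneg {q : ℝ} (h0 : 0 ≤ q) (n j : ℕ) : 0 ≤ geomHead q n j := by
  unfold geomHead; split_ifs <;> positivity

theorem summable_geomHead (q : ℝ) (n : ℕ) : Summable (geomHead q n) :=
  summable_of_ne_finset_zero (s := Finset.range n) fun j hj => by
    simp only [Finset.mem_range] at hj; simp [geomHead, hj]

/-- The bound is uniform in n: read backwards, the sum is an initial piece of a geometric series. -/
theorem tsum_geomHead_le {q : ℝ} (h0 : 0 ≤ q) (h1 : q < 1) (n : ℕ) :
    ∑' j, geomHead q n j ≤ 1 / (1 - q) := by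
  rw [tsum_eq_sum (s := Finset.range n) fun j hj => by
    simp only [Finset.mem_range] at hj; simp [geomHead, hj]]
  have e : ∑ j ∈ Finset.range n, geomHead q n j = ∑ j ∈ Finset.range n, q ^ (j + 1) := by
    rw [← Finset.sum_range_reflect]
    refine Finset.sum_congr rfl fun j hj => ?_
    have hj := Finset.mem_range.1 hj
    rw [geomHead, if_pos (by omega)]
    congr 1; omega
  rw [e]
  calc ∑ j ∈ Finset.range n, q ^ (j + 1) ≤ ∑ j ∈ Finset.range n, q ^ j :=
        Finset.sum_le_sum fun j _ => pow_le_pow_of_le_one h0 h1.le (Nat.le_succ j)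
    _ ≤ ∑' j, q ^ j := (summable_geometric_of_lt_one h0 h1).sum_le_tsum _
        fun j _ => by positivity
    _ = _ := by rw [tsum_geometric_of_lt_one h0 h1, one_div]

theorem summable_geomHead_natAbs (q : ℝ) (n : ℕ) :
    Summable fun k : ℤ => geomHead q n k.natAbs :=
  summable_int_natAbs (summable_geomHead q n)

theorem tsum_geomHead_natAbs_le {q : ℝ} (h0 : 0 ≤ q) (h1 : q < 1) (n : ℕ) :
    ∑' k : ℤ, geomHead q n k.natAbs ≤ 2 / (1 - q) := by
  refine (tsum_int_natAbs_le (summable_geomHead q n) (geomHead_nonneg h0 n)).trans ?_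
  calc 2 * ∑' j, geomHead q n j ≤ 2 * (1 / (1 - q)) := by
        gcongr; exact tsum_geomHead_le h0 h1 n
    _ = _ := by ring

end Sequences

/-! ### Operators on ℓ²(ℤ) whose columns have summable norms -/

section ColumnOperators

/-- The space `ℓ²(ℤ)`. -/
abbrev ElTwo : Type := lp (fun _ : ℤ => ℂ) 2

/-- The standard basis of `ℓ²(ℤ)`. -/
def basisVec (k : ℤ) : ElTwo := lp.single 2 k 1

/-- The coordinate functionals of `ℓ²(ℤ)`. -/
def coordL (k : ℤ) : ElTwo →L[ℂ] ℂ :=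
  LinearMap.mkContinuous
    { toFun := fun f => f k
      map_add' := fun f g => by simp
      map_smul' := fun c f => by simp } 1
    fun f => by
      rw [one_mul]
      exact lp.norm_apply_le_norm two_ne_zero f k

theorem coordL_apply (k : ℤ) (f : ElTwo) : coordL k f = f k := rfl

theorem norm_coordL_le (k : ℤ) : ‖coordL k‖ ≤ 1 :=
  LinearMap.mkContinuous_norm_le _ zero_le_one _

theorem norm_single_elTwo (k : ℤ) (a : ℂ) : ‖(lp.single 2 k a : ElTwo)‖ = ‖a‖ :=
  lp.norm_single (E := fun _ : ℤ => ℂ) (p := 2) (by norm_num) k a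

theorem single_eq_smul_basisVec (k : ℤ) (a : ℂ) : (lp.single 2 k a : ElTwo) = a • basisVec k := by
  rw [basisVec, ← lp.single_smul, smul_eq_mul, mul_one]

theorem basisVec_apply (k l : ℤ) : basisVec k l = if l = k then 1 else 0 := by
  rw [basisVec, lp.single_apply]
  rcases eq_or_ne l k with rfl | h
  · simp
  · simp [h]

/-- The element of `ℓ²(ℤ)` with absolutely summable coordinates `f`. -/
def seqVec (f : ℤ → ℂ) : ElTwo := ∑' k, lp.single 2 k (f k)

theorem hasSum_seqVec {f : ℤ → ℂ} (hf : Summable fun k => ‖f k‖) :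
    HasSum (fun k => (lp.single 2 k (f k) : ElTwo)) (seqVec f) := by
  refine Summable.hasSum (Summable.of_norm ?_)
  simpa only [norm_single_elTwo] using hf

theorem seqVec_apply {f : ℤ → ℂ} (hf : Summable fun k => ‖f k‖) (l : ℤ) :
    seqVec f l = f l := by
  have h := (coordL l).hasSum (hasSum_seqVec hf)
  refine h.unique ?_
  have e : f l = coordL l (lp.single 2 l (f l) : ElTwo) := by
    rw [single_eq_smul_basisVec, map_smul, coordL_apply, basisVec_apply]; simp
  rw [e]
  refine hasSum_single l fun k hk => ?_
  rw [single_eq_smul_basisVec, map_smul, coordL_apply, basisVec_apply, if_neg hk.symm, smul_zero]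

theorem norm_elTwo_le_tsum {f : ElTwo} (hf : Summable fun k => ‖f k‖) :
    ‖f‖ ≤ ∑' k, ‖f k‖ := by
  have h := lp.hasSum_single (p := 2) (by norm_num) f
  rw [← h.tsum_eq]
  have e : ∀ k, ‖(lp.single 2 k (f k) : ElTwo)‖ = ‖f k‖ := fun k => norm_single_elTwo k _
  refine (norm_tsum_le_tsum_norm (by simpa only [e] using hf)).trans ?_
  simp only [e]
  rw [h.tsum_eq]

/-- The ℓ² norm is dominated by the ℓ¹ norm. This loses only constants here, as all the sequences in
play decay geometrically. -/
theorem norm_elTwo_le {f : ElTwo} {g : ℤ → ℝ} (hg : Summable g) (h : ∀ k, ‖f k‖ ≤ g k) :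
    ‖f‖ ≤ ∑' k, g k := by
  have hf : Summable fun k => ‖f k‖ := Summable.of_nonneg_of_le (fun _ => norm_nonneg _) h hg
  exact (norm_elTwo_le_tsum hf).trans (hf.tsum_le_tsum h hg)

/-- The operator on `ℓ²(ℤ)` with the absolutely summable columns `v k`. -/
def colOp (v : ℤ → ElTwo) : ElTwo →L[ℂ] ElTwo := ∑' k, (coordL k).smulRight (v k)

theorem norm_smulRight_coordL_le (k : ℤ) (x : ElTwo) : ‖(coordL k).smulRight x‖ ≤ ‖x‖ := by
  rw [ContinuousLinearMap.norm_smulRight_apply]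
  exact mul_le_of_le_one_left (norm_nonneg _) (norm_coordL_le k)

theorem hasSum_colOp {v : ℤ → ElTwo} (hv : Summable fun k => ‖v k‖) :
    HasSum (fun k => (coordL k).smulRight (v k)) (colOp v) :=
  (Summable.of_norm (Summable.of_nonneg_of_le (fun _ => norm_nonneg _)
    (fun k => norm_smulRight_coordL_le k (v k)) hv)).hasSum

theorem hasSum_colOp_apply {v : ℤ → ElTwo} (hv : Summable fun k => ‖v k‖) (f : ElTwo) :
    HasSum (fun k => f k • v k) (colOp v f) := by
  have h := (ContinuousLinearMap.apply ℂ ElTwo f).hasSum (hasSum_colOp hv)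
  exact h

theorem colOp_basisVec {v : ℤ → ElTwo} (hv : Summable fun k => ‖v k‖) (k : ℤ) :
    colOp v (basisVec k) = v k := by
  refine (hasSum_colOp_apply hv _).unique ?_
  have e : v k = basisVec k k • v k := by rw [basisVec_apply]; simp
  have h := hasSum_single (f := fun l => basisVec k l • v l) k fun l hl => by
    rw [basisVec_apply, if_neg hl, zero_smul]
  exact e.symm ▸ h

theorem norm_colOp_le {v : ℤ → ElTwo} (hv : Summable fun k => ‖v k‖) :
    ‖colOp v‖ ≤ ∑' k, ‖v k‖ :=
  (hasSum_colOp hv).norm_le_of_bounded hv.hasSum fun k => norm_smulRight_coordL_le k (v k)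

theorem colOp_sub {v w : ℤ → ElTwo} (hv : Summable fun k => ‖v k‖)
    (hw : Summable fun k => ‖w k‖) : colOp v - colOp w = colOp fun k => v k - w k := by
  have h := (hasSum_colOp hv).sub (hasSum_colOp hw)
  have h' : HasSum (fun k => (coordL k).smulRight (v k - w k)) (colOp v - colOp w) := by
    have e : (fun k => (coordL k).smulRight (v k - w k)) =
        fun k => (coordL k).smulRight (v k) - (coordL k).smulRight (w k) := by
      funext k
      ext1 f
      simp only [sub_apply, ContinuousLinearMap.smulRight_apply, smul_sub]
    rwa [e]
  exact h'.tsum_eq.symm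

/-- The operator is a norm limit of finite sums of rank one operators. -/
theorem isCompactOperator_colOp {v : ℤ → ElTwo} (hv : Summable fun k => ‖v k‖) :
    IsCompactOperator (colOp v) := by
  refine isCompactOperator_of_tendsto (hasSum_colOp hv) (Eventually.of_forall fun s => ?_)
  refine (compactOperator (RingHom.id ℂ) ElTwo ElTwo).sum_mem fun k _ => ?_
  have h : IsCompactOperator (coordL k) := ⟨Metric.closedBall 0 1, isCompact_closedBall 0 1, by
    exact (coordL k).continuous.continuousAt.preimage_mem_nhds
      (by rw [map_zero]; exact Metric.closedBall_mem_nhds _ one_pos)⟩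
  exact h.clm_comp (ContinuousLinearMap.toSpanSingleton ℂ (v k))

theorem isHilbertSchmidt_of_summable {T : ElTwo →L[ℂ] ElTwo}
    (h : Summable fun k => ‖T (basisVec k)‖ ^ 2) : IsHilbertSchmidt T := by
  refine ⟨ℤ, HilbertBasis.ofRepr (LinearIsometryEquiv.refl ℂ ElTwo), ?_⟩
  refine h.congr fun k => ?_
  have e : HilbertBasis.ofRepr (LinearIsometryEquiv.refl ℂ ElTwo) k = basisVec k := by
    classical
    rw [← HilbertBasis.repr_symm_single]
    rw [basisVec]
    refine (congrArg _ ?_)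
    ext l
    simp only [lp.single_apply]
  rw [e]

end ColumnOperators

end EDMD

end

noncomputable section

namespace EDMD

/-! ### Laurent coefficients of functions holomorphic on a closed annulus -/

section Annuli

/-- The closed annulus `{z : a ≤ |z| ≤ a⁻¹}`. -/
def closedAnn (a : ℝ) : Set ℂ := {z | a ≤ ‖z‖ ∧ ‖z‖ ≤ a⁻¹}

theorem ne_zero_of_mem_closedAnn {a : ℝ} (ha : 0 < a) {z : ℂ} (hz : z ∈ closedAnn a) : z ≠ 0 :=
  norm_pos_iff.1 (ha.trans_le hz.1)

theorem closedAnn_subset_closure_annulus {a : ℝ} (ha : 0 < a) (ha1 : a < 1) :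
    closedAnn a ⊆ closure (annulus a) := by
  rintro z ⟨hz1, hz2⟩
  have hinv : 1 < a⁻¹ := (one_lt_inv₀ ha).2 ha1
  have hzpos : 0 < ‖z‖ := ha.trans_le hz1
  have hnorm : ∀ s : ℝ, 0 ≤ s → ‖(s : ℂ) * z‖ = s * ‖z‖ := fun s hs => by
    rw [norm_mul, Complex.norm_real, Real.norm_of_nonneg hs]
  have htend : Tendsto (fun s : ℝ => (s : ℂ) * z) (𝓝 1) (𝓝 z) := by
    have : ContinuousAt (fun s : ℝ => (s : ℂ) * z) 1 := by fun_prop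
    simpa [ContinuousAt] using this
  have htend' : Tendsto (fun s : ℝ => s * ‖z‖) (𝓝 1) (𝓝 ‖z‖) := by
    have : ContinuousAt (fun s : ℝ => s * ‖z‖) 1 := by fun_prop
    simpa [ContinuousAt] using this
  -- Moving z radially towards the unit circle takes it into the open annulus.
  rcases le_total ‖z‖ 1 with h | h
  · refine mem_closure_of_tendsto (htend.mono_left (nhdsWithin_le_nhds (s := Set.Ioi 1))) ?_
    filter_upwards [self_mem_nhdsWithin,
      nhdsWithin_le_nhds (htend'.eventually_lt_const (h.trans_lt hinv))] with s hs hs'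
    have hs1 : (1 : ℝ) < s := hs
    refine ⟨?_, ?_⟩
    · rw [hnorm s (by linarith)]; nlinarith
    · rwa [hnorm s (by linarith)]
  · refine mem_closure_of_tendsto (htend.mono_left (nhdsWithin_le_nhds (s := Set.Iio 1))) ?_
    filter_upwards [self_mem_nhdsWithin,
      nhdsWithin_le_nhds (htend'.eventually_const_lt (ha1.trans_le h)),
      nhdsWithin_le_nhds (lt_mem_nhds zero_lt_one)] with s hs hs' hs0
    have hs1 : s < 1 := hs
    refine ⟨?_, ?_⟩
    · rwa [hnorm s hs0.le]
    · rw [hnorm s hs0.le]; nlinarith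

/-- The norm is a closed map, so the radii of the circles contained in U form an open set of
nonnegative reals. This set contains the interval from a to a⁻¹ and hence a slightly larger one. -/
theorem exists_larger_annulus {a : ℝ} (ha : 0 < a) (ha1 : a < 1) {U : Set ℂ} (hU : IsOpen U)
    (h : closedAnn a ⊆ U) : ∃ b, 0 < b ∧ b < a ∧ closedAnn b ⊆ U := by
  have hcl : IsClosed ((fun z : ℂ => dist 0 z) '' Uᶜ) :=
    isClosedMap_dist (0 : ℂ) _ hU.isClosed_compl
  set V := ((fun z : ℂ => dist 0 z) '' Uᶜ)ᶜ with hV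
  have hVo : IsOpen V := hcl.isOpen_compl
  have hinv : 1 < a⁻¹ := (one_lt_inv₀ ha).2 ha1
  have memV : ∀ z : ℂ, ‖z‖ ∈ V → z ∈ U := by
    intro z hz
    by_contra hzU
    exact hz ⟨z, hzU, by simp⟩
  have hIcc : Set.Icc a a⁻¹ ⊆ V := by
    rintro t ht ⟨z, hzU, hzt⟩
    simp only [dist_zero_left] at hzt
    exact hzU (h ⟨hzt ▸ ht.1, hzt ▸ ht.2⟩)
  have h1 : V ∈ 𝓝 a := hVo.mem_nhds (hIcc ⟨le_rfl, by linarith⟩)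
  -- The outer radius b⁻¹ is tied to the inner one, so b must be near enough to a for both ends to
  -- stay in V.
  have h2 : V ∈ 𝓝 a⁻¹ := hVo.mem_nhds (hIcc ⟨by linarith, le_rfl⟩)
  obtain ⟨δ, hδ, hδV⟩ := Metric.mem_nhds_iff.1 h1
  obtain ⟨δ', hδ', hδV'⟩ := Metric.mem_nhds_iff.1 h2
  have hc : Tendsto (fun b : ℝ => b⁻¹) (𝓝 a) (𝓝 a⁻¹) := (continuousAt_inv₀ ha.ne').tendsto
  have e1 : ∀ᶠ b in 𝓝[<] a, b < a ∧ 0 < b ∧ a - δ < b ∧ b⁻¹ < a⁻¹ + δ' := by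
    filter_upwards [self_mem_nhdsWithin, nhdsWithin_le_nhds (lt_mem_nhds ha),
      nhdsWithin_le_nhds (lt_mem_nhds (show a - δ < a by linarith)),
      nhdsWithin_le_nhds (hc.eventually_lt_const (show a⁻¹ < a⁻¹ + δ' by linarith))]
      with b hb1 hb2 hb3 hb4 using ⟨hb1, hb2, hb3, hb4⟩
  obtain ⟨b, hba, hb0, hbδ, hbδ'⟩ := e1.exists
  refine ⟨b, hb0, hba, fun z hz => memV z ?_⟩
  obtain ⟨hz1, hz2⟩ := hz
  rcases lt_or_ge ‖z‖ a with hza | hza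
  · exact hδV (by rw [Metric.mem_ball, Real.dist_eq, abs_lt]; constructor <;> linarith)
  rcases le_or_gt ‖z‖ a⁻¹ with hza' | hza'
  · exact hIcc ⟨hza, hza'⟩
  · exact hδV' (by rw [Metric.mem_ball, Real.dist_eq, abs_lt]; constructor <;> linarith)

theorem closedAnn_mono {a b : ℝ} (ha : 0 < a) (h : a ≤ b) : closedAnn b ⊆ closedAnn a :=
  fun _ hz => ⟨h.trans hz.1, hz.2.trans ((inv_le_inv₀ (ha.trans_le h) ha).2 h)⟩

theorem sphere_subset_closedAnn {a R : ℝ} (h1 : a ≤ R) (h2 : R ≤ a⁻¹) :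
    Metric.sphere (0 : ℂ) R ⊆ closedAnn a := by
  intro z hz
  rw [mem_sphere_zero_iff_norm] at hz
  exact ⟨hz ▸ h1, hz ▸ h2⟩

theorem circleAverage_eq_of_analytic {f : ℂ → ℂ} {a R R' : ℝ} (ha : 0 < a)
    (hf : AnalyticOnNhd ℂ f (closedAnn a)) (h1 : a ≤ R) (h2 : R ≤ R') (h3 : R' ≤ a⁻¹) :
    Real.circleAverage f 0 R = Real.circleAverage f 0 R' := by
  have hR : 0 < R := ha.trans_le h1
  rw [Real.circleAverage_eq_circleIntegral hR.ne',
    Real.circleAverage_eq_circleIntegral (hR.trans_le h2).ne']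
  congr 1
  refine (Complex.circleIntegral_sub_center_inv_smul_eq_of_differentiable_on_annulus_off_countable
    hR h2 (Set.countable_empty) (fun z hz => ?_) fun z hz => ?_).symm
  · refine (hf z ⟨?_, ?_⟩).continuousAt.continuousWithinAt
    · have := hz.2; simp at this; linarith
    · have := hz.1; simp at this; linarith
  · refine (hf z ⟨?_, ?_⟩).differentiableAt
    · have := hz.1.2; simp at this; linarith
    · have := hz.1.1; simp at this; linarith

theorem circleAverage_eq_one {f : ℂ → ℂ} {a R : ℝ} (ha : 0 < a) (ha1 : a ≤ 1)
    (hf : AnalyticOnNhd ℂ f (closedAnn a)) (h1 : a ≤ R) (h2 : R ≤ a⁻¹) :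
    Real.circleAverage f 0 R = Real.circleAverage f 0 1 := by
  have hinv : 1 ≤ a⁻¹ := (one_le_inv₀ ha).2 ha1
  rcases le_total R 1 with h | h
  · exact circleAverage_eq_of_analytic ha hf h1 h hinv
  · exact (circleAverage_eq_of_analytic ha hf ha1 h h2).symm

theorem norm_circleAverage_le {f : ℂ → ℂ} {R M : ℝ} (hR : 0 ≤ R)
    (h : ∀ z, ‖z‖ = R → ‖f z‖ ≤ M) : ‖Real.circleAverage f 0 R‖ ≤ M := by
  rw [Real.circleAverage_def, norm_smul, norm_inv, Real.norm_of_nonneg (by positivity)]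
  have := intervalIntegral.norm_integral_le_of_norm_le_const (a := 0) (b := 2 * Real.pi)
    (f := fun θ => f (circleMap 0 R θ)) (C := M) fun θ _ => h _ (by
      rw [norm_circleMap_zero, abs_of_nonneg hR])
  rw [sub_zero, abs_of_nonneg (by positivity)] at this
  rw [inv_mul_le_iff₀ (by positivity)]
  exact this.trans_eq (mul_comm _ _)

theorem circleCoeff_eq_circleAverage (f : ℂ → ℂ) (l : ℤ) :
    circleCoeff f l = Real.circleAverage (fun z => f z * z ^ (-l)) 0 1 := by
  rw [circleCoeff, Real.circleAverage_def, Complex.real_smul]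
  congr 1
  · push_cast; rfl
  · refine intervalIntegral.integral_congr fun t _ => ?_
    simp only [circleMap, Complex.ofReal_one, one_mul, zero_add]
    rw [← Complex.exp_int_mul]
    congr 2
    push_cast; ring

theorem analyticOnNhd_zpow {a : ℝ} (ha : 0 < a) (l : ℤ) :
    AnalyticOnNhd ℂ (fun z : ℂ => z ^ l) (closedAnn a) := fun _ hz =>
  analyticAt_id.zpow (ne_zero_of_mem_closedAnn ha hz)

/-- Cauchy's estimate for the Laurent coefficients. -/
theorem norm_circleCoeff_le {f : ℂ → ℂ} {a R M : ℝ} (ha : 0 < a) (ha1 : a ≤ 1)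
    (hf : AnalyticOnNhd ℂ f (closedAnn a)) (h1 : a ≤ R) (h2 : R ≤ a⁻¹)
    (hM : ∀ z, ‖z‖ = R → ‖f z‖ ≤ M) (l : ℤ) : ‖circleCoeff f l‖ ≤ M * R ^ (-l) := by
  have hR : 0 < R := ha.trans_le h1
  rw [circleCoeff_eq_circleAverage,
    ← circleAverage_eq_one ha ha1 (hf.mul (analyticOnNhd_zpow ha (-l))) h1 h2]
  refine norm_circleAverage_le hR.le fun z hz => ?_
  rw [norm_mul, norm_zpow, hz]
  gcongr
  exact hM z hz

theorem inv_zpow_natAbs_of_nonneg {a : ℝ} {l : ℤ} (hl : 0 ≤ l) :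
    (a⁻¹) ^ (-l) = a ^ l.natAbs := by
  rw [inv_zpow, zpow_neg, inv_inv, ← zpow_natCast, Int.natAbs_of_nonneg hl]

theorem zpow_natAbs_of_nonpos {a : ℝ} {l : ℤ} (hl : l ≤ 0) : a ^ (-l) = a ^ l.natAbs := by
  rw [← zpow_natCast, Int.ofNat_natAbs_of_nonpos hl]

theorem zpow_neg_le_inv_pow_natAbs {a : ℝ} (ha : 0 < a) (ha1 : a ≤ 1) (l : ℤ) :
    a ^ (-l) ≤ (a ^ l.natAbs)⁻¹ := by
  rw [← zpow_natCast, ← zpow_neg]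
  exact zpow_le_zpow_right_of_le_one₀ ha ha1 (by omega)

theorem inv_zpow_neg_le_inv_pow_natAbs {a : ℝ} (ha : 0 < a) (ha1 : a ≤ 1) (l : ℤ) :
    (a⁻¹) ^ (-l) ≤ (a ^ l.natAbs)⁻¹ := by
  rw [inv_zpow, zpow_neg, inv_inv, ← zpow_natCast, ← zpow_neg]
  exact zpow_le_zpow_right_of_le_one₀ ha ha1 (by omega)

/-- The Laurent coefficients of a function that is bounded on both boundary circles decay
geometrically. -/
theorem norm_circleCoeff_le_pow {f : ℂ → ℂ} {a M : ℝ} (ha : 0 < a) (ha1 : a ≤ 1)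
    (hf : AnalyticOnNhd ℂ f (closedAnn a)) (hM : ∀ z, ‖z‖ = a ∨ ‖z‖ = a⁻¹ → ‖f z‖ ≤ M) (l : ℤ) :
    ‖circleCoeff f l‖ ≤ M * a ^ l.natAbs := by
  have hinv : 1 ≤ a⁻¹ := (one_le_inv₀ ha).2 ha1
  -- The outer circle serves nonnegative l and the inner one nonpositive l; both choices gain a^|l|.
  rcases le_total 0 l with hl | hl
  · have := norm_circleCoeff_le ha ha1 hf (by linarith : a ≤ a⁻¹) le_rfl
      (fun z hz => hM z (Or.inr hz)) l
    rwa [inv_zpow_natAbs_of_nonneg hl] at this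
  · have := norm_circleCoeff_le ha ha1 hf le_rfl (by linarith : a ≤ a⁻¹)
      (fun z hz => hM z (Or.inl hz)) l
    rwa [zpow_natAbs_of_nonpos hl] at this

theorem summable_norm_circleCoeff {f : ℂ → ℂ} {a : ℝ} (ha : 0 < a) (ha1 : a < 1)
    (hf : AnalyticOnNhd ℂ f (closedAnn a)) : ∃ M, 0 ≤ M ∧
    ∀ l, ‖circleCoeff f l‖ ≤ M * a ^ l.natAbs := by
  have hinv : 1 ≤ a⁻¹ := (one_le_inv₀ ha).2 ha1.le
  obtain ⟨M₁, h₁⟩ := (isCompact_sphere (0 : ℂ) a).exists_bound_of_continuousOn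
    (hf.continuousOn.mono (sphere_subset_closedAnn le_rfl (by linarith)))
  obtain ⟨M₂, h₂⟩ := (isCompact_sphere (0 : ℂ) a⁻¹).exists_bound_of_continuousOn
    (hf.continuousOn.mono (sphere_subset_closedAnn (by linarith) le_rfl))
  refine ⟨max 0 (max M₁ M₂), le_max_left _ _, norm_circleCoeff_le_pow ha ha1.le hf fun z hz => ?_⟩
  rcases hz with hz | hz
  · exact (h₁ z (mem_sphere_zero_iff_norm.2 hz)).trans
      ((le_max_left _ _).trans (le_max_right _ _))
  · exact (h₂ z (mem_sphere_zero_iff_norm.2 hz)).trans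
      ((le_max_right _ _).trans (le_max_right _ _))

/-- A continuous function on the unit circle with absolutely summable Fourier coefficients is the
sum of its Fourier series. -/
theorem hasSum_circleCoeff {f : ℂ → ℂ} (hf : ContinuousOn f (Metric.sphere 0 1))
    (hs : Summable fun l => ‖circleCoeff f l‖) {z : ℂ} (hz : ‖z‖ = 1) :
    HasSum (fun l : ℤ => circleCoeff f l * z ^ l) (f z) := by
  have hT : Fact (0 < 2 * Real.pi) := ⟨Real.two_pi_pos⟩
  have hcoe : ∀ t : ℝ, ((AddCircle.toCircle (t : AddCircle (2 * Real.pi)) : Circle) : ℂ) =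
      Complex.exp (t * Complex.I) := by
    intro t
    rw [AddCircle.toCircle_apply_mk, Circle.coe_exp]
    congr 2
    rw [div_self Real.two_pi_pos.ne', one_mul]
  let F : C(AddCircle (2 * Real.pi), ℂ) :=
    ⟨fun x => f (AddCircle.toCircle x : Circle), hf.comp_continuous
      (continuous_subtype_val.comp AddCircle.continuous_toCircle) fun x =>
        mem_sphere_zero_iff_norm.2 (Circle.norm_coe _)⟩
  have hfour : ∀ (l : ℤ) (t : ℝ), fourier l (t : AddCircle (2 * Real.pi)) =
      Complex.exp (t * Complex.I) ^ l := by
    intro l t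
    rw [fourier_coe_apply, ← Complex.exp_int_mul]
    congr 1
    have : (Real.pi : ℂ) ≠ 0 := by exact_mod_cast Real.pi_ne_zero
    push_cast
    field_simp
  have hco : ∀ l, fourierCoeff F l = circleCoeff f l := by
    intro l
    rw [fourierCoeff_eq_intervalIntegral F l 0, circleCoeff, Complex.real_smul, zero_add]
    congr 1
    · push_cast; rw [one_div]
    · refine intervalIntegral.integral_congr fun t _ => ?_
      simp only [hfour, smul_eq_mul]
      rw [mul_comm]
      congr 1
      · exact congrArg f (hcoe t)
      · rw [← Complex.exp_int_mul]; congr 1; push_cast; ring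
  have hsum : Summable (fourierCoeff F) := by
    refine Summable.of_norm ?_
    simpa only [hco] using hs
  obtain ⟨t, ht⟩ : ∃ t : ℝ, Complex.exp (t * Complex.I) = z := ⟨Complex.arg z, by
    have := Complex.norm_mul_exp_arg_mul_I z
    rwa [hz, Complex.ofReal_one, one_mul] at this⟩
  have h := has_pointwise_sum_fourier_series_of_summable hsum (t : AddCircle (2 * Real.pi))
  have e : F (t : AddCircle (2 * Real.pi)) = f z := by
    rw [← ht]; exact congrArg f (hcoe t)
  rw [e] at h
  simpa only [hco, hfour, ht, smul_eq_mul] using h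

/-- The mean over the unit circle of a product, in terms of the Laurent coefficients. -/
theorem hasSum_circleAverage_mul {f g : ℂ → ℂ} (hf : ContinuousOn f (Metric.sphere 0 1))
    (hs : Summable fun l => ‖circleCoeff f l‖) (hg : ContinuousOn g (Metric.sphere 0 1)) :
    HasSum (fun l : ℤ => circleCoeff f l * circleCoeff g (-l))
      (Real.circleAverage (fun z => g z * f z) 0 1) := by
  obtain ⟨M, hM⟩ := (isCompact_sphere (0 : ℂ) 1).exists_bound_of_continuousOn hg
  have hmem : ∀ t : ℝ, circleMap 0 1 t ∈ Metric.sphere (0 : ℂ) 1 := fun t => by simp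
  have hnorm : ∀ t : ℝ, ‖circleMap 0 1 t‖ = 1 := fun t => by simp
  have hgc : Continuous fun t : ℝ => g (circleMap 0 1 t) :=
    hg.comp_continuous (continuous_circleMap 0 1) hmem
  have hzc : ∀ l : ℤ, Continuous fun t : ℝ => (circleMap 0 1 t) ^ l := fun l =>
    (continuous_circleMap 0 1).zpow₀ l fun t => Or.inl (by
      rw [← norm_ne_zero_iff, hnorm]; exact one_ne_zero)
  have h := intervalIntegral.hasSum_integral_of_dominated_convergence
    (μ := MeasureTheory.volume) (a := 0) (b := 2 * Real.pi)
    (F := fun (l : ℤ) t => circleCoeff f l * (g (circleMap 0 1 t) * (circleMap 0 1 t) ^ l))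
    (f := fun t => g (circleMap 0 1 t) * f (circleMap 0 1 t))
    (bound := fun l _ => M * ‖circleCoeff f l‖)
    (fun l => (continuous_const.mul (hgc.mul (hzc l))).aestronglyMeasurable)
    (fun l => Eventually.of_forall fun t _ => by
      rw [norm_mul, norm_mul, norm_zpow, hnorm, one_zpow, mul_one, mul_comm]
      gcongr
      exact hM _ (hmem t))
    (Eventually.of_forall fun t _ => hs.mul_left M)
    (continuous_const.intervalIntegrable _ _)
    (Eventually.of_forall fun t _ => by
      have := (hasSum_circleCoeff hf hs (hnorm t)).mul_left (g (circleMap 0 1 t))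
      refine this.congr_fun ?_
      intro l; ring)
  have h2 := h.mul_left (((2 * Real.pi)⁻¹ : ℝ) : ℂ)
  rw [Real.circleAverage_def, Complex.real_smul]
  refine h2.congr_fun fun l => ?_
  rw [intervalIntegral.integral_const_mul, circleCoeff_eq_circleAverage g,
    Real.circleAverage_def, Complex.real_smul, neg_neg]
  ring

end Annuli

end EDMD

end

noncomputable section

namespace EDMD

/-! ### Equidistant sampling and aliasing -/

section Sampling

theorem node_eq (m : ℕ) (α : ℝ) (j : Fin m) :
    node m α j = Complex.exp (Complex.I * α) * Complex.exp (2 * Real.pi * Complex.I / m) ^ (j : ℕ) := by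
  rw [node, Complex.exp_add, mul_comm, ← Complex.exp_nat_mul]
  congr 2
  ring

theorem norm_node (m : ℕ) (α : ℝ) (j : Fin m) : ‖node m α j‖ = 1 := by
  have e : 2 * Real.pi * Complex.I * (j : ℕ) / m + Complex.I * α =
      ((2 * Real.pi * (j : ℕ) / m + α : ℝ) : ℂ) * Complex.I := by
    push_cast; ring
  rw [node, e, Complex.norm_exp_ofReal_mul_I]

theorem conj_node_zpow (m : ℕ) (α : ℝ) (j : Fin m) (l : ℤ) :
    starRingEnd ℂ (node m α j ^ l) = node m α j ^ (-l) := by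
  rw [map_zpow₀, ← Complex.inv_eq_conj (norm_node m α j), inv_zpow, zpow_neg]

theorem node_ne_zero (m : ℕ) (α : ℝ) (j : Fin m) : node m α j ≠ 0 := Complex.exp_ne_zero _

/-- The mean of `z ^ s` over the nodes. -/
def nodeMean (m : ℕ) (α : ℝ) (s : ℤ) : ℂ := (m : ℂ)⁻¹ * ∑ j, node m α j ^ s

theorem nodeMean_zero {m : ℕ} (hm : 0 < m) (α : ℝ) : nodeMean m α 0 = 1 := by
  have : (m : ℂ) ≠ 0 := by exact_mod_cast hm.ne'
  simp [nodeMean, this]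

/-- Up to the factor from the rotation by α, this is a full geometric sum over the powers of an m-th
root of unity different from 1. -/
theorem nodeMean_eq_zero {m : ℕ} (hm : 0 < m) (α : ℝ) {s : ℤ} (hs : ¬ (m : ℤ) ∣ s) :
    nodeMean m α s = 0 := by
  set w := Complex.exp (2 * Real.pi * Complex.I / m) with hw
  have hprim : IsPrimitiveRoot w m := Complex.isPrimitiveRoot_exp m hm.ne'
  have h1 : w ^ s ≠ 1 := fun h => hs ((hprim.zpow_eq_one_iff_dvd s).1 h)
  have hsum : ∑ j ∈ Finset.range m, (w ^ s) ^ j = 0 := by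
    have := mul_geom_sum (w ^ s) m
    rw [← zpow_natCast (w ^ s) m, ← zpow_mul, mul_comm s, zpow_mul, zpow_natCast, hprim.pow_eq_one,
      one_zpow, sub_self, mul_eq_zero] at this
    exact this.resolve_left (sub_ne_zero.2 h1)
  have e : ∀ j : Fin m, node m α j ^ s = Complex.exp (Complex.I * α) ^ s * (w ^ s) ^ (j : ℕ) := by
    intro j
    rw [node_eq, mul_zpow, ← zpow_natCast w, ← zpow_mul, ← zpow_natCast (w ^ s), ← zpow_mul,
      mul_comm s]
  rw [nodeMean, Finset.sum_congr rfl fun j _ => e j, ← Finset.mul_sum,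
    Fin.sum_univ_eq_sum_range (fun j => (w ^ s) ^ j), hsum, mul_zero, mul_zero]

theorem norm_nodeMean_le {m : ℕ} (hm : 0 < m) (α : ℝ) (s : ℤ) : ‖nodeMean m α s‖ ≤ 1 := by
  rw [nodeMean, norm_mul, norm_inv, Complex.norm_natCast, inv_mul_le_iff₀ (by exact_mod_cast hm)]
  refine (norm_sum_le _ _).trans ?_
  simp [norm_zpow, norm_node]

/-- Sampled Fourier coefficients. -/
def sampleCoeff (m : ℕ) (α : ℝ) (f : ℂ → ℂ) (l : ℤ) : ℂ :=
  (m : ℂ)⁻¹ * ∑ j, f (node m α j) * starRingEnd ℂ (node m α j ^ l)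

/-- The aliasing error of equidistant sampling. -/
theorem norm_sampleCoeff_sub_le {f : ℂ → ℂ} {a K : ℝ} (ha : 0 < a) (ha1 : a < 1) (hK : 0 ≤ K)
    (hf : ContinuousOn f (Metric.sphere 0 1)) (hc : ∀ p, ‖circleCoeff f p‖ ≤ K * a ^ p.natAbs)
    {m : ℕ} (hm : 0 < m) (α : ℝ) {l : ℤ} :
    ‖sampleCoeff m α f l - circleCoeff f l‖ ≤ K * (2 / (1 - a) * a ^ (m - l.natAbs)) := by
  have hs : Summable fun p => ‖circleCoeff f p‖ :=
    Summable.of_nonneg_of_le (fun _ => norm_nonneg _) hc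
      ((summable_pow_natAbs ha.le ha1).mul_left K)
  have h1 : ∀ j : Fin m, HasSum (fun p => circleCoeff f p * node m α j ^ (p - l))
      (f (node m α j) * starRingEnd ℂ (node m α j ^ l)) := by
    intro j
    rw [conj_node_zpow]
    refine ((hasSum_circleCoeff hf hs (norm_node m α j)).mul_right _).congr_fun fun p => ?_
    rw [mul_assoc, ← zpow_add₀ (node_ne_zero m α j), sub_eq_add_neg]
  have h2 : HasSum (fun p => circleCoeff f p * nodeMean m α (p - l)) (sampleCoeff m α f l) := by
    refine ((hasSum_sum fun j _ => h1 j).mul_left (m : ℂ)⁻¹).congr_fun fun p => ?_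
    rw [nodeMean, ← Finset.mul_sum]
    ring
  -- Only the p congruent to l modulo m survive sampling. Removing p = l leaves the error, whose
  -- indices all satisfy |p| ≥ m - |l|.
  have h3 := hasSum_ite_sub_hasSum h2 l
  rw [sub_self, nodeMean_zero hm, mul_one] at h3
  refine (h3.norm_le_of_bounded ((summable_geomTail_natAbs ha.le ha1 (m - l.natAbs)).mul_left
    K).hasSum fun p => ?_).trans ?_
  · have hnn := geomTail_nonneg ha.le (m - l.natAbs) p.natAbs
    split_ifs with hp
    · rw [norm_zero]; positivity
    by_cases hd : (m : ℤ) ∣ p - l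
    · have hle : m - l.natAbs ≤ p.natAbs := by
        have h5 := Int.le_of_dvd (abs_pos.2 (sub_ne_zero.2 hp)) ((dvd_abs _ _).2 hd)
        rw [Int.abs_eq_natAbs] at h5
        omega
      rw [geomTail, if_pos hle, norm_mul]
      calc _ ≤ ‖circleCoeff f p‖ * 1 := by gcongr; exact norm_nodeMean_le hm α _
        _ ≤ _ := by rw [mul_one]; exact hc p
    · rw [nodeMean_eq_zero hm α hd, mul_zero, norm_zero]; positivity
  · rw [tsum_mul_left]
    gcongr
    exact tsum_geomTail_natAbs_le ha.le ha1 _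

/-- Two distinct indices differ by less than 2n < m, so the monomials are orthonormal for the
discrete mean. -/
theorem laurentH_eq_one {n m : ℕ} (hm : 2 * n < m) (α : ℝ) : laurentH n m α = 1 := by
  ext k l
  have hk := Finset.mem_Ioo.1 k.2
  have hl := Finset.mem_Ioo.1 l.2
  have e : laurentH n m α k l = nodeMean m α ((k : ℤ) - l) := by
    simp only [laurentH, edmdH, Matrix.of_apply, observable, nodeMean]
    congr 1
    refine Finset.sum_congr rfl fun j _ => ?_
    rw [conj_node_zpow, ← zpow_add₀ (node_ne_zero m α j), sub_eq_add_neg]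
  rw [e]
  rcases eq_or_ne k l with rfl | hkl
  · rw [sub_self, nodeMean_zero (by omega), Matrix.one_apply_eq]
  · rw [Matrix.one_apply_ne hkl]
    refine nodeMean_eq_zero (by omega) α fun hd => ?_
    have hne : (k : ℤ) - l ≠ 0 := sub_ne_zero.2 fun h => hkl (Subtype.ext h)
    have h5 := Int.le_of_dvd (abs_pos.2 hne) ((dvd_abs _ _).2 hd)
    rw [Int.abs_eq_natAbs] at h5
    omega

theorem laurentM_apply {τ : ℂ → ℂ} {n m : ℕ} (hm : 2 * n < m) (α : ℝ) (k l : Idx n) :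
    laurentM τ n m α k l = sampleCoeff m α (fun z => τ z ^ (k : ℤ)) l := by
  have h : (edmdH (observable n) (node m α))⁻¹ = 1 := by
    have := laurentH_eq_one hm α
    rw [laurentH] at this
    rw [this, inv_one]
  rw [laurentM, edmdMatrix, h, mul_one]
  rfl

end Sampling

/-! ### Two coefficient bounds for the powers of an expansive map -/

section Expansive

/-- Expansiveness of `τ`, with an annulus `r₀ ≤ |z| ≤ r₀⁻¹` larger than the annulus of `r₁` on which
`τ` is holomorphic without zeros. -/
structure RegularExpansive (r₀ r₁ r₂ r₃ : ℝ) (τ : ℂ → ℂ) : Prop where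
  pos₀ : 0 < r₀
  lt₀₁ : r₀ < r₁
  pos₃ : 0 < r₃
  lt₃₂ : r₃ < r₂
  lt₂₁ : r₂ < r₁
  lt_one : r₁ < 1
  holo : AnalyticOnNhd ℂ τ (closedAnn r₀)
  ne_zero : ∀ z ∈ closedAnn r₀, τ z ≠ 0
  expansive :
    ((∀ z : ℂ, ‖z‖ = r₁ → r₃ < ‖τ z‖ ∧ ‖τ z‖ < r₂) ∧
      (∀ z : ℂ, ‖z‖ = r₁⁻¹ → r₂⁻¹ < ‖τ z‖ ∧ ‖τ z‖ < r₃⁻¹)) ∨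
    ((∀ z : ℂ, ‖z‖ = r₁ → r₂⁻¹ < ‖τ z‖ ∧ ‖τ z‖ < r₃⁻¹) ∧
      (∀ z : ℂ, ‖z‖ = r₁⁻¹ → r₃ < ‖τ z‖ ∧ ‖τ z‖ < r₂))

variable {r₀ r₁ r₂ r₃ : ℝ} {τ : ℂ → ℂ}

/-- On the boundary circles expansiveness itself excludes zeros, so τ is analytic and zero-free on
the compact annulus, and both properties are open. The strict gain r₀ < r₁ is needed for
injectivity, where r₀^|l| has to beat r₁^(-|l|). -/
theorem HolomorphicallyExpansive.exists_regular (h : HolomorphicallyExpansive r₁ r₂ r₃ τ)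
    (h₀ : ∀ z ∈ annulus r₁, τ z ≠ 0) : ∃ r₀, RegularExpansive r₀ r₁ r₂ r₃ τ := by
  have hr₁ : 0 < r₁ := (h.pos.trans h.lt₃₂).trans h.lt₂₁
  have hr₂ : 0 < r₂ := h.pos.trans h.lt₃₂
  set U : Set ℂ := {z | AnalyticAt ℂ τ z ∧ τ z ≠ 0} with hU
  have hUo : IsOpen U := by
    rw [isOpen_iff_mem_nhds]
    rintro z ⟨hz, hz0⟩
    filter_upwards [hz.eventually_analyticAt, hz.continuousAt.eventually_ne hz0] with w h1 h2
      using ⟨h1, h2⟩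
  have hsub : closedAnn r₁ ⊆ U := by
    intro z hz
    refine ⟨h.holo z (closedAnn_subset_closure_annulus hr₁ h.lt_one hz), ?_⟩
    have hpos : r₃ < ‖τ z‖ ∨ r₂⁻¹ < ‖τ z‖ → τ z ≠ 0 := by
      intro hor h0
      rw [h0, norm_zero] at hor
      have := inv_pos.2 hr₂
      rcases hor with h' | h' <;> linarith [h.pos]
    rcases hz.1.lt_or_eq with h1 | h1
    · rcases hz.2.lt_or_eq with h2 | h2
      · exact h₀ z ⟨h1, h2⟩
      · rcases h.expansive with h' | h'
        · exact hpos (Or.inr (h'.2 z h2).1)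
        · exact hpos (Or.inl (h'.2 z h2).1)
    · rcases h.expansive with h' | h'
      · exact hpos (Or.inl (h'.1 z h1.symm).1)
      · exact hpos (Or.inr (h'.1 z h1.symm).1)
  obtain ⟨b, hb0, hb1, hb⟩ := exists_larger_annulus hr₁ h.lt_one hUo hsub
  exact ⟨b, hb0, hb1, h.pos, h.lt₃₂, h.lt₂₁, h.lt_one, fun z hz => (hb hz).1,
    fun z hz => (hb hz).2, h.expansive⟩

theorem zpow_le_pow_natAbs_of_nonneg {x q : ℝ} (hx : 0 ≤ x) (h : x ≤ q) {k : ℤ} (hk : 0 ≤ k) :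
    x ^ k ≤ q ^ k.natAbs := by
  lift k to ℕ using hk
  simpa using pow_le_pow_left₀ hx h k

theorem zpow_le_pow_natAbs_of_nonpos {x q : ℝ} (hq : 0 < q) (h : q⁻¹ ≤ x) {k : ℤ} (hk : k ≤ 0) :
    x ^ k ≤ q ^ k.natAbs := by
  have hx : 0 < x := (inv_pos.2 hq).trans_le h
  have h2 := zpow_le_pow_natAbs_of_nonneg (inv_pos.2 hx).le (inv_le_of_inv_le₀ hq h)
    (k := -k) (by omega)
  rwa [inv_zpow, zpow_neg, inv_inv, Int.natAbs_neg] at h2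

theorem zpow_le_inv_pow_natAbs {x q : ℝ} (hq : 0 < q) (h1 : q ≤ x) (h2 : x ≤ q⁻¹) (k : ℤ) :
    x ^ k ≤ (q ^ k.natAbs)⁻¹ := by
  rw [← inv_pow]
  rcases le_total 0 k with hk | hk
  · exact zpow_le_pow_natAbs_of_nonneg (hq.le.trans h1) h2 hk
  · exact zpow_le_pow_natAbs_of_nonpos (inv_pos.2 hq) (by rwa [inv_inv]) hk

namespace RegularExpansive

theorem pos₂ (h : RegularExpansive r₀ r₁ r₂ r₃ τ) : 0 < r₂ := h.pos₃.trans h.lt₃₂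

theorem pos₁ (h : RegularExpansive r₀ r₁ r₂ r₃ τ) : 0 < r₁ := h.pos₂.trans h.lt₂₁

theorem one_lt_inv₁ (h : RegularExpansive r₀ r₁ r₂ r₃ τ) : 1 < r₁⁻¹ :=
  (one_lt_inv₀ h.pos₁).2 h.lt_one

theorem lt_one₀ (h : RegularExpansive r₀ r₁ r₂ r₃ τ) : r₀ < 1 := h.lt₀₁.trans h.lt_one

theorem one_lt_inv₀' (h : RegularExpansive r₀ r₁ r₂ r₃ τ) : 1 < r₀⁻¹ :=
  (one_lt_inv₀ h.pos₀).2 h.lt_one₀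

theorem closedAnn_subset (h : RegularExpansive r₀ r₁ r₂ r₃ τ) : closedAnn r₁ ⊆ closedAnn r₀ :=
  closedAnn_mono h.pos₀ h.lt₀₁.le

theorem analytic_zpow (h : RegularExpansive r₀ r₁ r₂ r₃ τ) (k : ℤ) :
    AnalyticOnNhd ℂ (fun z => τ z ^ k) (closedAnn r₀) := fun z hz =>
  (h.holo z hz).zpow (h.ne_zero z hz)

theorem sphere_subset (h : RegularExpansive r₀ r₁ r₂ r₃ τ) :
    Metric.sphere (0 : ℂ) 1 ⊆ closedAnn r₀ :=
  sphere_subset_closedAnn h.lt_one₀.le h.one_lt_inv₀'.le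

theorem continuousOn_zpow (h : RegularExpansive r₀ r₁ r₂ r₃ τ) (k : ℤ) :
    ContinuousOn (fun z => τ z ^ k) (Metric.sphere 0 1) :=
  (h.analytic_zpow k).continuousOn.mono h.sphere_subset

/-- On one of the two boundary circles, `τ ^ k` is small. -/
theorem exists_circle (h : RegularExpansive r₀ r₁ r₂ r₃ τ) (k : ℤ) :
    (∀ z : ℂ, ‖z‖ = r₁ → ‖τ z ^ k‖ ≤ r₂ ^ k.natAbs) ∨
      ∀ z : ℂ, ‖z‖ = r₁⁻¹ → ‖τ z ^ k‖ ≤ r₂ ^ k.natAbs := by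
  simp only [norm_zpow]
  rcases le_total 0 k with hk | hk
  · rcases h.expansive with h' | h'
    · exact Or.inl fun z hz => zpow_le_pow_natAbs_of_nonneg (norm_nonneg _) (h'.1 z hz).2.le hk
    · exact Or.inr fun z hz => zpow_le_pow_natAbs_of_nonneg (norm_nonneg _) (h'.2 z hz).2.le hk
  · rcases h.expansive with h' | h'
    · exact Or.inr fun z hz => zpow_le_pow_natAbs_of_nonpos h.pos₂ (h'.2 z hz).1.le hk
    · exact Or.inl fun z hz => zpow_le_pow_natAbs_of_nonpos h.pos₂ (h'.1 z hz).1.le hk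

/-- Cauchy's estimate on the circle where τ^k is small. That circle is dictated by k, so in l the
estimate may be unfavourable and cost r₁^(-|l|). -/
theorem norm_coeff_le (h : RegularExpansive r₀ r₁ r₂ r₃ τ) (k l : ℤ) :
    ‖circleCoeff (fun z => τ z ^ k) l‖ ≤ r₂ ^ k.natAbs * (r₁ ^ l.natAbs)⁻¹ := by
  have ha := (h.analytic_zpow k).mono h.closedAnn_subset
  have hr₂ := h.pos₂
  have hi := h.one_lt_inv₁
  have h1 := h.lt_one
  rcases h.exists_circle k with hc | hc
  · refine (norm_circleCoeff_le h.pos₁ h1.le ha le_rfl (by linarith) hc l).trans ?_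
    gcongr
    exact zpow_neg_le_inv_pow_natAbs h.pos₁ h1.le l
  · refine (norm_circleCoeff_le h.pos₁ h1.le ha (by linarith) le_rfl hc l).trans ?_
    gcongr
    exact inv_zpow_neg_le_inv_pow_natAbs h.pos₁ h1.le l

/-- Here the circle is chosen according to the sign of l, which gains r₁^|l|; on it τ^k is only
known to be at most r₃^(-|k|). This is the bound that controls aliasing. -/
theorem norm_coeff_le_pow (h : RegularExpansive r₀ r₁ r₂ r₃ τ) (k l : ℤ) :
    ‖circleCoeff (fun z => τ z ^ k) l‖ ≤ (r₃ ^ k.natAbs)⁻¹ * r₁ ^ l.natAbs := by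
  have ha := (h.analytic_zpow k).mono h.closedAnn_subset
  have h32 : r₂ < r₃⁻¹ := by
    have := (one_lt_inv₀ h.pos₃).2 ((h.lt₃₂.trans h.lt₂₁).trans h.lt_one)
    have := h.lt₂₁.trans h.lt_one
    linarith
  have h23 : r₃ < r₂⁻¹ := by
    have := (one_lt_inv₀ h.pos₂).2 (h.lt₂₁.trans h.lt_one)
    have := (h.lt₃₂.trans h.lt₂₁).trans h.lt_one
    linarith
  refine norm_circleCoeff_le_pow h.pos₁ h.lt_one.le ha (fun z hz => ?_) l
  rw [norm_zpow]
  have key : r₃ ≤ ‖τ z‖ ∧ ‖τ z‖ ≤ r₃⁻¹ := by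
    rcases hz with hz | hz <;> rcases h.expansive with h' | h'
    · have := h'.1 z hz; constructor <;> linarith
    · have := h'.1 z hz; constructor <;> linarith
    · have := h'.2 z hz; constructor <;> linarith
    · have := h'.2 z hz; constructor <;> linarith
  exact zpow_le_inv_pow_natAbs h.pos₃ key.1 key.2 k

end RegularExpansive

end Expansive

end EDMD

end

noncomputable section

namespace EDMD

/-! ### The matrix of the Koopman operator and its finite rank approximation -/

section Koopman

variable {r r₀ r₁ r₂ r₃ : ℝ} {τ : ℂ → ℂ}

/-- The factor by which the matrix entries change on passing from the monomials to the orthonormal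
basis. -/
def weight (r : ℝ) (k l : ℤ) : ℂ := (r : ℂ) ^ l.natAbs * ((r : ℂ) ^ k.natAbs)⁻¹

theorem norm_weight (hr : 0 < r) (k l : ℤ) :
    ‖weight r k l‖ = r ^ l.natAbs * (r ^ k.natAbs)⁻¹ := by
  rw [weight, norm_mul, norm_inv, norm_pow, norm_pow, Complex.norm_real, Real.norm_of_nonneg hr.le]

/-- The matrix of the Koopman operator with respect to the orthonormal basis. -/
def koopEntry (r : ℝ) (τ : ℂ → ℂ) (k l : ℤ) : ℂ :=
  weight r k l * circleCoeff (fun z => τ z ^ k) l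

/-- The Koopman operator. -/
def koopOp (r : ℝ) (τ : ℂ → ℂ) : ElTwo →L[ℂ] ElTwo := colOp fun k => seqVec (koopEntry r τ k)

/-- The matrix of the approximating operator with respect to the orthonormal basis. -/
def approxEntry (r : ℝ) (τ : ℂ → ℂ) (n m : ℕ) (α : ℝ) (k l : ℤ) : ℂ :=
  if k.natAbs < n ∧ l.natAbs < n then
    weight r k l * sampleCoeff m α (fun z => τ z ^ k) l else 0

/-- The finite rank operator that is given by the EDMD matrix. -/
def approxOp (r : ℝ) (τ : ℂ → ℂ) (n m : ℕ) (α : ℝ) : ElTwo →L[ℂ] ElTwo :=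
  colOp fun k => seqVec (approxEntry r τ n m α k)

theorem finite_natAbs_lt (n : ℕ) : {k : ℤ | k.natAbs < n}.Finite :=
  (Set.finite_Ioo (-(n : ℤ)) n).subset fun k (hk : k.natAbs < n) => by
    rw [Set.mem_Ioo]; omega

theorem summable_approxEntry (r : ℝ) (τ : ℂ → ℂ) (n m : ℕ) (α : ℝ) (k : ℤ) :
    Summable fun l => ‖approxEntry r τ n m α k l‖ :=
  summable_of_hasFiniteSupport <| (finite_natAbs_lt n).subset fun l hl => by
    by_contra hcon
    have hcon : ¬ l.natAbs < n := hcon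
    simp [approxEntry, hcon] at hl

theorem seqVec_zero : seqVec 0 = 0 := by
  simp [seqVec]

theorem approxCol_eq_zero (r : ℝ) (τ : ℂ → ℂ) {n : ℕ} (m : ℕ) (α : ℝ) {k : ℤ}
    (hk : ¬ k.natAbs < n) : seqVec (approxEntry r τ n m α k) = 0 := by
  rw [← seqVec_zero]
  congr 1
  funext l
  simp [approxEntry, hk]

theorem summable_approxCol (r : ℝ) (τ : ℂ → ℂ) (n m : ℕ) (α : ℝ) :
    Summable fun k => ‖seqVec (approxEntry r τ n m α k)‖ :=
  summable_of_hasFiniteSupport <| (finite_natAbs_lt n).subset fun k hk => by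
    by_contra hcon
    have hcon : ¬ k.natAbs < n := hcon
    exact hk (by simp only [approxCol_eq_zero r τ m α hcon, norm_zero])

namespace RegularExpansive

theorem rate_lt_one (h : RegularExpansive r₀ r₁ r₂ r₃ τ) (hr : 0 < r) (hr2 : r ^ 2 = r₁ * r₂) :
    r / r₁ < 1 := by
  have h1 := h.pos₁
  rw [div_lt_one h1]
  have := h.lt₂₁
  nlinarith

theorem rate_eq (h : RegularExpansive r₀ r₁ r₂ r₃ τ) (hr : 0 < r) (hr2 : r ^ 2 = r₁ * r₂) :
    r / r₁ = r₂ / r := by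
  have h1 := h.pos₁
  rw [div_eq_div_iff h1.ne' hr.ne', ← sq, hr2, mul_comm]

/-- Passing to the orthonormal basis turns r₂^|k| r₁^(-|l|) into (r₂/r)^|k| (r/r₁)^|l|. The choice
r² = r₁r₂ makes the two rates equal. -/
theorem norm_koopEntry_le (h : RegularExpansive r₀ r₁ r₂ r₃ τ) (hr : 0 < r)
    (hr2 : r ^ 2 = r₁ * r₂) (k l : ℤ) :
    ‖koopEntry r τ k l‖ ≤ (r / r₁) ^ k.natAbs * (r / r₁) ^ l.natAbs := by
  rw [koopEntry, norm_mul, norm_weight hr]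
  nth_rewrite 1 [h.rate_eq hr hr2]
  calc _ ≤ r ^ l.natAbs * (r ^ k.natAbs)⁻¹ * (r₂ ^ k.natAbs * (r₁ ^ l.natAbs)⁻¹) := by
        gcongr; exact h.norm_coeff_le k l
    _ = _ := by rw [div_pow, div_pow]; ring

theorem summable_koopEntry (h : RegularExpansive r₀ r₁ r₂ r₃ τ) (hr : 0 < r)
    (hr2 : r ^ 2 = r₁ * r₂) (k : ℤ) : Summable fun l => ‖koopEntry r τ k l‖ :=
  Summable.of_nonneg_of_le (fun _ => norm_nonneg _) (h.norm_koopEntry_le hr hr2 k)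
    ((summable_pow_natAbs (div_pos hr h.pos₁).le (h.rate_lt_one hr hr2)).mul_left _)

theorem norm_koopCol_le (h : RegularExpansive r₀ r₁ r₂ r₃ τ) (hr : 0 < r)
    (hr2 : r ^ 2 = r₁ * r₂) (k : ℤ) :
    ‖seqVec (koopEntry r τ k)‖ ≤ 2 / (1 - r / r₁) * (r / r₁) ^ k.natAbs := by
  have hρ := (div_pos hr h.pos₁).le
  have hρ1 := h.rate_lt_one hr hr2
  refine (norm_elTwo_le ((summable_pow_natAbs hρ hρ1).mul_left ((r / r₁) ^ k.natAbs))
    fun l => ?_).trans ?_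
  · rw [seqVec_apply (h.summable_koopEntry hr hr2 k)]
    exact h.norm_koopEntry_le hr hr2 k l
  · rw [tsum_mul_left, mul_comm]
    gcongr
    exact tsum_pow_natAbs_le hρ hρ1

theorem summable_koopCol (h : RegularExpansive r₀ r₁ r₂ r₃ τ) (hr : 0 < r)
    (hr2 : r ^ 2 = r₁ * r₂) : Summable fun k => ‖seqVec (koopEntry r τ k)‖ :=
  Summable.of_nonneg_of_le (fun _ => norm_nonneg _) (h.norm_koopCol_le hr hr2)
    ((summable_pow_natAbs (div_pos hr h.pos₁).le (h.rate_lt_one hr hr2)).mul_left _)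

theorem isHilbertSchmidt_koopOp (h : RegularExpansive r₀ r₁ r₂ r₃ τ) (hr : 0 < r)
    (hr2 : r ^ 2 = r₁ * r₂) : IsHilbertSchmidt (koopOp r τ) := by
  have hs := h.summable_koopCol hr hr2
  have hρ := (div_pos hr h.pos₁).le
  have hρ1 := h.rate_lt_one hr hr2
  refine isHilbertSchmidt_of_summable ?_
  simp only [koopOp, colOp_basisVec hs]
  refine Summable.of_nonneg_of_le (fun _ => by positivity) (fun k => ?_)
    (hs.mul_left (2 / (1 - r / r₁)))
  rw [sq]
  gcongr
  refine (h.norm_koopCol_le hr hr2 k).trans ?_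
  have : 0 < 1 - r / r₁ := by linarith
  exact mul_le_of_le_one_right (by positivity) (pow_le_one₀ hρ hρ1.le)

/-- As r₂ = (r/r₁) r, the sampling condition reads r₁^m ≤ (r/r₁)^n (r r₃)^n. Of the last power, the
part with exponent |k| cancels r^(-|k|) r₃^(-|k|), which come from the weight and from the
coefficient bound; the remaining (r r₃)^(n-|k|) is summable over k uniformly in n. -/
theorem norm_sample_error_le (h : RegularExpansive r₀ r₁ r₂ r₃ τ) (hr : 0 < r)
    (hr2 : r ^ 2 = r₁ * r₂) {n m : ℕ} (hm : 2 * n < m) (hpow : r₁ ^ m ≤ (r₂ * r₃) ^ n) (α : ℝ)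
    {k l : ℤ} (hk : k.natAbs < n) (hl : l.natAbs < n) :
    ‖weight r k l * sampleCoeff m α (fun z => τ z ^ k) l - koopEntry r τ k l‖ ≤
      2 / (1 - r₁) * (r / r₁) ^ n * geomHead (r * r₃) n k.natAbs * (r / r₁) ^ l.natAbs := by
  have h1 := h.pos₁
  have h2 := h.pos₂
  have h3 := h.pos₃
  have h4 : 0 < 1 - r₁ := by linarith [h.lt_one]
  have hs := norm_sampleCoeff_sub_le h1 h.lt_one (inv_nonneg.2 (pow_nonneg h3.le k.natAbs))
    (h.continuousOn_zpow k) (h.norm_coeff_le_pow k) (by omega : 0 < m) α (l := l)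
  rw [koopEntry, ← mul_sub, norm_mul, norm_weight hr, geomHead, if_pos hk]
  have e1 : r₁ ^ (m - l.natAbs) = r₁ ^ m * (r₁ ^ l.natAbs)⁻¹ := by
    rw [pow_sub₀ _ h1.ne' (by omega)]
  have e2 : (r₂ * r₃) ^ n = (r / r₁) ^ n * ((r * r₃) ^ k.natAbs * (r * r₃) ^ (n - k.natAbs)) := by
    rw [← pow_add, Nat.add_sub_cancel' hk.le, ← mul_pow, h.rate_eq hr hr2]
    congr 1
    field_simp
  calc _ ≤ r ^ l.natAbs * (r ^ k.natAbs)⁻¹ *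
        ((r₃ ^ k.natAbs)⁻¹ * (2 / (1 - r₁) * r₁ ^ (m - l.natAbs))) := by gcongr
    _ ≤ r ^ l.natAbs * (r ^ k.natAbs)⁻¹ *
        ((r₃ ^ k.natAbs)⁻¹ * (2 / (1 - r₁) * ((r₂ * r₃) ^ n * (r₁ ^ l.natAbs)⁻¹))) := by
      rw [e1]; gcongr
    _ = _ := by
      rw [e2, mul_pow r r₃ k.natAbs, div_pow r r₁ l.natAbs]
      field_simp

/-- The three terms are the aliasing error, the discarded coordinates |l| ≥ n of a retained column,
and the discarded columns |k| ≥ n. -/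
theorem norm_approxCol_sub_le (h : RegularExpansive r₀ r₁ r₂ r₃ τ) (hr : 0 < r)
    (hr2 : r ^ 2 = r₁ * r₂) {n m : ℕ} (hm : 2 * n < m) (hpow : r₁ ^ m ≤ (r₂ * r₃) ^ n) (α : ℝ)
    (k : ℤ) :
    ‖seqVec (approxEntry r τ n m α k) - seqVec (koopEntry r τ k)‖ ≤
      2 / (1 - r / r₁) * (2 / (1 - r₁) * (r / r₁) ^ n * geomHead (r * r₃) n k.natAbs +
        (r / r₁) ^ n * (r / r₁) ^ k.natAbs + geomTail (r / r₁) n k.natAbs) := by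
  have hρ := (div_pos hr h.pos₁).le
  have hρ1 := h.rate_lt_one hr hr2
  have h3 := h.pos₃
  have h4 : 0 < 1 - r₁ := by linarith [h.lt_one]
  have h5 : 0 < 1 - r / r₁ := by linarith
  have hgh := geomHead_nonneg (by positivity : 0 ≤ r * r₃) n k.natAbs
  have hgt := geomTail_nonneg hρ n k.natAbs
  by_cases hk : k.natAbs < n
  · set c := 2 / (1 - r₁) * (r / r₁) ^ n * geomHead (r * r₃) n k.natAbs with hc
    have hc0 : 0 ≤ c := by positivity
    refine (norm_elTwo_le (((summable_pow_natAbs hρ hρ1).mul_left c).add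
      ((summable_geomTail_natAbs hρ hρ1 n).mul_left ((r / r₁) ^ k.natAbs))) fun l => ?_).trans ?_
    · have e : (seqVec (approxEntry r τ n m α k) - seqVec (koopEntry r τ k)) l =
          approxEntry r τ n m α k l - koopEntry r τ k l := by
        rw [lp.coeFn_sub, Pi.sub_apply, seqVec_apply (summable_approxEntry r τ n m α k),
          seqVec_apply (h.summable_koopEntry hr hr2 k)]
      rw [e]
      have hgt := geomTail_nonneg hρ n l.natAbs
      by_cases hl : l.natAbs < n
      · rw [approxEntry, if_pos ⟨hk, hl⟩]
        refine (h.norm_sample_error_le hr hr2 hm hpow α hk hl).trans ?_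
        have : 0 ≤ (r / r₁) ^ k.natAbs * geomTail (r / r₁) n l.natAbs := by positivity
        linarith
      · rw [approxEntry, if_neg fun hh => hl hh.2, zero_sub, norm_neg, geomTail,
          if_pos (not_lt.1 hl)]
        refine (h.norm_koopEntry_le hr hr2 k l).trans ?_
        have : 0 ≤ c * (r / r₁) ^ l.natAbs := by positivity
        linarith
    · rw [((summable_pow_natAbs hρ hρ1).mul_left c).tsum_add
        ((summable_geomTail_natAbs hρ hρ1 n).mul_left ((r / r₁) ^ k.natAbs)), tsum_mul_left,
        tsum_mul_left]
      have b1 : c * ∑' l : ℤ, (r / r₁) ^ l.natAbs ≤ c * (2 / (1 - r / r₁)) := by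
        gcongr; exact tsum_pow_natAbs_le hρ hρ1
      have b2 : (r / r₁) ^ k.natAbs * ∑' l : ℤ, geomTail (r / r₁) n l.natAbs ≤
          (r / r₁) ^ k.natAbs * (2 / (1 - r / r₁) * (r / r₁) ^ n) := by
        gcongr; exact tsum_geomTail_natAbs_le hρ hρ1 n
      have b3 : 0 ≤ 2 / (1 - r / r₁) * geomTail (r / r₁) n k.natAbs := by positivity
      calc _ ≤ c * (2 / (1 - r / r₁)) +
            (r / r₁) ^ k.natAbs * (2 / (1 - r / r₁) * (r / r₁) ^ n) := add_le_add b1 b2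
        _ ≤ _ := by linarith
  · rw [approxCol_eq_zero r τ m α hk, zero_sub, norm_neg]
    refine (h.norm_koopCol_le hr hr2 k).trans ?_
    rw [geomTail, if_pos (not_lt.1 hk)]
    gcongr
    have : 0 ≤ 2 / (1 - r₁) * (r / r₁) ^ n * geomHead (r * r₃) n k.natAbs +
        (r / r₁) ^ n * (r / r₁) ^ k.natAbs := by positivity
    linarith

/-- The approximating operators converge to the Koopman operator at the rate `(r₂/r₁) ^ (n/2)`. -/
theorem exists_norm_approxOp_sub_le (h : RegularExpansive r₀ r₁ r₂ r₃ τ) (hr : 0 < r)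
    (hr2 : r ^ 2 = r₁ * r₂) : ∃ K > 0, ∀ {n m : ℕ}, 2 * n < m → r₁ ^ m ≤ (r₂ * r₃) ^ n →
      ∀ α, ‖approxOp r τ n m α - koopOp r τ‖ ≤ K * (r / r₁) ^ n := by
  have hρ := (div_pos hr h.pos₁).le
  have hρ1 := h.rate_lt_one hr hr2
  have h3 := h.pos₃
  have h4 : 0 < 1 - r₁ := by linarith [h.lt_one]
  have h5 : 0 < 1 - r / r₁ := by linarith
  have hs0 : 0 ≤ r * r₃ := by positivity
  have hs1 : r * r₃ < 1 := by
    have h6 : r < 1 := by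
      have := (div_lt_one h.pos₁).1 hρ1
      linarith
    have h7 : r₃ < 1 := ((h.lt₃₂.trans h.lt₂₁).trans h.lt_one)
    nlinarith
  have h6 : 0 < 1 - r * r₃ := by linarith
  set A := 2 / (1 - r / r₁) with hA
  refine ⟨A * (2 / (1 - r₁) * (2 / (1 - r * r₃)) + A + A), by positivity,
    fun {n m} hm hpow α => ?_⟩
  have hsum1 := (summable_geomHead_natAbs (r * r₃) n).mul_left (2 / (1 - r₁) * (r / r₁) ^ n)
  have hsum2 := (summable_pow_natAbs hρ hρ1).mul_left ((r / r₁) ^ n)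
  have hsum3 := summable_geomTail_natAbs hρ hρ1 n
  have hsum := ((hsum1.add hsum2).add hsum3).mul_left A
  rw [approxOp, koopOp, colOp_sub (summable_approxCol r τ n m α) (h.summable_koopCol hr hr2)]
  have hle := h.norm_approxCol_sub_le hr hr2 hm hpow α
  have hsn := Summable.of_nonneg_of_le (fun _ => norm_nonneg _) hle hsum
  refine (norm_colOp_le hsn).trans ((hsn.tsum_le_tsum hle hsum).trans ?_)
  rw [tsum_mul_left, (hsum1.add hsum2).tsum_add hsum3, hsum1.tsum_add hsum2, tsum_mul_left,
    tsum_mul_left]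
  calc _ ≤ A * (2 / (1 - r₁) * (r / r₁) ^ n * (2 / (1 - r * r₃)) + (r / r₁) ^ n * A +
        A * (r / r₁) ^ n) := by
        gcongr
        · exact tsum_geomHead_natAbs_le hs0 hs1 n
        · exact tsum_pow_natAbs_le hρ hρ1
        · exact tsum_geomTail_natAbs_le hρ hρ1 n
    _ = _ := by ring

end RegularExpansive

end Koopman

end EDMD

end

noncomputable section

namespace EDMD

/-! ### The matrix does represent composition with τ -/

section KoopmanProperty

variable {r r₀ r₁ r₂ r₃ : ℝ} {τ : ℂ → ℂ}

theorem circleCoeff_const_mul (a : ℂ) (f : ℂ → ℂ) (l : ℤ) :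
    circleCoeff (fun z => a * f z) l = a * circleCoeff f l := by
  simp only [circleCoeff, mul_assoc, intervalIntegral.integral_const_mul]
  ring

theorem circleCoeff_sum {ι : Type*} (s : Finset ι) {f : ι → ℂ → ℂ}
    (hf : ∀ i ∈ s, ContinuousOn (f i) (Metric.sphere 0 1)) (l : ℤ) :
    circleCoeff (fun z => ∑ i ∈ s, f i z) l = ∑ i ∈ s, circleCoeff (f i) l := by
  simp only [circleCoeff, Finset.sum_mul]
  rw [intervalIntegral.integral_finsetSum, Finset.mul_sum]
  intro i hi
  refine Continuous.intervalIntegrable (Continuous.mul ?_ (by fun_prop)) _ _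
  exact (hf i hi).comp_continuous (by fun_prop) fun t => by
    rw [mem_sphere_zero_iff_norm, Complex.norm_exp_ofReal_mul_I]

theorem laurentFun_apply (p : ℤ →₀ ℂ) (z : ℂ) :
    laurentFun p z = ∑ k ∈ p.support, p k * z ^ k := rfl

theorem ofLaurent_eq_sum (r : ℝ) (p : ℤ →₀ ℂ) :
    (HardyC.ofLaurent r p : ElTwo) =
      ∑ k ∈ p.support, ((r : ℂ) ^ k.natAbs * p k) • basisVec k := by
  ext l
  rw [HardyC.ofLaurent_apply, ← coordL_apply l (∑ k ∈ p.support, _), map_sum]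
  simp only [map_smul, coordL_apply, basisVec_apply, smul_eq_mul, mul_ite, mul_one, mul_zero]
  rw [Finset.sum_ite_eq]
  split_ifs with h
  · rfl
  · rw [Finsupp.notMem_support_iff.1 h, mul_zero]

theorem inv_pow_mul_weight (hr : 0 < r) (k l : ℤ) :
    ((r : ℂ) ^ l.natAbs)⁻¹ * ((r : ℂ) ^ k.natAbs * weight r k l) = 1 := by
  have h : (r : ℂ) ≠ 0 := by exact_mod_cast hr.ne'
  rw [weight]
  field_simp

theorem RegularExpansive.isKoopman_koopOp (h : RegularExpansive r₀ r₁ r₂ r₃ τ) (hr : 0 < r)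
    (hr2 : r ^ 2 = r₁ * r₂) : IsKoopman r τ (koopOp r τ) := by
  intro p
  have hcont : ContinuousOn (fun z => laurentFun p (τ z)) (Metric.sphere 0 1) := by
    simp only [laurentFun_apply]
    exact continuousOn_finsetSum _ fun k _ => continuousOn_const.mul (h.continuousOn_zpow k)
  constructor
  · obtain ⟨M, hM⟩ := (isCompact_sphere (0 : ℂ) 1).exists_bound_of_continuousOn hcont
    have hmem : ∀ t : ℝ, Complex.exp (t * Complex.I) ∈ Metric.sphere (0 : ℂ) 1 := fun t => by
      rw [mem_sphere_zero_iff_norm, Complex.norm_exp_ofReal_mul_I]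
    exact MeasureTheory.MemLp.of_bound
      (hcont.comp_continuous (by fun_prop) hmem).aestronglyMeasurable M
      (Eventually.of_forall fun t => hM _ (hmem t))
  · intro l
    rw [ofLaurent_eq_sum, map_sum]
    simp only [laurentFun_apply]
    rw [circleCoeff_sum p.support (f := fun k z => p k * τ z ^ k)
      fun k _ => continuousOn_const.mul (h.continuousOn_zpow k), HardyC.coeff,
      ← coordL_apply l (∑ k ∈ p.support, _), map_sum, Finset.mul_sum]
    refine Finset.sum_congr rfl fun k _ => ?_
    rw [circleCoeff_const_mul, map_smul, map_smul, koopOp, colOp_basisVec (h.summable_koopCol hr hr2),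
      coordL_apply, seqVec_apply (h.summable_koopEntry hr hr2 k), koopEntry, smul_eq_mul]
    linear_combination (p k * circleCoeff (fun z => τ z ^ k) l) * inv_pow_mul_weight hr k l

theorem isKoopman_unique (hr : 0 < r) {C C' : HardyC r →L[ℂ] HardyC r}
    (hC : IsKoopman r τ C) (hC' : IsKoopman r τ C') : C' = C := by
  refine ContinuousLinearMap.coeFn_injective ((HardyC.denseRange_ofLaurent hr).equalizer
    C'.continuous C.continuous (funext fun p => ?_))
  have hr' : (r : ℂ) ≠ 0 := by exact_mod_cast hr.ne'
  ext l
  have h1 := (hC p).2 l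
  rw [← (hC' p).2 l, HardyC.coeff, HardyC.coeff] at h1
  exact (mul_left_cancel₀ (inv_ne_zero (pow_ne_zero _ hr')) h1).symm

end KoopmanProperty

/-! ### Dictionary between the EDMD matrix and the finite rank operator -/

section Approximation

variable {r r₀ r₁ r₂ r₃ : ℝ} {τ : ℂ → ℂ} {n m : ℕ} {α : ℝ}

theorem natAbs_lt_of_idx (k : Idx n) : (k : ℤ).natAbs < n := by
  have := Finset.mem_Ioo.1 k.2
  omega

theorem mem_idx_of_natAbs_lt {k : ℤ} (hk : k.natAbs < n) :
    k ∈ Finset.Ioo (-(n : ℤ)) (n : ℤ) := by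
  rw [Finset.mem_Ioo]; omega

/-- The Laurent polynomial with the coefficients `ξ`, as an element of the Hilbert space. -/
def vecL (r : ℝ) (ξ : Idx n → ℂ) : ElTwo := HardyC.ofLaurent r (laurentOfVec ξ)

theorem laurentOfVec_apply (ξ : Idx n → ℂ) (l : Idx n) : laurentOfVec ξ l = ξ l := by
  rw [laurentOfVec, Finsupp.finsetSum_apply, Finset.sum_eq_single l]
  · simp
  · intro k _ hk
    rw [Finsupp.single_apply, if_neg fun h => hk (Subtype.ext h)]
  · simp

theorem laurentOfVec_apply_eq_zero (ξ : Idx n → ℂ) {l : ℤ} (hl : ¬ l.natAbs < n) :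
    laurentOfVec ξ l = 0 := by
  rw [laurentOfVec, Finsupp.finsetSum_apply]
  refine Finset.sum_eq_zero fun k _ => ?_
  rw [Finsupp.single_apply, if_neg]
  rintro rfl
  exact hl (natAbs_lt_of_idx k)

theorem vecL_apply (ξ : Idx n → ℂ) (l : Idx n) :
    vecL r ξ l = (r : ℂ) ^ (l : ℤ).natAbs * ξ l := by
  rw [vecL, HardyC.ofLaurent_apply, laurentOfVec_apply]

theorem vecL_apply_eq_zero (ξ : Idx n → ℂ) {l : ℤ} (hl : ¬ l.natAbs < n) : vecL r ξ l = 0 := by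
  rw [vecL, HardyC.ofLaurent_apply, laurentOfVec_apply_eq_zero ξ hl, mul_zero]

theorem ext_idx {f g : ElTwo} (h : ∀ l : Idx n, f l = g l)
    (hf : ∀ l : ℤ, ¬ l.natAbs < n → f l = 0) (hg : ∀ l : ℤ, ¬ l.natAbs < n → g l = 0) : f = g := by
  ext l
  by_cases hl : l.natAbs < n
  · exact h ⟨l, mem_idx_of_natAbs_lt hl⟩
  · rw [hf l hl, hg l hl]

theorem smul_vecL_sub (a : ℂ) (ξ η : Idx n → ℂ) :
    a • vecL r ξ - vecL r η = vecL r (a • ξ - η) := by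
  refine ext_idx (n := n) (fun l => ?_) (fun l hl => ?_) fun l hl => vecL_apply_eq_zero _ hl
  · rw [lp.coeFn_sub, Pi.sub_apply, lp.coeFn_smul, Pi.smul_apply, vecL_apply, vecL_apply,
      vecL_apply, Pi.sub_apply, Pi.smul_apply, smul_eq_mul, smul_eq_mul]
    ring
  · rw [lp.coeFn_sub, Pi.sub_apply, lp.coeFn_smul, Pi.smul_apply, vecL_apply_eq_zero _ hl,
      vecL_apply_eq_zero _ hl, smul_zero, sub_zero]

theorem vecL_injective (hr : 0 < r) : Function.Injective (vecL r : (Idx n → ℂ) → ElTwo) := by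
  intro ξ η h
  have hr' : (r : ℂ) ≠ 0 := by exact_mod_cast hr.ne'
  funext l
  have := congrArg (fun f : ElTwo => f (l : ℤ)) h
  simp only [vecL_apply] at this
  exact mul_left_cancel₀ (pow_ne_zero _ hr') this

theorem vecL_zero : vecL r (0 : Idx n → ℂ) = 0 := by
  refine ext_idx (n := n) (fun l => ?_) (fun l hl => vecL_apply_eq_zero _ hl) fun l _ => rfl
  rw [vecL_apply, Pi.zero_apply, mul_zero]; rfl

theorem norm_sq_vecL (r : ℝ) (ξ : Idx n → ℂ) :
    ‖vecL r ξ‖ ^ 2 = ∑ k : Idx n, ‖ξ k‖ ^ 2 * r ^ (2 * (k : ℤ).natAbs) := by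
  have h := HardyC.norm_sq_ofLaurent r (laurentOfVec ξ)
  have h2 : ∑ k ∈ (laurentOfVec ξ).support, ‖laurentOfVec ξ k‖ ^ 2 * r ^ (2 * k.natAbs) =
      ∑ k ∈ Finset.Ioo (-(n : ℤ)) (n : ℤ), ‖laurentOfVec ξ k‖ ^ 2 * r ^ (2 * k.natAbs) := by
    refine Finset.sum_subset (fun k hk => ?_) fun k _ hk => ?_
    · by_contra hcon
      exact Finsupp.mem_support_iff.1 hk (laurentOfVec_apply_eq_zero ξ
        fun hlt => hcon (mem_idx_of_natAbs_lt hlt))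
    · rw [Finsupp.notMem_support_iff.1 hk]; simp
  rw [h2, ← Finset.sum_coe_sort] at h
  simp only [laurentOfVec_apply] at h
  exact h

theorem approxOp_apply (f : ElTwo) (l : ℤ) :
    approxOp r τ n m α f l = ∑ k : Idx n, f (k : ℤ) * approxEntry r τ n m α k l := by
  have h := (coordL l).hasSum (hasSum_colOp_apply (summable_approxCol r τ n m α) f)
  have h2 : HasSum (fun k => f k * approxEntry r τ n m α k l)
      (∑ k ∈ Finset.Ioo (-(n : ℤ)) (n : ℤ), f k * approxEntry r τ n m α k l) := by
    refine hasSum_sum_of_ne_finset_zero fun k hk => ?_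
    rw [approxEntry, if_neg fun hh => hk (mem_idx_of_natAbs_lt hh.1), mul_zero]
  rw [← Finset.sum_coe_sort] at h2
  refine h.unique (h2.congr_fun fun k => ?_)
  rw [map_smul, coordL_apply, seqVec_apply (summable_approxEntry r τ n m α k), smul_eq_mul]

theorem approxOp_apply_eq_zero (f : ElTwo) {l : ℤ} (hl : ¬ l.natAbs < n) :
    approxOp r τ n m α f l = 0 := by
  rw [approxOp_apply]
  refine Finset.sum_eq_zero fun k _ => ?_
  rw [approxEntry, if_neg fun hh => hl hh.2, mul_zero]

/-- The transpose appears because the row index k of M labels the function τ^k and the column index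
l its coefficient. The weights cancel against the normalisation of the basis. -/
theorem approxOp_apply_vecL (hr : 0 < r) (hm : 2 * n < m) (ξ : Idx n → ℂ) :
    approxOp r τ n m α (vecL r ξ) = vecL r ((laurentM τ n m α).transpose.mulVec ξ) := by
  refine ext_idx (n := n) (fun l => ?_) (fun l hl => approxOp_apply_eq_zero _ hl)
    fun l hl => vecL_apply_eq_zero _ hl
  rw [approxOp_apply, vecL_apply, Matrix.mulVec, dotProduct, Finset.mul_sum]
  refine Finset.sum_congr rfl fun k _ => ?_
  rw [vecL_apply, Matrix.transpose_apply, laurentM_apply hm, approxEntry,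
    if_pos ⟨natAbs_lt_of_idx k, natAbs_lt_of_idx l⟩, weight]
  have h : (r : ℂ) ≠ 0 := by exact_mod_cast hr.ne'
  field_simp

theorem isCompactOperator_approxOp : IsCompactOperator (approxOp r τ n m α) :=
  isCompactOperator_colOp (summable_approxCol r τ n m α)

/-- A matrix and its transpose have the same spectrum, since lam - A and its transpose have the same
determinant. -/
theorem mem_spectrum_matrix_iff {ι : Type*} [Fintype ι] [DecidableEq ι] (A : Matrix ι ι ℂ)
    (lam : ℂ) : lam ∈ spectrum ℂ A ↔ ∃ v, v ≠ 0 ∧ A.transpose.mulVec v = lam • v := by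
  have h1 : ∀ v, A.transpose.mulVec v = lam • v ↔
      ((lam • (1 : Matrix ι ι ℂ) - A).transpose).mulVec v = 0 := by
    intro v
    rw [Matrix.transpose_sub, Matrix.transpose_smul, Matrix.transpose_one, Matrix.sub_mulVec,
      Matrix.smul_mulVec, Matrix.one_mulVec, sub_eq_zero, eq_comm]
  simp only [h1]
  rw [Matrix.exists_mulVec_eq_zero_iff, Matrix.det_transpose, spectrum.mem_iff,
    Matrix.isUnit_iff_isUnit_det, isUnit_iff_ne_zero, not_not, Algebra.algebraMap_eq_smul_one]

theorem mem_spectrum_of_eigenvector {H : Type*} [NormedAddCommGroup H] [InnerProductSpace ℂ H]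
    {T : H →L[ℂ] H} {lam : ℂ} {x : H} (hx : x ≠ 0) (h : T x = lam • x) : lam ∈ spectrum ℂ T := by
  intro hres
  obtain ⟨K, -, hb⟩ := exists_bound_of_isUnit (mem_resolventSet_iff_isUnit_shift.1 hres)
  have := hb x
  rw [shift_apply, h, sub_self, norm_zero, mul_zero] at this
  exact hx (norm_le_zero_iff.1 this)

theorem mem_spectrum_approxOp (hr : 0 < r) (hm : 2 * n < m) {lam : ℂ}
    (h : lam ∈ spectrum ℂ (laurentM τ n m α)) : lam ∈ spectrum ℂ (approxOp r τ n m α) := by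
  obtain ⟨ξ, hξ, hM⟩ := (mem_spectrum_matrix_iff _ _).1 h
  refine mem_spectrum_of_eigenvector (x := vecL r ξ) ?_ ?_
  · rw [← vecL_zero (n := n)]
    exact fun h => hξ (vecL_injective hr h)
  · rw [approxOp_apply_vecL hr hm, hM]
    have := smul_vecL_sub (r := r) lam ξ 0
    rw [vecL_zero, sub_zero, sub_zero] at this
    exact this.symm

/-- An eigenvector for lam ≠ 0 lies in the range of the operator and so has no coordinates with |l|
≥ n. For lam = 0 this fails, as every basis vector of index |k| ≥ n is in the kernel. -/
theorem mem_spectrum_laurentM (hr : 0 < r) (hm : 2 * n < m) {lam : ℂ} (hlam : lam ≠ 0)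
    (h : lam ∈ spectrum ℂ (approxOp r τ n m α)) : lam ∈ spectrum ℂ (laurentM τ n m α) := by
  have hev := (isCompactOperator_approxOp.hasEigenvalue_iff_mem_spectrum hlam).2 h
  obtain ⟨f, hf, hf0⟩ := hev.exists_hasEigenvector
  rw [Module.End.mem_eigenspace_iff] at hf
  have hf' : approxOp r τ n m α f = lam • f := hf
  have hr' : (r : ℂ) ≠ 0 := by exact_mod_cast hr.ne'
  have hfz : ∀ l : ℤ, ¬ l.natAbs < n → f l = 0 := by
    intro l hl
    have := approxOp_apply_eq_zero (r := r) (τ := τ) (m := m) (α := α) f hl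
    rw [hf', lp.coeFn_smul, Pi.smul_apply, smul_eq_zero] at this
    exact this.resolve_left hlam
  set ξ : Idx n → ℂ := fun k => ((r : ℂ) ^ (k : ℤ).natAbs)⁻¹ * f (k : ℤ) with hξ
  have hfξ : f = vecL r ξ := by
    refine ext_idx (n := n) (fun l => ?_) hfz fun l hl => vecL_apply_eq_zero _ hl
    rw [vecL_apply, hξ]
    simp only
    rw [mul_inv_cancel_left₀ (pow_ne_zero _ hr')]
  refine (mem_spectrum_matrix_iff _ _).2 ⟨ξ, ?_, ?_⟩
  · intro h0
    rw [hfξ, h0, vecL_zero] at hf0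
    exact hf0 rfl
  · apply vecL_injective hr
    rw [← approxOp_apply_vecL hr hm, ← hfξ, hf', hfξ]
    have := smul_vecL_sub (r := r) lam ξ 0
    rwa [vecL_zero, sub_zero, sub_zero] at this

theorem shift_approxOp_pow_vecL (hr : 0 < r) (hm : 2 * n < m) (lam : ℂ) (ν : ℕ) (ξ : Idx n → ℂ) :
    (shift (approxOp r τ n m α) lam ^ ν) (vecL r ξ) =
      vecL r (((lam • (1 : Matrix (Idx n) (Idx n) ℂ) -
        (laurentM τ n m α).transpose) ^ ν).mulVec ξ) := by
  induction ν with
  | zero => simp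
  | succ ν ih =>
    rw [pow_succ', mul_apply_eq_comp, ih, shift_apply, approxOp_apply_vecL hr hm, smul_vecL_sub,
      pow_succ', ← Matrix.mulVec_mulVec]
    congr 1
    rw [Matrix.sub_mulVec, Matrix.smul_mulVec, Matrix.one_mulVec]

end Approximation

end EDMD

end

noncomputable section

namespace EDMD

/-! ### Nonvanishing degree of τ and injectivity of the Koopman operator -/

section Injectivity

variable {r r₀ r₁ r₂ r₃ : ℝ} {τ : ℂ → ℂ}

theorem hasDerivAt_log_norm {γ : ℝ → ℂ} {γ' : ℂ} {t : ℝ} (h : HasDerivAt γ γ' t) (h0 : γ t ≠ 0) :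
    HasDerivAt (fun s => Real.log ‖γ s‖) (γ' / γ t).re t := by
  have hn : ‖γ t‖ ^ 2 ≠ 0 := pow_ne_zero _ (norm_ne_zero_iff.2 h0)
  have h1 := (h.norm_sq.log hn).const_mul (1 / 2)
  have e1 : (fun s => Real.log ‖γ s‖) = fun s => 1 / 2 * Real.log (‖γ s‖ ^ 2) := by
    funext s; rw [Real.log_pow]; push_cast; ring
  rw [e1]
  refine h1.congr_deriv ?_
  rw [Complex.inner, Complex.div_re, Complex.normSq_eq_norm_sq, Complex.mul_re, Complex.conj_re,
    Complex.conj_im]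
  field_simp
  ring

namespace RegularExpansive

/-- `z τ'(z) / τ(z)`. -/
abbrev logDerivFun (τ : ℂ → ℂ) (z : ℂ) : ℂ := z * deriv τ z / τ z

theorem analytic_logDerivFun (h : RegularExpansive r₀ r₁ r₂ r₃ τ) :
    AnalyticOnNhd ℂ (logDerivFun τ) (closedAnn r₀) := fun z hz =>
  (analyticAt_id.mul (h.holo.deriv z hz)).div (h.holo z hz) (h.ne_zero z hz)

/-- The point with the logarithmic polar coordinates `t`, `θ`. -/
def logPolar (t θ : ℝ) : ℂ := circleMap 0 (Real.exp t) θ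

theorem norm_logPolar (t θ : ℝ) : ‖logPolar t θ‖ = Real.exp t := by
  rw [logPolar, norm_circleMap_zero, abs_of_pos (Real.exp_pos t)]

theorem continuous_logPolar : Continuous fun x : ℝ × ℝ => logPolar x.1 x.2 := by
  simp only [logPolar, circleMap]; fun_prop

theorem hasDerivAt_logPolar (t θ : ℝ) : HasDerivAt (fun s => logPolar s θ) (logPolar t θ) t := by
  have e : ∀ s, logPolar s θ = ((Real.exp s : ℝ) : ℂ) * Complex.exp (θ * Complex.I) := fun s => by
    rw [logPolar, circleMap, zero_add]
  rw [funext e, e]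
  exact ((Real.hasDerivAt_exp t).ofReal_comp).mul_const _

theorem logPolar_mem (h : RegularExpansive r₀ r₁ r₂ r₃ τ) {t : ℝ}
    (ht : t ∈ Set.Icc (Real.log r₁) (-Real.log r₁)) (θ : ℝ) : logPolar t θ ∈ closedAnn r₀ := by
  refine h.closedAnn_subset ⟨?_, ?_⟩
  · rw [norm_logPolar]
    exact (Real.exp_log h.pos₁).symm.le.trans (Real.exp_le_exp.2 ht.1)
  · rw [norm_logPolar]
    refine (Real.exp_le_exp.2 ht.2).trans ?_
    rw [Real.exp_neg, Real.exp_log h.pos₁]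

theorem continuousOn_logDeriv_logPolar (h : RegularExpansive r₀ r₁ r₂ r₃ τ) :
    ContinuousOn (fun x : ℝ × ℝ => logDerivFun τ (logPolar x.1 x.2))
      (Set.Icc (Real.log r₁) (-Real.log r₁) ×ˢ Set.univ) :=
  h.analytic_logDerivFun.continuousOn.comp continuous_logPolar.continuousOn
    fun _ hx => h.logPolar_mem hx.1 _

/-- By Cauchy's theorem on the annulus the mean of zτ'/τ does not depend on the radius. -/
theorem integral_re_logDeriv (h : RegularExpansive r₀ r₁ r₂ r₃ τ)
    (hd : Real.circleAverage (logDerivFun τ) 0 1 = 0) {t : ℝ}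
    (ht : t ∈ Set.Icc (Real.log r₁) (-Real.log r₁)) :
    ∫ θ in (0 : ℝ)..2 * Real.pi, (logDerivFun τ (logPolar t θ)).re = 0 := by
  have h1 := h.pos₁
  have hle : r₁ ≤ Real.exp t := (Real.exp_log h1).symm.le.trans (Real.exp_le_exp.2 ht.1)
  have hge : Real.exp t ≤ r₁⁻¹ := by
    refine (Real.exp_le_exp.2 ht.2).trans ?_
    rw [Real.exp_neg, Real.exp_log h1]
  have ha : Real.circleAverage (logDerivFun τ) 0 (Real.exp t) = 0 :=
    (circleAverage_eq_one h1 h.lt_one.le (h.analytic_logDerivFun.mono h.closedAnn_subset)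
      hle hge).trans hd
  rw [Real.circleAverage_def, smul_eq_zero] at ha
  have ha := ha.resolve_left (inv_ne_zero Real.two_pi_pos.ne')
  have hc : Continuous fun θ => logDerivFun τ (logPolar t θ) :=
    h.analytic_logDerivFun.continuousOn.comp_continuous
      (continuous_logPolar.comp (Continuous.prodMk_right t)) fun θ => h.logPolar_mem ht θ
  have := Complex.reCLM.intervalIntegral_comp_comm (hc.intervalIntegrable (μ := MeasureTheory.volume) 0 (2 * Real.pi))
  exact this.trans ((congrArg Complex.re ha).trans Complex.zero_re)

theorem hasDerivAt_log_norm_logPolar (h : RegularExpansive r₀ r₁ r₂ r₃ τ) {t : ℝ}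
    (ht : t ∈ Set.Icc (Real.log r₁) (-Real.log r₁)) (θ : ℝ) :
    HasDerivAt (fun s => Real.log ‖τ (logPolar s θ)‖) (logDerivFun τ (logPolar t θ)).re t := by
  have hm := h.logPolar_mem ht θ
  have hτ := ((h.holo _ hm).differentiableAt.hasDerivAt).scomp t (hasDerivAt_logPolar t θ)
  exact hasDerivAt_log_norm hτ (h.ne_zero _ hm)

/-- In logarithmic polar coordinates, the radial derivative of log|τ| is the real part of zτ'/τ. -/
theorem integral_re_logDeriv_radial (h : RegularExpansive r₀ r₁ r₂ r₃ τ) (θ : ℝ) :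
    ∫ t in (Real.log r₁)..(-Real.log r₁), (logDerivFun τ (logPolar t θ)).re =
      Real.log ‖τ (logPolar (-Real.log r₁) θ)‖ - Real.log ‖τ (logPolar (Real.log r₁) θ)‖ := by
  have hneg := Real.log_neg h.pos₁ h.lt_one
  have hu : Set.uIcc (Real.log r₁) (-Real.log r₁) = Set.Icc (Real.log r₁) (-Real.log r₁) :=
    Set.uIcc_of_le (by linarith)
  have hderiv : ∀ t ∈ Set.uIcc (Real.log r₁) (-Real.log r₁),
      HasDerivAt (fun s => Real.log ‖τ (logPolar s θ)‖) (logDerivFun τ (logPolar t θ)).re t :=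
    fun t ht => h.hasDerivAt_log_norm_logPolar (by rwa [hu] at ht) θ
  have hcont : ContinuousOn (fun t => logDerivFun τ (logPolar t θ))
      (Set.uIcc (Real.log r₁) (-Real.log r₁)) := by
    rw [hu]
    exact h.analytic_logDerivFun.continuousOn.comp
      (continuous_logPolar.comp (Continuous.prodMk_left θ)).continuousOn
      fun t ht => h.logPolar_mem ht θ
  have hre : ContinuousOn (fun t => (logDerivFun τ (logPolar t θ)).re)
      (Set.uIcc (Real.log r₁) (-Real.log r₁)) := Complex.continuous_re.comp_continuousOn hcont
  exact intervalIntegral.integral_eq_sub_of_hasDerivAt hderiv hre.intervalIntegrable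

/-- Fubini: integrating the radial derivative first in θ gives zero when the degree vanishes, so the
mean of log|τ| is the same on both boundary circles. -/
theorem integral_log_norm_sub (h : RegularExpansive r₀ r₁ r₂ r₃ τ)
    (hd : Real.circleAverage (logDerivFun τ) 0 1 = 0) :
    ∫ θ in (0 : ℝ)..2 * Real.pi, (Real.log ‖τ (logPolar (-Real.log r₁) θ)‖ -
      Real.log ‖τ (logPolar (Real.log r₁) θ)‖) = 0 := by
  have hneg := Real.log_neg h.pos₁ h.lt_one
  have hle : Real.log r₁ ≤ -Real.log r₁ := by linarith
  have hFc : ContinuousOn (fun x : ℝ × ℝ => (logDerivFun τ (logPolar x.1 x.2)).re)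
      (Set.Icc (Real.log r₁) (-Real.log r₁) ×ˢ Set.univ) :=
    Complex.continuous_re.comp_continuousOn h.continuousOn_logDeriv_logPolar
  have h3 : MeasureTheory.IntegrableOn
      (fun x : ℝ × ℝ => (logDerivFun τ (logPolar x.1 x.2)).re)
      (Set.Icc (Real.log r₁) (-Real.log r₁) ×ˢ Set.Icc 0 (2 * Real.pi)) :=
    (hFc.mono (Set.prod_mono_right (Set.subset_univ _))).integrableOn_compact
      (isCompact_Icc.prod isCompact_Icc)
  have hFi : MeasureTheory.IntegrableOn
      (Function.uncurry fun t θ : ℝ => (logDerivFun τ (logPolar t θ)).re)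
      (Set.uIoc (Real.log r₁) (-Real.log r₁) ×ˢ Set.uIoc 0 (2 * Real.pi)) := by
    refine h3.mono_set (Set.prod_mono ?_ ?_)
    · rw [Set.uIoc_of_le hle]; exact Set.Ioc_subset_Icc_self
    · rw [Set.uIoc_of_le Real.two_pi_pos.le]; exact Set.Ioc_subset_Icc_self
  have hswap := MeasureTheory.intervalIntegral_intervalIntegral_swap hFi
  have hleft : ∫ t in (Real.log r₁)..(-Real.log r₁), ∫ θ in (0 : ℝ)..2 * Real.pi,
      (logDerivFun τ (logPolar t θ)).re = 0 := by
    rw [intervalIntegral.integral_congr (g := fun _ => (0 : ℝ)) fun t ht => ?_]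
    · exact intervalIntegral.integral_zero
    · rw [Set.uIcc_of_le hle] at ht
      exact h.integral_re_logDeriv hd ht
  exact (intervalIntegral.integral_congr fun θ _ =>
    (h.integral_re_logDeriv_radial θ).symm).trans (hswap.symm.trans hleft)

/-- The mapping degree of `τ` does not vanish. -/
theorem circleAverage_logDeriv_ne_zero (h : RegularExpansive r₀ r₁ r₂ r₃ τ) :
    Real.circleAverage (logDerivFun τ) 0 1 ≠ 0 := by
  intro hd
  have hint := h.integral_log_norm_sub hd
  have h2 := h.pos₂
  have hneg := Real.log_neg h.pos₁ h.lt_one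
  have hm₁ : Real.log r₁ ∈ Set.Icc (Real.log r₁) (-Real.log r₁) := ⟨le_rfl, by linarith⟩
  have hm₂ : -Real.log r₁ ∈ Set.Icc (Real.log r₁) (-Real.log r₁) := ⟨by linarith, le_rfl⟩
  have hn₁ : ∀ θ, ‖logPolar (Real.log r₁) θ‖ = r₁ := fun θ => by
    rw [norm_logPolar, Real.exp_log h.pos₁]
  have hn₂ : ∀ θ, ‖logPolar (-Real.log r₁) θ‖ = r₁⁻¹ := fun θ => by
    rw [norm_logPolar, Real.exp_neg, Real.exp_log h.pos₁]
  have hlogc : ∀ t ∈ Set.Icc (Real.log r₁) (-Real.log r₁),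
      Continuous fun θ => Real.log ‖τ (logPolar t θ)‖ := by
    intro t ht
    refine Continuous.log ?_ fun θ => norm_ne_zero_iff.2 (h.ne_zero _ (h.logPolar_mem ht θ))
    exact (h.holo.continuousOn.comp_continuous
      (continuous_logPolar.comp (Continuous.prodMk_right t)) fun θ => h.logPolar_mem ht θ).norm
  have hi : IntervalIntegrable (fun θ => Real.log ‖τ (logPolar (-Real.log r₁) θ)‖ -
      Real.log ‖τ (logPolar (Real.log r₁) θ)‖) MeasureTheory.volume 0 (2 * Real.pi) :=
    ((hlogc _ hm₂).sub (hlogc _ hm₁)).intervalIntegrable _ _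
  have hlog2 : Real.log r₂ < 0 := Real.log_neg h2 (h.lt₂₁.trans h.lt_one)
  have hlog2' : 0 < Real.log r₂⁻¹ := by rw [Real.log_inv]; linarith
  have hpos : ∀ {t θ}, t ∈ Set.Icc (Real.log r₁) (-Real.log r₁) → 0 < ‖τ (logPolar t θ)‖ :=
    fun ht => norm_pos_iff.2 (h.ne_zero _ (h.logPolar_mem ht _))
  rcases h.expansive with h' | h'
  -- The integrand has a strict sign: log|τ| exceeds -log r₂ > 0 on one boundary circle and is below
  -- log r₂ < 0 on the other.
  · refine absurd hint (intervalIntegral.intervalIntegral_pos_of_pos_on hi (fun θ _ => ?_)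
      Real.two_pi_pos).ne'
    have a1 := Real.log_lt_log (inv_pos.2 h2) (h'.2 _ (hn₂ θ)).1
    have a2 := Real.log_lt_log (hpos hm₁) (h'.1 _ (hn₁ θ)).2
    linarith
  · have hp := intervalIntegral.intervalIntegral_pos_of_pos_on hi.neg (fun θ _ => ?_)
      Real.two_pi_pos
    · refine absurd hp (Eq.not_gt ?_)
      exact (intervalIntegral.integral_neg).trans (neg_eq_zero.2 hint)
    · have a1 := Real.log_lt_log (inv_pos.2 h2) (h'.1 _ (hn₁ θ)).1
      have a2 := Real.log_lt_log (hpos hm₂) (h'.2 _ (hn₂ θ)).2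
      simp only [Pi.neg_apply]
      linarith

/-- For k ≠ j the integrand, taken against dz/z, is the derivative of τ^(k-j)/(k-j) and integrates
to zero. For k = j the powers cancel and the degree of τ remains. -/
theorem circleAverage_zpow_mul (h : RegularExpansive r₀ r₁ r₂ r₃ τ) (k j : ℤ) :
    Real.circleAverage (fun z => τ z ^ k * (logDerivFun τ z * τ z ^ (-j))) 0 1 =
      if k = j then Real.circleAverage (logDerivFun τ) 0 1 else 0 := by
  have hmem : ∀ z ∈ Metric.sphere (0 : ℂ) 1, z ∈ closedAnn r₀ := fun z hz => h.sphere_subset hz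
  split_ifs with hkj
  · subst hkj
    refine Real.circleAverage_congr_sphere fun z hz => ?_
    rw [abs_one] at hz
    have := h.ne_zero z (hmem z hz)
    rw [mul_left_comm, ← zpow_add₀ this, add_neg_cancel, zpow_zero, mul_one]
  · rw [Real.circleAverage_eq_circleIntegral one_ne_zero]
    rw [circleIntegral.integral_eq_zero_of_hasDerivWithinAt
      (f := fun z => τ z ^ (k - j) / ((k - j : ℤ) : ℂ)) zero_le_one, smul_zero]
    intro z hz
    have hz0 := ne_zero_of_mem_closedAnn h.pos₀ (hmem z hz)
    have hτ0 := h.ne_zero z (hmem z hz)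
    have hkj' : ((k - j : ℤ) : ℂ) ≠ 0 := by exact_mod_cast sub_ne_zero.2 hkj
    have hd := (((hasDerivAt_zpow (k - j) (τ z) (Or.inl hτ0)).comp z
      (h.holo z (hmem z hz)).differentiableAt.hasDerivAt).div_const ((k - j : ℤ) : ℂ))
    refine (hd.congr_deriv ?_).hasDerivWithinAt
    have e : τ z ^ (k - j - 1) * τ z = τ z ^ k * τ z ^ (-j) := by
      rw [← zpow_add_one₀ hτ0, ← zpow_add₀ hτ0]; congr 1; ring
    simp only [logDerivFun, smul_eq_mul, sub_zero]
    field_simp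
    rw [mul_assoc, mul_comm (deriv τ z), ← mul_assoc, e]
    ring

/-- The Koopman operator is injective. -/
theorem koopOp_injective (h : RegularExpansive r₀ r₁ r₂ r₃ τ) (hr : 0 < r)
    (hr2 : r ^ 2 = r₁ * r₂) {f : ElTwo} (hf : koopOp r τ f = 0) : f = 0 := by
  have hr' : (r : ℂ) ≠ 0 := by exact_mod_cast hr.ne'
  have h0 := h.pos₀
  have h1 := h.pos₁
  have h2 := h.pos₂
  ext j
  set φ : ℂ → ℂ := fun z => logDerivFun τ z * τ z ^ (-j) with hφ
  have hφa : AnalyticOnNhd ℂ φ (closedAnn r₀) := h.analytic_logDerivFun.mul (h.analytic_zpow (-j))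
  obtain ⟨M, hM0, hM⟩ := summable_norm_circleCoeff h0 h.lt_one₀ hφa
  have hφs : Summable fun l => ‖circleCoeff φ l‖ :=
    Summable.of_nonneg_of_le (fun _ => norm_nonneg _) hM
      ((summable_pow_natAbs h0.le h.lt_one₀).mul_left M)
  -- A formal pairing of C f with φ, as a double series. Summed over k first, each term contains a
  -- coordinate of C f = 0; summed over l first, it gives the mean of τ^k φ, which vanishes unless k
  -- = j.
  set a : ℤ → ℤ → ℂ := fun k l =>
    f k * ((r : ℂ) ^ k.natAbs)⁻¹ * (circleCoeff φ l * circleCoeff (fun z => τ z ^ k) (-l)) with ha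
  have hρ := (div_pos hr h1).le
  have hρ1 := h.rate_lt_one hr hr2
  have hq : 0 ≤ r₀ / r₁ := (div_pos h0 h1).le
  have hq1 : r₀ / r₁ < 1 := (div_lt_one h1).2 h.lt₀₁
  -- Absolute convergence in l is where the larger annulus enters: the coefficients of φ decay like
  -- r₀^|l|, those of τ^k are only bounded by r₁^(-|l|).
  have hsum : Summable (Function.uncurry a) := by
    have hs2 := (summable_pow_natAbs hρ hρ1).mul_of_nonneg (summable_pow_natAbs hq hq1)
      (fun _ => by positivity) (fun _ => by positivity)
    refine Summable.of_norm_bounded (hs2.mul_left (‖f‖ * M)) fun x => ?_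
    obtain ⟨k, l⟩ := x
    have hfk : ‖f k‖ ≤ ‖f‖ := lp.norm_apply_le_norm two_ne_zero f k
    simp only [Function.uncurry, ha, norm_mul, norm_inv, norm_pow, Complex.norm_real,
      Real.norm_of_nonneg hr.le]
    have hc := h.norm_coeff_le k (-l)
    rw [Int.natAbs_neg] at hc
    calc _ ≤ ‖f‖ * (r ^ k.natAbs)⁻¹ * ((M * r₀ ^ l.natAbs) *
          (r₂ ^ k.natAbs * (r₁ ^ l.natAbs)⁻¹)) := by
          gcongr
          exact hM l
      _ = _ := by rw [h.rate_eq hr hr2, div_pow, div_pow]; field_simp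
  have hcol : ∀ l, ∑' k, a k l = 0 := by
    intro l
    have hs := (coordL (-l)).hasSum (hasSum_colOp_apply (h.summable_koopCol hr hr2) f)
    have hz : coordL (-l) (colOp (fun k => seqVec (koopEntry r τ k)) f) = 0 := by
      have : colOp (fun k => seqVec (koopEntry r τ k)) f = 0 := hf
      rw [this, map_zero]
    rw [hz] at hs
    have hs3 := hs.mul_left (((r : ℂ) ^ (-l).natAbs)⁻¹ * circleCoeff φ l)
    rw [mul_zero] at hs3
    refine (hs3.congr_fun fun k => ?_).tsum_eq
    rw [map_smul, coordL_apply, seqVec_apply (h.summable_koopEntry hr hr2 k), koopEntry, weight,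
      smul_eq_mul, ha]
    field_simp
  have hrow : ∀ k, ∑' l, a k l = f k * ((r : ℂ) ^ k.natAbs)⁻¹ *
      if k = j then Real.circleAverage (logDerivFun τ) 0 1 else 0 := by
    intro k
    rw [← h.circleAverage_zpow_mul k j]
    exact ((hasSum_circleAverage_mul (hφa.continuousOn.mono h.sphere_subset) hφs
      (h.continuousOn_zpow k)).mul_left _).tsum_eq
  have hcomm := hsum.tsum_comm
  simp only [hcol, hrow, tsum_zero] at hcomm
  rw [tsum_eq_single j fun k hk => by rw [if_neg hk, mul_zero], if_pos rfl] at hcomm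
  have hne := h.circleAverage_logDeriv_ne_zero
  have := hcomm.symm
  rw [mul_eq_zero, mul_eq_zero] at this
  rcases this with (h3 | h3) | h3
  · rw [h3]; rfl
  · exact absurd h3 (inv_ne_zero (pow_ne_zero _ hr'))
  · exact absurd h3 hne

end RegularExpansive

end Injectivity

end EDMD

end

noncomputable section

namespace EDMD

/-! ### Small eigenvalues from a determinant bound -/

section SmallEigenvalues

theorem pow_card_le_norm_det {ι : Type*} [Fintype ι] [DecidableEq ι] (A : Matrix ι ι ℂ) {ε : ℝ}
    (hε : 0 ≤ ε) (h : ∀ z ∈ spectrum ℂ A, ε ≤ ‖z‖) : ε ^ Fintype.card ι ≤ ‖A.det‖ := by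
  have key : ∀ s : Multiset ℂ, (∀ z ∈ s, ε ≤ ‖z‖) → ε ^ s.card ≤ ‖s.prod‖ := by
    intro s
    induction s using Multiset.induction with
    | empty => simp
    | cons a s ih =>
      intro hs
      rw [Multiset.card_cons, Multiset.prod_cons, norm_mul, pow_succ']
      exact mul_le_mul (hs a (Multiset.mem_cons_self a s))
        (ih fun z hz => hs z (Multiset.mem_cons_of_mem hz)) (by positivity) (norm_nonneg _)
  have hcard : A.charpoly.roots.card = Fintype.card ι := by
    rw [← (IsAlgClosed.splits A.charpoly).natDegree_eq_card_roots, A.charpoly_natDegree_eq_dim]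
  rw [Matrix.det_eq_prod_roots_charpoly, ← hcard]
  refine key _ fun z hz => h z ?_
  rw [Matrix.mem_spectrum_iff_isRoot_charpoly]
  exact Polynomial.isRoot_of_mem_roots hz

/-- Pulling u out of the rows and v out of the columns leaves entries of norm at most c, for which
the Leibniz formula gives N! c^N ≤ N^N c^N. -/
theorem norm_det_le {ι : Type*} [Fintype ι] [DecidableEq ι] (A : Matrix ι ι ℂ) {c : ℝ}
    {u v : ι → ℝ} (hu : ∀ i, 0 < u i) (hv : ∀ i, 0 < v i)
    (h : ∀ i j, ‖A i j‖ ≤ c * (u i * v j)) :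
    ‖A.det‖ ≤ (Fintype.card ι : ℝ) ^ Fintype.card ι * c ^ Fintype.card ι * ∏ i, (u i * v i) := by
  have hu' : ∀ i, (u i : ℂ) ≠ 0 := fun i => by exact_mod_cast (hu i).ne'
  have hv' : ∀ i, (v i : ℂ) ≠ 0 := fun i => by exact_mod_cast (hv i).ne'
  set B : Matrix ι ι ℂ := Matrix.of fun i j => A i j / (u i * v j) with hB
  have hAB : A = Matrix.of fun i j =>
      (u i : ℂ) * (Matrix.of fun i j => (v j : ℂ) * B i j : Matrix ι ι ℂ) i j := by
    ext i j
    have := hu' i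
    have := hv' j
    simp only [hB, Matrix.of_apply]
    field_simp
  have hBle : ∀ i j, IsAbsoluteValue.toAbsoluteValue (norm : ℂ → ℝ) (B i j) ≤ c := by
    intro i j
    have hpos := mul_pos (hu i) (hv j)
    change ‖A i j / (u i * v j)‖ ≤ c
    rw [norm_div, norm_mul, Complex.norm_real, Complex.norm_real, Real.norm_of_nonneg (hu i).le,
      Real.norm_of_nonneg (hv j).le, div_le_iff₀ hpos]
    exact h i j
  have hdet : ‖B.det‖ ≤ ((Fintype.card ι).factorial : ℝ) * c ^ Fintype.card ι := by
    have := Matrix.det_le hBle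
    rwa [nsmul_eq_mul] at this
  have hc : 0 ≤ c ^ Fintype.card ι := by
    rcases isEmpty_or_nonempty ι with hι | ⟨⟨i⟩⟩
    · simp
    · exact pow_nonneg ((norm_nonneg (B i i)).trans (hBle i i)) _
  have hn : ‖A.det‖ = (∏ i, (u i * v i)) * ‖B.det‖ := by
    rw [hAB, Matrix.det_mul_column, Matrix.det_mul_row, norm_mul, norm_mul, norm_prod, norm_prod,
      Finset.prod_mul_distrib, mul_assoc]
    simp only [Complex.norm_real, Real.norm_of_nonneg (hu _).le, Real.norm_of_nonneg (hv _).le]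
  rw [hn, mul_comm]
  refine mul_le_mul_of_nonneg_right (hdet.trans ?_)
    (Finset.prod_nonneg fun i _ => (mul_pos (hu i) (hv i)).le)
  exact mul_le_mul_of_nonneg_right (by exact_mod_cast Nat.factorial_le_pow _) hc

theorem card_idx (n : ℕ) : Fintype.card (Idx n) = 2 * n - 1 := by
  rw [Fintype.card_coe, Int.card_Ioo]; omega

theorem sum_natAbs_idx (n : ℕ) : ∑ l : Idx n, (l : ℤ).natAbs = n * (n - 1) := by
  rw [Finset.sum_coe_sort (Finset.Ioo (-(n : ℤ)) n) Int.natAbs]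
  induction n with
  | zero => simp
  | succ n ih =>
    rcases n.eq_zero_or_pos with rfl | hn
    · decide
    have e : Finset.Ioo (-((n + 1 : ℕ) : ℤ)) ((n + 1 : ℕ) : ℤ) =
        insert (n : ℤ) (insert (-(n : ℤ)) (Finset.Ioo (-(n : ℤ)) n)) := by
      ext k; simp only [Finset.mem_insert, Finset.mem_Ioo]; omega
    rw [e, Finset.sum_insert, Finset.sum_insert, ih]
    · obtain ⟨k, rfl⟩ := Nat.exists_eq_succ_of_ne_zero hn.ne'
      simp only [Int.natAbs_neg, Int.natAbs_natCast, Nat.succ_eq_add_one, Nat.add_sub_cancel]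
      ring
    · simp
    · simp only [Finset.mem_insert, Finset.mem_Ioo]; omega

variable {r r₀ r₁ r₂ r₃ : ℝ} {τ : ℂ → ℂ}

namespace RegularExpansive

/-- Only the decay in l is kept. The factors r^|k| and r^(-|l|) undo the passage to the orthonormal
basis and cancel in the diagonal product that bounds the determinant. -/
theorem norm_laurentM_le (h : RegularExpansive r₀ r₁ r₂ r₃ τ) (hr : 0 < r)
    (hr2 : r ^ 2 = r₁ * r₂) {n m : ℕ} (hm : 2 * n < m) (hpow : r₁ ^ m ≤ (r₂ * r₃) ^ n) (α : ℝ)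
    (k l : Idx n) :
    ‖laurentM τ n m α k l‖ ≤ (1 + 2 / (1 - r₁)) *
      (r ^ (k : ℤ).natAbs * ((r ^ (l : ℤ).natAbs)⁻¹ * (r / r₁) ^ (l : ℤ).natAbs)) := by
  have hρ := (div_pos hr h.pos₁).le
  have hρ1 := (h.rate_lt_one hr hr2).le
  have h3 := h.pos₃
  have h4 : 0 < 1 - r₁ := by linarith [h.lt_one]
  have hrr : r < 1 := by
    have := h.rate_lt_one hr hr2
    rw [div_lt_one h.pos₁] at this
    exact this.trans h.lt_one
  have hs : r * r₃ ≤ 1 :=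
    mul_le_one₀ hrr.le h3.le ((h.lt₃₂.trans h.lt₂₁).trans h.lt_one).le
  have hg0 := geomHead_nonneg (mul_pos hr h3).le n (k : ℤ).natAbs
  have hg : geomHead (r * r₃) n (k : ℤ).natAbs ≤ 1 := by
    unfold geomHead
    split_ifs
    · exact pow_le_one₀ (mul_pos hr h3).le hs
    · exact zero_le_one
  have he := h.norm_sample_error_le hr hr2 hm hpow α (natAbs_lt_of_idx k) (natAbs_lt_of_idx l)
  have hk := h.norm_koopEntry_le hr hr2 k l
  have hsum : ‖weight r k l * sampleCoeff m α (fun z => τ z ^ (k : ℤ)) l‖ ≤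
      (1 + 2 / (1 - r₁)) * (r / r₁) ^ (l : ℤ).natAbs := by
    refine (norm_le_norm_add_norm_sub' _ _).trans ((add_le_add hk he).trans ?_)
    rw [add_mul]
    refine add_le_add (mul_le_mul_of_nonneg_right (pow_le_one₀ hρ hρ1) (by positivity))
      (mul_le_mul_of_nonneg_right ?_ (by positivity))
    rw [mul_assoc]
    refine mul_le_of_le_one_right (by positivity) ?_
    exact mul_le_one₀ (pow_le_one₀ hρ hρ1) hg0 hg
  rw [norm_mul, norm_weight hr, ← laurentM_apply hm] at hsum
  have hrk := pow_pos hr (k : ℤ).natAbs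
  have hrl := pow_pos hr (l : ℤ).natAbs
  rw [← div_eq_mul_inv, div_mul_eq_mul_div, div_le_iff₀ hrk, ← le_div_iff₀' hrl] at hsum
  refine hsum.trans (le_of_eq ?_)
  field_simp

/-- The matrices have arbitrarily small eigenvalues. -/
theorem eventually_exists_small (h : RegularExpansive r₀ r₁ r₂ r₃ τ) (hr : 0 < r)
    (hr2 : r ^ 2 = r₁ * r₂) {m : ℕ → ℕ} (hm : ∀ n, 1 ≤ n → 2 * n < m n)
    (hpow : ∀ n, 1 ≤ n → r₁ ^ m n ≤ (r₂ * r₃) ^ n) (α : ℝ) {ε : ℝ} (hε : 0 < ε) :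
    ∀ᶠ n in atTop, ∃ z ∈ spectrum ℂ (laurentM τ n (m n) α), ‖z‖ < ε := by
  set c := 1 + 2 / (1 - r₁) with hc
  have h4 : 0 < 1 - r₁ := by linarith [h.lt_one]
  have hc0 : 0 < c := by positivity
  set ρ := r / r₁ with hρ
  have hρ0 : 0 < ρ := div_pos hr h.pos₁
  have hρ1 : ρ < 1 := h.rate_lt_one hr hr2
  set s := Real.sqrt ρ with hs
  have hs0 : 0 < s := Real.sqrt_pos.2 hρ0
  have hs1 : s < 1 := by rw [hs, Real.sqrt_lt' one_pos]; simpa using hρ1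
  have hss : s ^ 2 = ρ := Real.sq_sqrt hρ0.le
  -- With n = N + 1 the matrix has size 2N + 1, and the root of that order of the determinant bound
  -- is at most (2N + 1) c s^N, hence at most this null sequence.
  have hlim : Tendsto (fun n : ℕ => 2 * c / s * (n * s ^ n)) atTop (𝓝 0) := by
    simpa using (tendsto_self_mul_const_pow_of_lt_one hs0.le hs1).const_mul (2 * c / s)
  filter_upwards [hlim.eventually_lt_const hε, eventually_ge_atTop 1] with n hn hn1
  by_contra! hcon
  have hlow := pow_card_le_norm_det _ hε.le hcon
  have hup := norm_det_le (laurentM τ n (m n) α) (c := c) (fun k => pow_pos hr (k : ℤ).natAbs)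
    (fun l => mul_pos (inv_pos.2 (pow_pos hr (l : ℤ).natAbs)) (pow_pos hρ0 (l : ℤ).natAbs))
    (h.norm_laurentM_le hr hr2 (hm n hn1) (hpow n hn1) α)
  have hprod : ∏ k : Idx n, (r ^ (k : ℤ).natAbs *
      ((r ^ (k : ℤ).natAbs)⁻¹ * ρ ^ (k : ℤ).natAbs)) = ρ ^ (n * (n - 1)) := by
    rw [← sum_natAbs_idx, ← Finset.prod_pow_eq_pow_sum]
    exact Finset.prod_congr rfl fun k _ => mul_inv_cancel_left₀ (pow_pos hr _).ne' _
  rw [hprod] at hup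
  have hle := hlow.trans hup
  obtain ⟨N, rfl⟩ : ∃ N, n = N + 1 := ⟨n - 1, by omega⟩
  rw [card_idx, show 2 * (N + 1) - 1 = 2 * N + 1 by omega, Nat.add_sub_cancel] at hle
  -- In terms of s = √ρ the left exponent is 2N(N + 1) ≥ N(2N + 1); the weaker power is a perfect
  -- (2N + 1)-st power, so that roots can be taken.
  have hρs : ρ ^ ((N + 1) * N) ≤ (s ^ N) ^ (2 * N + 1) := by
    rw [← hss, ← pow_mul, ← pow_mul]
    refine pow_le_pow_of_le_one hs0.le hs1.le ?_
    nlinarith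
  have hle2 : ε ^ (2 * N + 1) ≤ (((2 * N + 1 : ℕ) : ℝ) * c * s ^ N) ^ (2 * N + 1) := by
    rw [mul_pow, mul_pow]
    exact hle.trans (mul_le_mul_of_nonneg_left hρs (by positivity))
  have hle3 := le_of_pow_le_pow_left₀ (by omega) (by positivity) hle2
  refine absurd hn (not_lt.2 (hle3.trans ?_))
  have : 2 * c / s * (((N + 1 : ℕ) : ℝ) * s ^ (N + 1)) = (2 * (N + 1)) * c * s ^ N := by
    rw [pow_succ]; push_cast; field_simp
  rw [this]
  gcongr
  push_cast
  linarith

end RegularExpansive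

end SmallEigenvalues

end EDMD

end

noncomputable section

namespace EDMD

/-! ### Convergence and rates for the EDMD matrices -/

section Convergence

variable {r r₀ r₁ r₂ r₃ : ℝ} {τ : ℂ → ℂ}

theorem exists_nearest_mem_spectrum {n : ℕ} (hn : 1 ≤ n) (A : Matrix (Idx n) (Idx n) ℂ) (mu : ℂ) :
    ∃ z ∈ spectrum ℂ A, ∀ w ∈ spectrum ℂ A, ‖z - mu‖ ≤ ‖w - mu‖ := by
  have : Nonempty (Idx n) := ⟨⟨0, mem_idx_of_natAbs_lt (Int.natAbs_zero.trans_lt hn)⟩⟩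
  exact Set.exists_min_image _ (fun z => ‖z - mu‖) A.finite_spectrum
    (spectrum.nonempty_of_isAlgClosed_of_finiteDimensional ℂ A)

/-- Taking an eigenvalue nearest to mu makes one choice serve all η at once. -/
theorem exists_tendsto_of_eventually_near {A : (n : ℕ) → Matrix (Idx n) (Idx n) ℂ} {mu : ℂ}
    (h : ∀ η > 0, ∀ᶠ n in atTop, ∃ z ∈ spectrum ℂ (A n), ‖z - mu‖ < η) :
    ∃ lam : ℕ → ℂ, (∀ n, 1 ≤ n → lam n ∈ spectrum ℂ (A n)) ∧ Tendsto lam atTop (𝓝 mu) := by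
  have hex : ∀ n, ∃ z, 1 ≤ n →
      z ∈ spectrum ℂ (A n) ∧ ∀ w ∈ spectrum ℂ (A n), ‖z - mu‖ ≤ ‖w - mu‖ := by
    intro n
    by_cases hn : 1 ≤ n
    · obtain ⟨z, hz⟩ := exists_nearest_mem_spectrum hn (A n) mu
      exact ⟨z, fun _ => hz⟩
    · exact ⟨0, fun hn' => absurd hn' hn⟩
  choose lam hlam using hex
  refine ⟨lam, fun n hn => (hlam n hn).1, Metric.tendsto_atTop'.2 fun η hη => ?_⟩
  obtain ⟨N, hN⟩ := eventually_atTop.1 (h η hη)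
  refine ⟨N, fun n hn => ?_⟩
  obtain ⟨w, hw, hwη⟩ := hN n hn.le
  rw [dist_eq_norm]
  exact ((hlam n (by omega)).2 w hw).trans_lt hwη

theorem isBigO_rpow_of_pow_le {a b : ℕ → ℝ} {K : ℝ} {p : ℕ} (hp : p ≠ 0) (ha : ∀ n, 0 ≤ a n)
    (hb : ∀ n, 0 ≤ b n) (hK : 0 ≤ K) (h : ∀ᶠ n in atTop, a n ^ p ≤ K * b n) :
    a =O[atTop] fun n => b n ^ (p : ℝ)⁻¹ := by
  refine Asymptotics.IsBigO.of_bound (K ^ (p : ℝ)⁻¹) ?_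
  filter_upwards [h] with n hn
  rw [Real.norm_of_nonneg (ha n), Real.norm_of_nonneg (Real.rpow_nonneg (hb n) _),
    ← Real.mul_rpow hK (hb n), ← Real.pow_rpow_inv_natCast (ha n) hp]
  exact Real.rpow_le_rpow (pow_nonneg (ha n) p) hn (by positivity)

theorem ascent_ne_zero {H : Type*} [NormedAddCommGroup H] [InnerProductSpace ℂ H]
    {T : H →L[ℂ] H} {mu : ℂ} {p : ℕ} (hev : Module.End.HasEigenvalue (T : H →ₗ[ℂ] H) mu)
    (hp : ∀ x, (shift T mu ^ p) x = 0 ↔ (shift T mu ^ (p + 1)) x = 0) : p ≠ 0 := by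
  rintro rfl
  obtain ⟨f, hf, hf0⟩ := hev.exists_hasEigenvector
  rw [Module.End.mem_eigenspace_iff] at hf
  have hf' : T f = mu • f := hf
  refine hf0 ((hp f).2 ?_)
  rw [zero_add, pow_one, shift_apply, hf', sub_self]

namespace RegularExpansive

/-- Both log r₂ and log r₃ lie below log r₁ < 0, so the oversampling factor exceeds 2. -/
theorem two_mul_lt_of_log (h : RegularExpansive r₀ r₁ r₂ r₃ τ) {n m : ℕ} (hn : 1 ≤ n)
    (hm : Real.log (r₂ * r₃) / Real.log r₁ * n ≤ m) : 2 * n < m := by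
  have hlog := Real.log_neg h.pos₁ h.lt_one
  have h2 : Real.log r₂ < Real.log r₁ := Real.log_lt_log h.pos₂ h.lt₂₁
  have h3 : Real.log r₃ < Real.log r₁ := Real.log_lt_log h.pos₃ (h.lt₃₂.trans h.lt₂₁)
  have hq : 2 < Real.log (r₂ * r₃) / Real.log r₁ := by
    rw [lt_div_iff_of_neg hlog, Real.log_mul h.pos₂.ne' h.pos₃.ne']
    linarith
  have hn' : (0 : ℝ) < n := by exact_mod_cast hn
  have : (2 : ℝ) * n < m := (mul_lt_mul_of_pos_right hq hn').trans_le hm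
  exact_mod_cast this

theorem pow_le_of_log (h : RegularExpansive r₀ r₁ r₂ r₃ τ) {n m : ℕ}
    (hm : Real.log (r₂ * r₃) / Real.log r₁ * n ≤ m) : r₁ ^ m ≤ (r₂ * r₃) ^ n := by
  have hlog := Real.log_neg h.pos₁ h.lt_one
  rw [← Real.log_le_log_iff (pow_pos h.pos₁ m) (pow_pos (mul_pos h.pos₂ h.pos₃) n),
    Real.log_pow, Real.log_pow]
  have := mul_le_mul_of_nonpos_right hm hlog.le
  rwa [div_mul_eq_mul_div, div_mul_cancel₀ _ hlog.ne, mul_comm (Real.log _)] at this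

theorem rate_sq (h : RegularExpansive r₀ r₁ r₂ r₃ τ) (hr2 : r ^ 2 = r₁ * r₂) :
    r₂ / r₁ = (r / r₁) ^ 2 := by
  have := h.pos₁.ne'
  rw [div_pow, hr2]
  field_simp

theorem rpow_half (h : RegularExpansive r₀ r₁ r₂ r₃ τ) (hr : 0 < r) (hr2 : r ^ 2 = r₁ * r₂)
    (n : ℕ) : (r₂ / r₁) ^ ((n : ℝ) / 2) = (r / r₁) ^ n := by
  rw [h.rate_sq hr2, ← Real.rpow_natCast, ← Real.rpow_mul (div_pos hr h.pos₁).le,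
    ← Real.rpow_natCast]
  congr 1
  push_cast
  ring

theorem isCompactOperator_koopOp (h : RegularExpansive r₀ r₁ r₂ r₃ τ) (hr : 0 < r)
    (hr2 : r ^ 2 = r₁ * r₂) : IsCompactOperator (koopOp r τ) :=
  isCompactOperator_colOp (h.summable_koopCol hr hr2)

theorem not_hasEigenvalue_zero (h : RegularExpansive r₀ r₁ r₂ r₃ τ) (hr : 0 < r)
    (hr2 : r ^ 2 = r₁ * r₂) :
    ¬ Module.End.HasEigenvalue (koopOp r τ : ElTwo →ₗ[ℂ] ElTwo) 0 := by
  intro hev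
  obtain ⟨f, hf, hf0⟩ := hev.exists_hasEigenvector
  rw [Module.End.mem_eigenspace_iff, zero_smul] at hf
  exact hf0 (h.koopOp_injective hr hr2 hf)

theorem exists_isBigO_approxOp (h : RegularExpansive r₀ r₁ r₂ r₃ τ) (hr : 0 < r)
    (hr2 : r ^ 2 = r₁ * r₂) {m : ℕ → ℕ} (hm : ∀ n, 1 ≤ n → 2 * n < m n)
    (hpow : ∀ n, 1 ≤ n → r₁ ^ m n ≤ (r₂ * r₃) ^ n) (α : ℝ) :
    ∃ K > 0, ∀ᶠ n in atTop, ‖approxOp r τ n (m n) α - koopOp r τ‖ ≤ K * (r / r₁) ^ n := by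
  obtain ⟨K, hK, hle⟩ := h.exists_norm_approxOp_sub_le hr hr2
  refine ⟨K, hK, ?_⟩
  filter_upwards [eventually_ge_atTop 1] with n hn
  exact hle (hm n hn) (hpow n hn) α

theorem tendsto_norm_approxOp_sub (h : RegularExpansive r₀ r₁ r₂ r₃ τ) (hr : 0 < r)
    (hr2 : r ^ 2 = r₁ * r₂) {m : ℕ → ℕ} (hm : ∀ n, 1 ≤ n → 2 * n < m n)
    (hpow : ∀ n, 1 ≤ n → r₁ ^ m n ≤ (r₂ * r₃) ^ n) (α : ℝ) :
    Tendsto (fun n => ‖approxOp r τ n (m n) α - koopOp r τ‖) atTop (𝓝 0) := by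
  obtain ⟨K, -, hle⟩ := h.exists_isBigO_approxOp hr hr2 hm hpow α
  refine tendsto_of_tendsto_of_tendsto_of_le_of_le' tendsto_const_nhds ?_
    (Eventually.of_forall fun n => norm_nonneg _) hle
  simpa using (tendsto_pow_atTop_nhds_zero_of_lt_one (div_pos hr h.pos₁).le
    (h.rate_lt_one hr hr2)).const_mul K

theorem eventually_exists_near (h : RegularExpansive r₀ r₁ r₂ r₃ τ) (hr : 0 < r)
    (hr2 : r ^ 2 = r₁ * r₂) {m : ℕ → ℕ} (hm : ∀ n, 1 ≤ n → 2 * n < m n)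
    (hpow : ∀ n, 1 ≤ n → r₁ ^ m n ≤ (r₂ * r₃) ^ n) (α : ℝ) {mu : ℂ}
    (hmu : mu ∈ spectrum ℂ (koopOp r τ)) {η : ℝ} (hη : 0 < η) :
    ∀ᶠ n in atTop, ∃ z ∈ spectrum ℂ (laurentM τ n (m n) α), ‖z - mu‖ < η := by
  rcases eq_or_ne mu 0 with rfl | hmu0
  · simpa using h.eventually_exists_small hr hr2 hm hpow α hη
  -- The radius is capped by ‖mu‖ so that the spectral point found is nonzero and therefore belongs
  -- to the matrix.
  · filter_upwards [eventually_exists_mem_spectrum (h.isCompactOperator_koopOp hr hr2)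
      (h.tendsto_norm_approxOp_sub hr hr2 hm hpow α) hmu0 hmu
      (lt_min hη (norm_pos_iff.2 hmu0)), eventually_ge_atTop 1] with n ⟨z, hz, hzη⟩ hn
    refine ⟨z, mem_spectrum_laurentM hr (hm n hn) ?_ hz, hzη.trans_le (min_le_left _ _)⟩
    rintro rfl
    rw [zero_sub, norm_neg] at hzη
    exact absurd (hzη.trans_le (min_le_right _ _)) (lt_irrefl _)

theorem isBigO_eigenvalue (h : RegularExpansive r₀ r₁ r₂ r₃ τ) (hr : 0 < r)
    (hr2 : r ^ 2 = r₁ * r₂) {m : ℕ → ℕ} (hm : ∀ n, 1 ≤ n → 2 * n < m n)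
    (hpow : ∀ n, 1 ≤ n → r₁ ^ m n ≤ (r₂ * r₃) ^ n) {α : ℝ} {mu : ℂ} {lam : ℕ → ℂ}
    (hlam : ∀ n, 1 ≤ n → lam n ∈ spectrum ℂ (laurentM τ n (m n) α))
    (hlim : Tendsto lam atTop (𝓝 mu)) {p : ℕ}
    (hev : Module.End.HasEigenvalue (koopOp r τ : ElTwo →ₗ[ℂ] ElTwo) mu)
    (hp : IsAscent (koopOp r τ) mu p) :
    (fun n : ℕ => ‖mu - lam n‖) =O[atTop]
      (fun n : ℕ => (r₂ / r₁) ^ ((n : ℝ) / (2 * (p : ℝ)))) := by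
  -- Injectivity removes the eigenvalue 0, where the resolvent estimate for compact operators is not
  -- available.
  have hmu : mu ≠ 0 := by
    rintro rfl
    exact h.not_hasEigenvalue_zero hr hr2 hev
  have hp0 : p ≠ 0 := ascent_ne_zero hev hp.1
  obtain ⟨K, hK, hle⟩ := eventually_norm_sub_pow_le (A := fun n => approxOp r τ n (m n) α)
    (h.isCompactOperator_koopOp hr hr2) hmu hp0 hp.1
    ((eventually_ge_atTop 1).mono fun n hn => mem_spectrum_approxOp hr (hm n hn) (hlam n hn)) hlim
  obtain ⟨K', hK', hle'⟩ := h.exists_isBigO_approxOp hr hr2 hm hpow α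
  have hρ := div_pos hr h.pos₁
  have e : ∀ n : ℕ, (r₂ / r₁) ^ ((n : ℝ) / (2 * (p : ℝ))) = ((r / r₁) ^ n) ^ (p : ℝ)⁻¹ := by
    intro n
    rw [← h.rpow_half hr hr2, ← Real.rpow_mul (div_pos h.pos₂ h.pos₁).le]
    congr 1
    rw [div_mul_eq_div_div, div_eq_mul_inv ((n : ℝ) / 2)]
  simp only [e]
  refine isBigO_rpow_of_pow_le hp0 (fun _ => norm_nonneg _) (fun n => (pow_pos hρ n).le)
    (mul_pos hK hK').le ?_
  filter_upwards [hle, hle'] with n h1 h2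
  rw [mul_assoc]
  exact h1.trans (mul_le_mul_of_nonneg_left h2 hK.le)

theorem isBigO_genEigenvector (h : RegularExpansive r₀ r₁ r₂ r₃ τ) (hr : 0 < r)
    (hr2 : r ^ 2 = r₁ * r₂) {m : ℕ → ℕ} (hm : ∀ n, 1 ≤ n → 2 * n < m n)
    (hpow : ∀ n, 1 ≤ n → r₁ ^ m n ≤ (r₂ * r₃) ^ n) {α : ℝ} {mu : ℂ} {P : ElTwo →L[ℂ] ElTwo}
    (hP : IsSpectralProjection (koopOp r τ) mu P) {lam : ℕ → ℂ}
    (hlim : Tendsto lam atTop (𝓝 mu)) {ξ : (n : ℕ) → Idx n → ℂ}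
    (hξ : ∀ n, 1 ≤ n → IsGenEigenvector (laurentM τ n (m n) α).transpose (lam n) (ξ n) ∧
      ∑ k : Idx n, ‖ξ n k‖ ^ 2 * r ^ (2 * (k : ℤ).natAbs) = 1) :
    (fun n : ℕ => ‖P (vecL r (ξ n)) - vecL r (ξ n)‖) =O[atTop]
      (fun n : ℕ => (r₂ / r₁) ^ ((n : ℝ) / 2)) := by
  obtain ⟨K, hK, hle⟩ := eventually_norm_riesz_sub_le hP
    (h.tendsto_norm_approxOp_sub hr hr2 hm hpow α) hlim (x := fun n => vecL r (ξ n)) <| by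
      filter_upwards [eventually_ge_atTop 1] with n hn
      obtain ⟨⟨-, ν, hν⟩, h1⟩ := hξ n hn
      refine ⟨?_, ν, ?_⟩
      · rw [← norm_sq_vecL] at h1
        exact (pow_eq_one_iff_of_nonneg (norm_nonneg _) two_ne_zero).1 h1
      · rw [shift_approxOp_pow_vecL hr (hm n hn), hν, vecL_zero]
  obtain ⟨K', hK', hle'⟩ := h.exists_isBigO_approxOp hr hr2 hm hpow α
  simp only [h.rpow_half hr hr2]
  refine Asymptotics.IsBigO.of_bound (K * K') ?_
  filter_upwards [hle, hle'] with n h1 h2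
  rw [norm_norm, Real.norm_of_nonneg (pow_pos (div_pos hr h.pos₁) n).le, mul_assoc]
  exact h1.trans (mul_le_mul_of_nonneg_left h2 hK.le)

end RegularExpansive

end Convergence

end EDMD

end

/-! ### Assembly of the theorem -/

theorem theorem2p8 (r₁ r₂ r₃ : ℝ) (τ : ℂ → ℂ)
    (hτ : EDMD.HolomorphicallyExpansive r₁ r₂ r₃ τ)
    (hτ₀ : ∀ z ∈ EDMD.annulus r₁, τ z ≠ 0)
    (r : ℝ) (hr : r = Real.sqrt (r₁ * r₂)) :
    ∃ C : EDMD.HardyC r →L[ℂ] EDMD.HardyC r,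
      -- the Koopman operator is well defined and Hilbert-Schmidt
      EDMD.IsKoopman r τ C ∧ (∀ C', EDMD.IsKoopman r τ C' → C' = C) ∧
      EDMD.IsHilbertSchmidt C ∧
      -- its spectrum
      ((spectrum ℂ C).Finite ∨
        ∃ s : ℕ → ℂ, Function.Injective s ∧ (∀ j, s j ≠ 0) ∧ Tendsto s atTop (𝓝 0) ∧
          spectrum ℂ C = Set.range s ∪ {0}) ∧
      (∀ lam ∈ spectrum ℂ C, lam ≠ 0 →
        Module.End.HasEigenvalue (C : EDMD.HardyC r →ₗ[ℂ] EDMD.HardyC r) lam ∧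
        FiniteDimensional ℂ
          (Module.End.maxGenEigenspace (C : EDMD.HardyC r →ₗ[ℂ] EDMD.HardyC r) lam)) ∧
      -- the EDMD approximation
      ∀ (α : ℝ) (m : ℕ → ℕ),
        (∀ n : ℕ, 1 ≤ n → Real.log (r₂ * r₃) / Real.log r₁ * n ≤ m n) →
        (∀ n : ℕ, 1 ≤ n → IsUnit (EDMD.laurentH n (m n) α)) ∧
        -- (a) limits of eigenvalues are spectral points
        (∀ (lam : ℕ → ℂ) (μ : ℂ),
          (∀ n : ℕ, 1 ≤ n → lam n ∈ spectrum ℂ (EDMD.laurentM τ n (m n) α)) →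
          Tendsto lam atTop (𝓝 μ) → μ ∈ spectrum ℂ C) ∧
        -- (b) every spectral point is such a limit, with a rate at eigenvalues of ascent `p`
        (∀ μ ∈ spectrum ℂ C,
          (∃ lam : ℕ → ℂ,
            (∀ n : ℕ, 1 ≤ n → lam n ∈ spectrum ℂ (EDMD.laurentM τ n (m n) α)) ∧
            Tendsto lam atTop (𝓝 μ)) ∧
          (∀ lam : ℕ → ℂ,
            (∀ n : ℕ, 1 ≤ n → lam n ∈ spectrum ℂ (EDMD.laurentM τ n (m n) α)) →
            Tendsto lam atTop (𝓝 μ) →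
            ∀ p : ℕ, Module.End.HasEigenvalue (C : EDMD.HardyC r →ₗ[ℂ] EDMD.HardyC r) μ →
              EDMD.IsAscent C μ p →
              (fun n : ℕ => ‖μ - lam n‖) =O[atTop]
                (fun n : ℕ => (r₂ / r₁) ^ ((n : ℝ) / (2 * (p : ℝ)))))) ∧
        -- (c) generalised eigenvectors of the transposes
        (∀ μ ∈ spectrum ℂ C, μ ≠ 0 →
          (∃ P, EDMD.IsSpectralProjection C μ P) ∧
          ∀ P, EDMD.IsSpectralProjection C μ P →
          ∀ lam : ℕ → ℂ,
            (∀ n : ℕ, 1 ≤ n → lam n ∈ spectrum ℂ (EDMD.laurentM τ n (m n) α)) →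
            Tendsto lam atTop (𝓝 μ) →
          ∀ ξ : (n : ℕ) → EDMD.Idx n → ℂ,
            (∀ n : ℕ, 1 ≤ n →
              EDMD.IsGenEigenvector (EDMD.laurentM τ n (m n) α).transpose (lam n) (ξ n) ∧
              ∑ k : EDMD.Idx n, ‖ξ n k‖ ^ 2 * r ^ (2 * (k : ℤ).natAbs) = 1) →
            (fun n : ℕ => ‖P (EDMD.HardyC.ofLaurent r (EDMD.laurentOfVec (ξ n))) -
                EDMD.HardyC.ofLaurent r (EDMD.laurentOfVec (ξ n))‖) =O[atTop]
              (fun n : ℕ => (r₂ / r₁) ^ ((n : ℝ) / 2))) := by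
  obtain ⟨r₀, h⟩ := hτ.exists_regular hτ₀
  have hr0 : 0 < r := hr ▸ Real.sqrt_pos.2 (mul_pos h.pos₁ h.pos₂)
  have hr2 : r ^ 2 = r₁ * r₂ := by rw [hr, Real.sq_sqrt (mul_pos h.pos₁ h.pos₂).le]
  have hcpt := h.isCompactOperator_koopOp hr0 hr2
  have hkoop := h.isKoopman_koopOp hr0 hr2
  refine ⟨EDMD.koopOp r τ, hkoop, fun C' hC' => EDMD.isKoopman_unique hr0 hkoop hC',
    h.isHilbertSchmidt_koopOp hr0 hr2, EDMD.spectrum_finite_or_sequence hcpt,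
    fun lam hlam h0 => ⟨(hcpt.hasEigenvalue_iff_mem_spectrum h0).2 hlam,
      EDMD.finiteDimensional_maxGenEigenspace hcpt h0⟩, fun α m hm => ?_⟩
  have hm2 := fun n hn => h.two_mul_lt_of_log hn (hm n hn)
  have hpow := fun n hn => h.pow_le_of_log (hm n hn)
  refine ⟨fun n hn => ?_, fun lam μ hlam hlim => ?_, fun μ hμ => ⟨?_, ?_⟩,
    fun μ hμ hμ0 => ⟨?_, ?_⟩⟩
  · rw [EDMD.laurentH_eq_one (hm2 n hn)]
    exact isUnit_one
  · exact EDMD.mem_spectrum_of_tendsto (h.tendsto_norm_approxOp_sub hr0 hr2 hm2 hpow α)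
      ((eventually_ge_atTop 1).mono fun n hn =>
        EDMD.mem_spectrum_approxOp hr0 (hm2 n hn) (hlam n hn)) hlim
  · exact EDMD.exists_tendsto_of_eventually_near fun η hη =>
      h.eventually_exists_near hr0 hr2 hm2 hpow α hμ hη
  · intro lam hlam hlim p hev hp
    exact h.isBigO_eigenvalue hr0 hr2 hm2 hpow hlam hlim hev hp
  · obtain ⟨ε, hε, -, hiso⟩ := EDMD.exists_isolating_radius hcpt hμ0 hμ one_pos
    exact ⟨_, ε, hε, hiso, rfl⟩
  · intro P hP lam _ hlim ξ hξ
    exact h.isBigO_genEigenvector hr0 hr2 hm2 hpow hP hlim hξ
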